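/- Let $L,\mu,\rho_1,\rho_2>0$, $\Lambda=(0,L)\times\mathbb R$, let $S_1\subset\mathbb R^2$ be the unit circle, and let $\eta_\varepsilon$ satisfy $\eta_\varepsilon\to\infty$ and $\varepsilon^{1/2}\eta_\varepsilon^6\to0$ as $\varepsilon\to0^+$. For $v\in S_1$ and $\rho\in[-1,1]$ let $v'=v-2(n\cdot v)n$, where $n=n(\rho,v)$ is the outward unit normal at the point where a particle of velocity $v$ hits a hard disk with (signed, normalized) impact parameter $\rho$, and put $\mathcal L f(v)=\mu\int_{-1}^1[f(v')-f(v)]\,d\rho$. Consider the stationary linear Boltzmann equation $$v\cdot\nabla_x h=\eta_\varepsilon\mathcal L h\ \text{ in }\Lambda\times S_1,\qquad h=\rho_1\ \text{ if } x_1=0,\ v_1>0,\qquad h=\rho_2\ \text{ if } x_1=L,\ v_1<0. \tag{1}$$ A function $h\in L^\infty(\Lambda\times S_1)$ solves (1) if it does so along characteristics: for almost every $(x,v)\in\Lambda\times S_1$, $$h(x,v)=f_B(x-Tv,v)+\int_0^{T}\eta_\varepsilon(\mathcal L h)(x-sv,v)\,ds,$$ where $T=T(x,v)$ is the time at which the backward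 ray $x-sv$ leaves $\Lambda$, and $f_B$ is the boundary datum: $f_B=\rho_1$ for $x_1=0$, $v_1>0$ and $f_B=\rho_2$ for $x_1=L$, $v_1<0$. For $t\ge t_1\ge\dots\ge t_N\ge0$ and $r_1,\dots,r_N\in[-1,1]$ let $\gamma^{-s}(x,v)$, $0\le s\le t$, be the backward trajectory from $(x,v)$ that flies freely except for collisions at the times $t_i$ (backward times $t-t_i$), where the velocity $w$ becomes $w'$ for the impact parameter $r_i$; let $t-\tau$ be the first backward time in $[0,t]$ at which its position is on $\partial\Lambda$, with $\tau=0$ if there is none. Write $\kappa=\mu\eta_\varepsilon$ and $t_0:=t$ when $N=0$ in $\{\tau<t_N\}$. Define, for $\ell\in L^\infty(\mathbb R^2\times S_1)$, $$S_\varepsilon^0(t)\ell(x,v)=\chi_\Lambda(x)\sum_{N\ge0}e^{-2\kappa t}\kappa^N\int_0^tdt_1\cdots\int_0^{t_{N-1}}dt_N\int_{[-1,1]^N}dr\ \chi(\tau=0)\,\ell(\gamma^{-t}(x,v)),$$ $$h^{out}_\varepsilon(t)(x,v)=\chi_\Lambda(x)\sum_{N\ge0}\kappa^N\int_0^tdt_1\cdots\int_0^{t_{N-1}}dt_N\int_{[-1,1]^N}dr\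 \chi(\tau<t_N)\chi(\tau>0)\,e^{-2\kappa(t-\tau)}f_B(\gamma^{-(t-\tau)}(x,v)).$$ **Proposition.** There are $\alpha\in[0,1)$ and $\varepsilon_0>0$ such that for every $\varepsilon\in(0,\varepsilon_0)$: 1. for every $\ell_0\in L^\infty(\mathbb R^2\times S_1)$ one has $S^0_\varepsilon(\eta_\varepsilon)\ell_0\in L^\infty(\mathbb R^2\times S_1)$ and $\|S^0_\varepsilon(\eta_\varepsilon)\ell_0\|_\infty\le\alpha\|\ell_0\|_\infty$; 2. there is a unique (up to null sets) $h^S_\varepsilon\in L^\infty(\Lambda\times S_1)$ solving (1), and the Neumann series $\sum_{n\ge0}(S^0_\varepsilon(\eta_\varepsilon))^nh^{out}_\varepsilon(\eta_\varepsilon)$ converges to $h^S_\varepsilon$ in $L^\infty(\Lambda\times S_1)$. -/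

import Mathlib

open MeasureTheory Filter Topology
open scoped ENNReal

noncomputable section

namespace SlabBoltzmann

/-- The plane `ℝ²`, with its Euclidean norm. -/
abbrev Plane : Type := EuclideanSpace ℝ (Fin 2)

/-- The unit circle `S₁` of velocities. -/
abbrev S1 : Type := Metric.sphere (0 : Plane) 1

/-- The extended phase space `ℝ² × S₁`. -/
abbrev Phase : Type := Plane × S1

/-- Lebesgue measure times arc length on `ℝ² × S₁`. -/
def phaseMeasure : Measure Phase :=
  (volume : Measure Plane).prod (volume : Measure Plane).toSphere

/-- The open strip `Λ = (0, L) × ℝ`. -/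
def slab (L : ℝ) : Set Plane := {x | 0 < x 0 ∧ x 0 < L}

/-- The boundary of the strip, `{0} × ℝ ∪ {L} × ℝ`. -/
def slabBoundary (L : ℝ) : Set Plane := {x | x 0 = 0 ∨ x 0 = L}

/-- The phase space `Λ × S₁`. -/
def slabPhase (L : ℝ) : Set Phase := {z | z.1 ∈ slab L}

/-- The measure of `Λ × S₁`. -/
def slabMeasure (L : ℝ) : Measure Phase := phaseMeasure.restrict (slabPhase L)

/-- Scaling: `η_ε → ∞` and `ε^(1/2) η_ε^6 → 0` as `ε → 0⁺`. -/
def SlowlyDiverging (η : ℝ → ℝ) : Prop :=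
  Tendsto η (𝓝[>] 0) atTop ∧
    Tendsto (fun ε : ℝ => ε ^ (1 / 2 : ℝ) * η ε ^ 6) (𝓝[>] 0) (𝓝 0)

/-! ### Collisions with a hard disk -/

/-- The rotation of a vector by `π / 2`. -/
def perp (v : Plane) : Plane := !₂[-(v 1), v 0]

/-- The outward unit normal at the point where a particle of velocity `v` hits a disk of radius
one with impact parameter `ρ ∈ [-1, 1]`; the angle from `-v` to the normal has sine `ρ`. -/
def normal (ρ : ℝ) (v : Plane) : Plane := -(Real.sqrt (1 - ρ ^ 2) • v) - ρ • perp v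

/-- The velocity `v'` after the collision: the reflection of `v` in the line orthogonal to the
normal, see `scatter_eq` for the formula `v' = v - 2 (n ⬝ v) n`. -/
def scatter (ρ : ℝ) (v : S1) : S1 :=
  ⟨(Submodule.span ℝ {normal ρ v})ᗮ.reflection (v : Plane), by
    rw [mem_sphere_zero_iff_norm, LinearIsometryEquiv.norm_map]
    exact mem_sphere_zero_iff_norm.1 v.2⟩

theorem norm_normal {ρ : ℝ} (hρ : ρ ∈ Set.Icc (-1 : ℝ) 1) (v : S1) :
    ‖normal ρ v‖ = 1 := by
  have hv : ‖(v : Plane)‖ = 1 := mem_sphere_zero_iff_norm.1 v.2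
  have hv2 : (v : Plane) 0 ^ 2 + (v : Plane) 1 ^ 2 = 1 := by
    have h := EuclideanSpace.norm_sq_eq (v : Plane)
    rw [hv] at h
    simpa [Fin.sum_univ_two] using h.symm
  have hs : Real.sqrt (1 - ρ ^ 2) ^ 2 = 1 - ρ ^ 2 :=
    Real.sq_sqrt (by nlinarith [hρ.1, hρ.2])
  have hn : ‖normal ρ v‖ ^ 2 = 1 := by
    rw [EuclideanSpace.norm_sq_eq]
    simp only [normal, perp, Fin.sum_univ_two, Real.norm_eq_abs, sq_abs]
    simp
    linear_combination (Real.sqrt (1 - ρ ^ 2) ^ 2 + ρ ^ 2) * hv2 + hs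
  nlinarith [norm_nonneg (normal ρ v)]

theorem scatter_eq {ρ : ℝ} (hρ : ρ ∈ Set.Icc (-1 : ℝ) 1) (v : S1) :
    (scatter ρ v : Plane) =
      (v : Plane) - (2 * inner ℝ (normal ρ v) (v : Plane)) • normal ρ v := by
  have hn := norm_normal hρ v
  simp only [scatter]
  rw [Submodule.reflection_orthogonal_apply, Submodule.reflection_singleton_apply, hn]
  simp [two_smul, two_mul, add_smul]

/-- The linear Boltzmann operator
`(𝓛 h)(x, v) = μ ∫_{-1}^{1} (h(x, v') - h(x, v)) dρ`. -/
def boltzmannOp (μ : ℝ) (h : Phase → ℝ) (z : Phase) : ℝ :=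
  μ * ∫ ρ in (-1 : ℝ)..1, (h (z.1, scatter ρ z.2) - h z)

/-! ### Backward trajectories -/

/-- `backward t z c s` is the position and velocity `γ^{-s}(z)` at backward time `s ∈ [0, t]`,
started from `z` at time `t`, with collisions at the times `t ≥ t₁ ≥ t₂ ≥ … ≥ t_N ≥ 0` with impact
parameters `ρ₁, …, ρ_N`, for `c = [(t₁, ρ₁), …, (t_N, ρ_N)]`. In particular the position of
`γ^{-t}(x, v)` is `x - v (t - t₁) - v₁ (t₁ - t₂) - … - v_N t_N` and its velocity is `v_N`. -/
def backward : ℝ → Phase → List (ℝ × ℝ) → ℝ → Phase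
  | _, z, [], s => (z.1 - s • (z.2 : Plane), z.2)
  | t, z, (t₁, ρ₁) :: c, s =>
      if s < t - t₁ then (z.1 - s • (z.2 : Plane), z.2)
      else backward t₁ (z.1 - (t - t₁) • (z.2 : Plane), scatter ρ₁ z.2) c (s - (t - t₁))

/-- The time `t_N` of the last entry of the list of collisions (`t` if there is none). -/
def lastTime : ℝ → List (ℝ × ℝ) → ℝ
  | t, [] => t
  | _, (t₁, _) :: c => lastTime t₁ c

/-- The backward times in `[0, t]` at which the trajectory is on the boundary of the strip. -/
def hittingTimes (L t : ℝ) (z : Phase) (c : List (ℝ × ℝ)) : Set ℝ :=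
  {s | s ∈ Set.Icc 0 t ∧ (backward t z c s).1 ∈ slabBoundary L}

open Classical in
/-- The number `τ` such that `t - τ` is the first backward hitting time with the boundary;
`τ = 0` if the backward trajectory does not hit the boundary. -/
def tau (L t : ℝ) (z : Phase) (c : List (ℝ × ℝ)) : ℝ :=
  if (hittingTimes L t z c).Nonempty then t - sInf (hittingTimes L t z c) else 0

/-- `∫_0^t dt₁ ∫_{-1}^1 dρ₁ ∫_0^{t₁} dt₂ ∫_{-1}^1 dρ₂ … ∫_0^{t_{N-1}} dt_N ∫_{-1}^1 dρ_N F`,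
with `F` evaluated at `[(t₁, ρ₁), …, (t_N, ρ_N)]`. -/
def collisionIntegral : ℕ → ℝ → (List (ℝ × ℝ) → ℝ) → ℝ
  | 0, _, F => F []
  | N + 1, t, F =>
      ∫ t₁ in (0 : ℝ)..t, ∫ ρ₁ in (-1 : ℝ)..1,
        collisionIntegral N t₁ (fun c => F ((t₁, ρ₁) :: c))

/-! ### The interior semigroup and the boundary contribution

Below `κ` is the number `μ η_ε`; the total collision rate is `2 κ`. -/

open Classical in
/-- The semigroup `S⁰(t)` of the trajectories that do not leave `Λ`, acting on functions on
`ℝ² × S₁`. -/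
def semigroup (L κ t : ℝ) (ℓ : Phase → ℝ) : Phase → ℝ :=
  (slabPhase L).indicator fun z =>
    ∑' N : ℕ, Real.exp (-2 * κ * t) * κ ^ N *
      collisionIntegral N t (fun c => if tau L t z c = 0 then ℓ (backward t z c t) else 0)

open Classical in
/-- The reservoir data: `ρ₁` for particles entering from the left, `ρ₂` for particles entering
from the right. -/
def reservoir (L ρ₁ ρ₂ : ℝ) (z : Phase) : ℝ :=
  if z.1 0 = 0 ∧ 0 < (z.2 : Plane) 0 then ρ₁
  else if z.1 0 = L ∧ (z.2 : Plane) 0 < 0 then ρ₂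
  else 0

open Classical in
/-- The contribution `h^out(t)` of the trajectories coming from the reservoirs, extended by zero
outside `Λ`. -/
def outer (L κ ρ₁ ρ₂ t : ℝ) : Phase → ℝ :=
  (slabPhase L).indicator fun z =>
    ∑' N : ℕ, κ ^ N *
      collisionIntegral N t (fun c =>
        if tau L t z c < lastTime t c ∧ 0 < tau L t z c then
          Real.exp (-2 * κ * (t - tau L t z c)) *
            reservoir L ρ₁ ρ₂ (backward t z c (t - tau L t z c))
        else 0)

/-! ### The stationary equation -/

open Classical in
/-- For `(x, v)` in `Λ × S₁` with `v₁ ≠ 0`, the length of the part of the characteristic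
`s ↦ x - s v` from `x` back to the point where it enters `Λ`. -/
def entryTime (L : ℝ) (z : Phase) : ℝ :=
  if 0 < (z.2 : Plane) 0 then z.1 0 / (z.2 : Plane) 0 else (z.1 0 - L) / (z.2 : Plane) 0

/-- `h` solves `v ⬝ ∇ₓ h = η 𝓛 h` in `Λ × S₁` with the reservoir data on the incoming boundary:
along almost every characteristic, `h` is the integral of `η 𝓛 h` that starts from the reservoir
value at the entry point. Only the values of `h` in `Λ × S₁`, up to null sets, matter (and
velocities with `v₁ = 0`, whose characteristics do not meet the boundary, form a null set). -/
def IsStationarySolution (L μ η ρ₁ ρ₂ : ℝ) (h : Phase → ℝ) : Prop :=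
  ∀ᵐ z ∂(slabMeasure L),
    h z = reservoir L ρ₁ ρ₂ (z.1 - entryTime L z • (z.2 : Plane), z.2) +
      ∫ s in (0 : ℝ)..entryTime L z,
        η * boltzmannOp μ h (z.1 - s • (z.2 : Plane), z.2)

end SlabBoltzmann

end

noncomputable section

namespace SlabBoltzmann

open scoped Pointwise

section

/-! ### Free streaming and scattering -/

/-! Expanding in the number of collisions turns everything into iterates of one positive operator.
`transport` inserts one collision after a free flight inside the strip. Because the strip is convex,
the position at the collision decides whether the flight has left. Hence `S⁰(t)ℓ` is the series of
iterates of `transport` applied to `interiorSeed` (`semigroup_term`), and `h^out(t)` is the same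
series started from `boundarySeed` (`outer_term`). The `N`-th term is of size `(2κt)^N / N!`, so
both series converge.

The contraction says that the survival probability, the series for `ℓ = 1`, stays below some `α < 1`
at time `η`. With `κ = μη` the motion on this time scale is diffusive, with diffusivity of order
`1/κ`, so it leaves a strip of fixed width with probability bounded below. To make this
quantitative, `e^{k x₁ + λt} ψ(v)` is shown to be a subsolution of the evolution, where `ψ` is `1`
plus first and second order corrections in `k/κ` and `λ = k²/(8κ)` (`profile_generator`). A constant
minus a multiple of it is a supersolution (`barrier_supersolution`) that dominates the partial sums
(`sum_iterate_transport_le`). The product `λη = k²/(8μ)` does not depend on `η`, so one large `k`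
serves all large `η` and gives `α = 1 - (4/11) e^{-kL}` (`survival_sum_le`, `exists_survivalBound`).

For the stationary equation, integration along characteristics replaces (1) by its mild form, in
which the value is the boundary contribution plus the contribution of the most recent collision. A
bounded mild solution is the monotone limit of an iteration from zero (`exists_isMildSolution`).
Iterating its identity up to time `t` gives `h = S⁰(t)h + h^out(t)`
(`IsMildSolution.eq_semigroup_add_outer`). The contraction then makes the error of the `m`-th
Neumann sum at most `α^m sup |h|` (`IsMildSolution.tendsto_neumannSum`). Uniqueness uses the same
contraction: the difference of two solutions is dominated by an iteration without reservoirs, whose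
limit is fixed by `S⁰(t)` and therefore zero (`tendsto_decay`).

Elements of `L^∞` are classes while trajectories evaluate representatives. Streaming and collisions
preserve the phase measure, so null sets never accumulate. -/

/-- Free backward streaming for the time `s`. -/
def stream (s : ℝ) (z : Phase) : Phase := (z.1 - s • (z.2 : Plane), z.2)

/-- The change of the velocity in a collision, on phase space. -/
def collideAt (ρ : ℝ) (z : Phase) : Phase := (z.1, scatter ρ z.2)

@[simp] theorem stream_zero (z : Phase) : stream 0 z = z := by simp [stream]

theorem stream_stream (s r : ℝ) (z : Phase) : stream s (stream r z) = stream (r + s) z := by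
  simp [stream, add_smul, sub_sub]

@[simp] theorem stream_fst_zero (s : ℝ) (z : Phase) :
    (stream s z).1 0 = z.1 0 - s * (z.2 : Plane) 0 := by
  simp [stream]

@[simp] theorem stream_snd (s : ℝ) (z : Phase) : (stream s z).2 = z.2 := rfl

theorem sq_add_sq_velocity (v : S1) : (v : Plane) 0 ^ 2 + (v : Plane) 1 ^ 2 = 1 := by
  have hv : ‖(v : Plane)‖ = 1 := mem_sphere_zero_iff_norm.1 v.2
  have h := EuclideanSpace.norm_sq_eq (v : Plane)
  rw [hv] at h
  simpa [Fin.sum_univ_two] using h.symm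

theorem measurable_scatter : Measurable fun p : ℝ × S1 => scatter p.1 p.2 := by
  -- Dividing by the squared norm keeps the formula valid for all real `ρ`, also outside `[-1, 1]`,
  -- where the normal is not a unit vector.
  have h : ∀ p : ℝ × S1, (scatter p.1 p.2 : Plane) =
      -((2 * (inner ℝ (normal p.1 p.2) (p.2 : Plane) / ‖normal p.1 p.2‖ ^ 2)) •
        normal p.1 p.2 - (p.2 : Plane)) := by
    intro p
    simp only [scatter]
    rw [Submodule.reflection_orthogonal_apply, Submodule.reflection_singleton_apply]
    simp [two_mul, two_smul, add_smul]
  have hperp : Measurable perp := by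
    unfold perp
    exact (WithLp.measurable_toLp 2 _).comp
      (measurable_pi_lambda _ fun i => by fin_cases i <;> simp <;> fun_prop)
  have hn : Measurable fun p : ℝ × S1 => normal p.1 p.2 := by
    unfold normal
    have : Measurable fun p : ℝ × S1 => perp (p.2 : Plane) :=
      hperp.comp (measurable_subtype_coe.comp measurable_snd)
    fun_prop
  have hm : Measurable fun p : ℝ × S1 => (scatter p.1 p.2 : Plane) := by
    rw [funext h]
    fun_prop
  exact hm.subtype_mk

theorem measurable_scatter_right (ρ : ℝ) : Measurable (scatter ρ) := by
  have h := measurable_scatter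
  exact Measurable.of_uncurry_left (f := scatter) h

/-- The axis of the reflection turns with `v`, so the map is a rotation by an angle depending on `ρ`
alone. With `ρ = sin β` the coefficients are `-cos 2β` and `sin 2β`. -/
theorem scatter_zero {ρ : ℝ} (hρ : ρ ∈ Set.Icc (-1 : ℝ) 1) (v : S1) :
    (scatter ρ v : Plane) 0 =
      (2 * ρ ^ 2 - 1) * (v : Plane) 0 + 2 * ρ * Real.sqrt (1 - ρ ^ 2) * (v : Plane) 1 := by
  have hs : Real.sqrt (1 - ρ ^ 2) ^ 2 = 1 - ρ ^ 2 := Real.sq_sqrt (by nlinarith [hρ.1, hρ.2])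
  have hv := sq_add_sq_velocity v
  rw [scatter_eq hρ]
  simp [normal, perp, Fin.sum_univ_two, PiLp.inner_apply]
  linear_combination (-2 * (v : Plane) 0 * Real.sqrt (1 - ρ ^ 2) ^ 2 +
    2 * ρ * Real.sqrt (1 - ρ ^ 2) * (v : Plane) 1) * hv - 2 * (v : Plane) 0 * hs

theorem scatter_one {ρ : ℝ} (hρ : ρ ∈ Set.Icc (-1 : ℝ) 1) (v : S1) :
    (scatter ρ v : Plane) 1 =
      (2 * ρ ^ 2 - 1) * (v : Plane) 1 - 2 * ρ * Real.sqrt (1 - ρ ^ 2) * (v : Plane) 0 := by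
  have hs : Real.sqrt (1 - ρ ^ 2) ^ 2 = 1 - ρ ^ 2 := Real.sq_sqrt (by nlinarith [hρ.1, hρ.2])
  have hv := sq_add_sq_velocity v
  rw [scatter_eq hρ]
  simp [normal, perp, Fin.sum_univ_two, PiLp.inner_apply]
  linear_combination (-2 * (v : Plane) 1 * Real.sqrt (1 - ρ ^ 2) ^ 2 -
    2 * ρ * Real.sqrt (1 - ρ ^ 2) * (v : Plane) 0) * hv - 2 * (v : Plane) 1 * hs

/-- The rotation of the plane that acts on the velocities as the collision with impact
parameter `ρ`. -/
def rotation (ρ : ℝ) (x : Plane) : Plane :=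
  (2 * ρ ^ 2 - 1) • x - (2 * ρ * Real.sqrt (1 - ρ ^ 2)) • perp x

theorem coe_scatter {ρ : ℝ} (hρ : ρ ∈ Set.Icc (-1 : ℝ) 1) (v : S1) :
    (scatter ρ v : Plane) = rotation ρ v := by
  ext i
  fin_cases i
  · simp [scatter_zero hρ, rotation, perp]
  · simp [scatter_one hρ, rotation, perp]

/-- The rotation `rotation ρ` as a linear isometry. -/
def rotationEquiv {ρ : ℝ} (hρ : ρ ∈ Set.Icc (-1 : ℝ) 1) : Plane ≃ₗᵢ[ℝ] Plane :=
  LinearIsometry.toLinearIsometryEquiv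
    { toFun := rotation ρ
      map_add' := fun x y => by
        ext i; fin_cases i <;> simp [rotation, perp] <;> ring
      map_smul' := fun c x => by
        ext i; fin_cases i <;> simp [rotation, perp] <;> ring
      norm_map' := fun x => by
        have hs : Real.sqrt (1 - ρ ^ 2) ^ 2 = 1 - ρ ^ 2 :=
          Real.sq_sqrt (by nlinarith [hρ.1, hρ.2])
        have : ‖rotation ρ x‖ ^ 2 = ‖x‖ ^ 2 := by
          rw [EuclideanSpace.norm_sq_eq, EuclideanSpace.norm_sq_eq]
          simp [Fin.sum_univ_two, rotation, perp]
          linear_combination 4 * ρ ^ 2 * (x 0 ^ 2 + x 1 ^ 2) * hs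
        exact (sq_eq_sq₀ (norm_nonneg _) (norm_nonneg _)).1 this } rfl

theorem rotationEquiv_apply {ρ : ℝ} (hρ : ρ ∈ Set.Icc (-1 : ℝ) 1) (x : Plane) :
    rotationEquiv hρ x = rotation ρ x := rfl

/-! ### Invariance of the phase measure -/

/-- A linear isometry that preserves a measure preserves the induced measure on the sphere. -/
theorem measurePreserving_toSphere {E : Type*} [NormedAddCommGroup E] [NormedSpace ℝ E]
    [MeasurableSpace E] [BorelSpace E] {μ : Measure E} (T : E ≃ₗᵢ[ℝ] E)
    (hT : MeasurePreserving T μ μ) {f : Metric.sphere (0 : E) 1 → Metric.sphere (0 : E) 1}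
    (hm : Measurable f) (hf : ∀ v, (f v : E) = T v) :
    MeasurePreserving f μ.toSphere μ.toSphere := by
  refine ⟨hm, ?_⟩
  ext s hs
  rw [Measure.map_apply hm hs, Measure.toSphere_apply' _ (hm hs), Measure.toSphere_apply' _ hs]
  congr 1
  -- `toSphere` measures a set by the volume of the truncated cone over it, and a linear isometry
  -- maps cones to cones.
  have himg : Set.Ioo (0 : ℝ) 1 • ((↑) '' (f ⁻¹' s) : Set E) =
      T ⁻¹' (Set.Ioo (0 : ℝ) 1 • ((↑) '' s : Set E)) := by
    ext x
    simp only [Set.mem_smul, Set.mem_preimage, Set.mem_image]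
    constructor
    · rintro ⟨c, hc, _, ⟨v, hv, rfl⟩, rfl⟩
      exact ⟨c, hc, _, ⟨_, hv, rfl⟩, by rw [map_smul, hf]⟩
    · rintro ⟨c, hc, _, ⟨v, hv, rfl⟩, h⟩
      refine ⟨c, hc, _, ⟨⟨T.symm v, by simp⟩, ?_, rfl⟩, ?_⟩
      · have : f ⟨T.symm v, by simp⟩ = v := by
          apply Subtype.ext
          rw [hf]
          simp
        exact this.symm ▸ hv
      · apply T.injective
        rw [map_smul, ← h]
        simp
  rw [himg]
  exact hT.measure_preimage_emb T.toHomeomorph.measurableEmbedding _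

/-- Arc length on the unit circle. -/
def circleMeasure : Measure S1 := (volume : Measure Plane).toSphere

instance : IsFiniteMeasure circleMeasure := by
  unfold circleMeasure
  infer_instance

theorem phaseMeasure_eq : phaseMeasure = (volume : Measure Plane).prod circleMeasure := rfl

theorem measurePreserving_scatter {ρ : ℝ} (hρ : ρ ∈ Set.Icc (-1 : ℝ) 1) :
    MeasurePreserving (scatter ρ) circleMeasure circleMeasure := by
  have hf : ∀ v : S1, (scatter ρ v : Plane) = rotationEquiv hρ v := fun v => by
    rw [coe_scatter hρ v, rotationEquiv_apply hρ v]
  exact measurePreserving_toSphere _ (rotationEquiv hρ).measurePreserving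
    (measurable_scatter_right ρ) hf

theorem measurable_stream : Measurable fun p : ℝ × Phase => stream p.1 p.2 := by
  unfold stream
  fun_prop

theorem measurable_collideAt : Measurable fun p : ℝ × Phase => collideAt p.1 p.2 := by
  unfold collideAt
  have := measurable_scatter.comp
    (measurable_fst.prodMk (measurable_snd.comp measurable_snd) :
      Measurable fun p : ℝ × Phase => (p.1, p.2.2))
  exact (measurable_fst.comp measurable_snd).prodMk this

instance : SFinite phaseMeasure := by
  rw [phaseMeasure_eq]
  infer_instance

/-- For each fixed velocity this is a translation of the plane, hence a skew product with the
velocity as base. The swaps only put the base first. -/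
theorem measurePreserving_stream (s : ℝ) :
    MeasurePreserving (stream s) phaseMeasure phaseMeasure := by
  have h : MeasurePreserving (fun p : S1 × Plane => (id p.1, p.2 - s • (p.1 : Plane)))
      (circleMeasure.prod (volume : Measure Plane))
      (circleMeasure.prod (volume : Measure Plane)) := by
    refine (MeasurePreserving.id circleMeasure).skew_product (μc := (volume : Measure Plane))
      (μd := volume) (g := fun v x => x - s • (v : Plane)) ?_ ?_
    · simp only [Function.uncurry_def]
      fun_prop
    · refine Eventually.of_forall fun v => ?_
      exact (measurePreserving_sub_right volume (s • (v : Plane))).map_eq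
  have h1 : MeasurePreserving Prod.swap ((volume : Measure Plane).prod circleMeasure)
      (circleMeasure.prod volume) := Measure.measurePreserving_swap
  have h2 : MeasurePreserving Prod.swap (circleMeasure.prod volume)
      ((volume : Measure Plane).prod circleMeasure) := Measure.measurePreserving_swap
  exact h2.comp (h.comp h1)

theorem measurePreserving_collideAt {ρ : ℝ} (hρ : ρ ∈ Set.Icc (-1 : ℝ) 1) :
    MeasurePreserving (collideAt ρ) phaseMeasure phaseMeasure := by
  rw [phaseMeasure_eq]
  exact (MeasurePreserving.id _).prod (measurePreserving_scatter hρ)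

theorem measurableSet_slabPhase (L : ℝ) : MeasurableSet (slabPhase L) := by
  have h : Measurable fun z : Phase => z.1 0 := by fun_prop
  exact (measurableSet_lt measurable_const h).inter (measurableSet_lt h measurable_const)

theorem mem_slabPhase {L : ℝ} {z : Phase} : z ∈ slabPhase L ↔ 0 < z.1 0 ∧ z.1 0 < L := Iff.rfl

theorem collideAt_mem_slabPhase {L ρ : ℝ} {z : Phase} :
    collideAt ρ z ∈ slabPhase L ↔ z ∈ slabPhase L := Iff.rfl

/-- A family of null sets, parametrized by time, is avoided by almost all pairs of a point and its
image under streaming and one collision. -/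
theorem ae_collide_notMem {E : Set (ℝ × Phase)} (hE : MeasurableSet E)
    (hE0 : ∀ r, phaseMeasure {z | (r, z) ∈ E} = 0) {σ : ℝ → ℝ} (hσ : Measurable σ) :
    ∀ᵐ z ∂phaseMeasure, ∀ᵐ p ∂(volume : Measure ℝ).prod (volume.restrict (Set.Ioc (-1 : ℝ) 1)),
      (p.1, collideAt p.2 (stream (σ p.1) z)) ∉ E := by
  have hm : Measurable fun q : Phase × ℝ × ℝ =>
      (q.2.1, collideAt q.2.2 (stream (σ q.2.1) q.1)) := by
    refine (measurable_fst.comp measurable_snd).prodMk (measurable_collideAt.comp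
      ((measurable_snd.comp measurable_snd).prodMk (measurable_stream.comp
        ((hσ.comp (measurable_fst.comp measurable_snd)).prodMk measurable_fst))))
  have hm' : MeasurableSet {q : Phase × ℝ × ℝ |
      (q.2.1, collideAt q.2.2 (stream (σ q.2.1) q.1)) ∉ E} := hm hE.compl
  -- In the other order of integration the time and the impact parameter are fixed, and the map is
  -- measure preserving.
  refine (Measure.ae_ae_comm hm').2 ?_
  have hρ : ∀ᵐ p ∂(volume : Measure ℝ).prod (volume.restrict (Set.Ioc (-1 : ℝ) 1)),
      p.2 ∈ Set.Ioc (-1 : ℝ) 1 :=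
    Measure.quasiMeasurePreserving_snd.ae (ae_restrict_mem measurableSet_Ioc)
  filter_upwards [hρ] with p hp
  have hmp := (measurePreserving_collideAt (Set.Ioc_subset_Icc_self hp)).comp
    (measurePreserving_stream (σ p.1))
  have hs : MeasurableSet {z | (p.1, z) ∈ E} := measurable_prodMk_left hE
  have := hmp.measure_preimage hs.nullMeasurableSet
  rw [hE0] at this
  rw [ae_iff]
  simp only [not_not]
  exact this

end

section

/-! ### The gain operators -/

/-- The integral of `h` over the impact parameter of one collision. -/
def scatterIntegral (h : Phase → ℝ) (z : Phase) : ℝ := ∫ ρ in (-1 : ℝ)..1, h (collideAt ρ z)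

/-- The contribution of one collision at the time `r` to the value at time `t`, for the operator
`transport`. -/
def gain (L κ : ℝ) (F : ℝ → Phase → ℝ) (t : ℝ) (z : Phase) (r : ℝ) : ℝ :=
  κ * Real.exp (-2 * κ * (t - r)) *
    (slabPhase L).indicator (scatterIntegral (F r)) (stream (t - r) z)

/-- One collision, at a time in `[0, t]` and before the exit from the strip, preceded by free
flight. -/
def transport (L κ : ℝ) (F : ℝ → Phase → ℝ) (t : ℝ) (z : Phase) : ℝ :=
  ∫ r in (0 : ℝ)..t, gain L κ F t z r

/-- Joint measurability, and boundedness on `[0, T] × Λ × S₁`. -/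
def BddMeas (L T : ℝ) (F : ℝ → Phase → ℝ) : Prop :=
  Measurable (Function.uncurry F) ∧
    ∃ M, ∀ r ∈ Set.Icc 0 T, ∀ z ∈ slabPhase L, |F r z| ≤ M

/-- Equality outside of a measurable set that is null at each time. -/
def AgreeAE (F F' : ℝ → Phase → ℝ) : Prop :=
  ∃ E : Set (ℝ × Phase), MeasurableSet E ∧ (∀ r, phaseMeasure {z | (r, z) ∈ E} = 0) ∧
    ∀ r z, (r, z) ∉ E → F r z = F' r z

variable {L κ T t : ℝ} {F F' : ℝ → Phase → ℝ} {h h' : Phase → ℝ} {z : Phase}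

theorem measurable_scatterIntegral_uncurry (hF : Measurable (Function.uncurry F)) :
    Measurable fun p : ℝ × Phase => scatterIntegral (F p.1) p.2 := by
  have hm : Measurable fun q : (ℝ × Phase) × ℝ => F q.1.1 (collideAt q.2 q.1.2) :=
    hF.comp ((measurable_fst.comp measurable_fst).prodMk
      (measurable_collideAt.comp (measurable_snd.prodMk (measurable_snd.comp measurable_fst))))
  have := (hm.stronglyMeasurable.integral_prod_right' (ν := volume.restrict
    (Set.Ioc (-1 : ℝ) 1))).measurable
  simpa only [scatterIntegral, intervalIntegral.integral_of_le (show (-1 : ℝ) ≤ 1 by norm_num)]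
    using this

theorem measurable_scatterIntegral (hh : Measurable h) : Measurable (scatterIntegral h) := by
  have : Measurable (Function.uncurry fun _ : ℝ => h) := hh.comp measurable_snd
  exact (measurable_scatterIntegral_uncurry this).comp (measurable_const.prodMk measurable_id :
    Measurable fun z : Phase => ((0 : ℝ), z))

theorem measurable_collideAt_left (z : Phase) : Measurable fun ρ => collideAt ρ z :=
  measurable_collideAt.comp (measurable_id.prodMk measurable_const)

theorem measurable_stream_left (z : Phase) : Measurable fun s => stream s z :=
  measurable_stream.comp (measurable_id.prodMk measurable_const)

theorem intervalIntegrable_of_abs_le {f : ℝ → ℝ} {a b M : ℝ} (hf : Measurable f)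
    (hM : ∀ x ∈ Set.uIoc a b, |f x| ≤ M) : IntervalIntegrable f volume a b := by
  refine IntervalIntegrable.mono_fun' (g := fun _ => M) (by simp) hf.aestronglyMeasurable ?_
  filter_upwards [ae_restrict_mem measurableSet_uIoc] with x hx
  exact hM x hx

theorem intervalIntegrable_collideAt {M : ℝ} (hh : Measurable h)
    (hM : ∀ ρ, |h (collideAt ρ z)| ≤ M) :
    IntervalIntegrable (fun ρ => h (collideAt ρ z)) volume (-1) 1 :=
  intervalIntegrable_of_abs_le (hh.comp (measurable_collideAt_left z)) fun ρ _ => hM ρ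

theorem abs_scatterIntegral_le {M : ℝ} (hM : ∀ ρ, |h (collideAt ρ z)| ≤ M) :
    |scatterIntegral h z| ≤ 2 * M := by
  have := intervalIntegral.norm_integral_le_of_norm_le_const (a := -1) (b := 1) (C := M)
    (f := fun ρ => h (collideAt ρ z)) (fun ρ _ => hM ρ)
  rw [Real.norm_eq_abs] at this
  norm_num at this
  rw [scatterIntegral]
  linarith

theorem scatterIntegral_mono {M : ℝ} (hh : Measurable h) (hh' : Measurable h')
    (hM : ∀ ρ, |h (collideAt ρ z)| ≤ M) (hM' : ∀ ρ, |h' (collideAt ρ z)| ≤ M)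
    (hle : ∀ ρ, h (collideAt ρ z) ≤ h' (collideAt ρ z)) :
    scatterIntegral h z ≤ scatterIntegral h' z :=
  intervalIntegral.integral_mono (by norm_num) (intervalIntegrable_collideAt hh hM)
    (intervalIntegrable_collideAt hh' hM') hle

theorem scatterIntegral_const (c : ℝ) (z : Phase) : scatterIntegral (fun _ => c) z = 2 * c := by
  simp [scatterIntegral]
  norm_num

theorem scatterIntegral_congr (hle : ∀ ρ, h (collideAt ρ z) = h' (collideAt ρ z)) :
    scatterIntegral h z = scatterIntegral h' z := by
  simp only [scatterIntegral, hle]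

theorem measurable_gain (hF : Measurable (Function.uncurry F)) :
    Measurable fun p : (ℝ × Phase) × ℝ => gain L κ F p.1.1 p.1.2 p.2 := by
  have h1 : Measurable fun p : (ℝ × Phase) × ℝ => (p.2, stream (p.1.1 - p.2) p.1.2) :=
    measurable_snd.prodMk (measurable_stream.comp
      (((measurable_fst.comp measurable_fst).sub measurable_snd).prodMk
        (measurable_snd.comp measurable_fst)))
  have h2 : Measurable fun q : ℝ × Phase =>
      (slabPhase L).indicator (scatterIntegral (F q.1)) q.2 := by
    have h3 := (measurable_scatterIntegral_uncurry hF).indicator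
      (measurable_snd (measurableSet_slabPhase L) :
        MeasurableSet (Prod.snd ⁻¹' slabPhase L : Set (ℝ × Phase)))
    exact h3
  have h4 := h2.comp h1
  unfold gain
  refine Measurable.mul ?_ h4
  fun_prop

theorem measurable_transport (hF : Measurable (Function.uncurry F)) :
    Measurable (Function.uncurry (transport L κ F)) := by
  -- Rescaling to `[0, 1]` makes the measure of integration independent of the parameter `t`.
  have h1 : ∀ p : ℝ × Phase, Function.uncurry (transport L κ F) p =
      p.1 * ∫ u in Set.Ioc (0 : ℝ) 1, gain L κ F p.1 p.2 (p.1 * u) := by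
    intro p
    have := intervalIntegral.smul_integral_comp_mul_left (a := 0) (b := 1)
      (gain L κ F p.1 p.2) p.1
    rw [mul_zero, mul_one] at this
    rw [← intervalIntegral.integral_of_le (zero_le_one), ← smul_eq_mul, this]
    rfl
  rw [funext h1]
  refine measurable_fst.mul ?_
  have h2 : Measurable fun q : (ℝ × Phase) × ℝ => gain L κ F q.1.1 q.1.2 (q.1.1 * q.2) :=
    (measurable_gain hF).comp (measurable_fst.prodMk
      ((measurable_fst.comp measurable_fst).mul measurable_snd))
  exact (h2.stronglyMeasurable.integral_prod_right' (ν := volume.restrict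
    (Set.Ioc (0 : ℝ) 1))).measurable

theorem abs_gain_le {r B : ℝ} (hκ : 0 ≤ κ) (hr : r ≤ t) (hB : 0 ≤ B)
    (hF : ∀ w ∈ slabPhase L, |F r w| ≤ B) : |gain L κ F t z r| ≤ 2 * κ * B := by
  have h1 : Real.exp (-2 * κ * (t - r)) ≤ 1 := Real.exp_le_one_iff.2 (by nlinarith)
  have h2 : |(slabPhase L).indicator (scatterIntegral (F r)) (stream (t - r) z)| ≤ 2 * B := by
    by_cases hz : stream (t - r) z ∈ slabPhase L
    · rw [Set.indicator_of_mem hz]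
      exact abs_scatterIntegral_le fun ρ => hF _ (collideAt_mem_slabPhase.2 hz)
    · rw [Set.indicator_of_notMem hz]
      simpa using hB
  rw [gain, abs_mul, abs_mul, abs_of_nonneg hκ, abs_of_pos (Real.exp_pos _)]
  calc κ * Real.exp (-2 * κ * (t - r)) * _ ≤ κ * 1 * (2 * B) := by gcongr
    _ = 2 * κ * B := by ring

theorem measurable_gain_right (hF : Measurable (Function.uncurry F)) (t : ℝ) (z : Phase) :
    Measurable (gain L κ F t z) :=
  (measurable_gain hF).comp (measurable_const.prodMk measurable_id :
    Measurable fun r : ℝ => ((t, z), r))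

theorem BddMeas.intervalIntegrable_gain (hF : BddMeas L T F) (hκ : 0 ≤ κ)
    (ht : t ∈ Set.Icc 0 T) (z : Phase) : IntervalIntegrable (gain L κ F t z) volume 0 t := by
  obtain ⟨hm, M, hM⟩ := hF
  refine intervalIntegrable_of_abs_le (M := 2 * κ * |M|) (measurable_gain_right hm t z)
    fun r hr => ?_
  rw [Set.uIoc_of_le ht.1] at hr
  exact abs_gain_le hκ hr.2 (abs_nonneg _) fun w hw =>
    (hM r ⟨hr.1.le, hr.2.trans ht.2⟩ w hw).trans (le_abs_self M)

/-- A collision costs the factor `2κ`, the rate `κ` times the length of `[-1, 1]`, and one time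
integration, which turns `rⁿ / n!` into `tⁿ⁺¹ / (n + 1)!`. -/
theorem abs_transport_le {M : ℝ} (hκ : 0 ≤ κ) (hM : 0 ≤ M) (n : ℕ) (ht : t ∈ Set.Icc 0 T)
    (hF : ∀ r ∈ Set.Icc 0 T, ∀ w ∈ slabPhase L, |F r w| ≤ M * (2 * κ * r) ^ n / n.factorial) :
    |transport L κ F t z| ≤ M * (2 * κ * t) ^ (n + 1) / (n + 1).factorial := by
  have h1 : ‖transport L κ F t z‖ ≤
      ∫ r in (0 : ℝ)..t, 2 * κ * (M * (2 * κ * r) ^ n / n.factorial) := by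
    refine intervalIntegral.norm_integral_le_of_norm_le ht.1 (ae_of_all _ fun r hr => ?_) ?_
    · have : 0 ≤ 2 * κ * r := by have := hr.1; positivity
      exact abs_gain_le hκ hr.2 (by positivity) (hF r ⟨hr.1.le, hr.2.trans ht.2⟩)
    · exact (by fun_prop : Continuous fun r : ℝ =>
        2 * κ * (M * (2 * κ * r) ^ n / n.factorial)).intervalIntegrable _ _
  refine h1.trans (le_of_eq ?_)
  have h2 : ∀ r : ℝ, 2 * κ * (M * (2 * κ * r) ^ n / n.factorial) =
      (2 * κ * M * (2 * κ) ^ n / n.factorial) * r ^ n := by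
    intro r; rw [mul_pow]; ring
  simp_rw [h2]
  rw [intervalIntegral.integral_const_mul, integral_pow, Nat.factorial_succ]
  push_cast
  have : (n : ℝ) + 1 ≠ 0 := by positivity
  have : (n.factorial : ℝ) ≠ 0 := by positivity
  field_simp
  simp
  ring

theorem BddMeas.transport (hF : BddMeas L T F) (hκ : 0 ≤ κ) :
    BddMeas L T (transport L κ F) := by
  obtain ⟨hm, M, hM⟩ := hF
  refine ⟨measurable_transport hm, |M| * (2 * κ * T), fun r hr w _ => ?_⟩
  have := abs_transport_le (z := w) hκ (abs_nonneg M) 0 hr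
    (fun r hr w hw => by simpa using (hM r hr w hw).trans (le_abs_self M))
  refine this.trans ?_
  have := hr.2
  simp
  gcongr

theorem BddMeas.iterate (hF : BddMeas L T F) (hκ : 0 ≤ κ) (n : ℕ) :
    BddMeas L T ((SlabBoltzmann.transport L κ)^[n] F) := by
  induction n with
  | zero => exact hF
  | succ n ih => rw [Function.iterate_succ_apply']; exact ih.transport hκ

theorem abs_iterate_transport_le {M : ℝ} (hκ : 0 ≤ κ)
    (hF : ∀ r ∈ Set.Icc 0 T, ∀ w ∈ slabPhase L, |F r w| ≤ M) (n : ℕ) (ht : t ∈ Set.Icc 0 T)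
    (hz : z ∈ slabPhase L) :
    |(transport L κ)^[n] F t z| ≤ M * (2 * κ * t) ^ n / n.factorial := by
  have hM : 0 ≤ M := (abs_nonneg _).trans (hF t ht z hz)
  induction n generalizing t z with
  | zero => simpa using hF t ht z hz
  | succ n ih =>
    rw [Function.iterate_succ_apply']
    exact abs_transport_le hκ hM n ht fun r hr w hw => ih hr hw

theorem BddMeas.add (hF : BddMeas L T F) (hF' : BddMeas L T F') :
    BddMeas L T (F + F') := by
  obtain ⟨hm, M, hM⟩ := hF
  obtain ⟨hm', M', hM'⟩ := hF'
  exact ⟨hm.add hm', M + M', fun r hr z hz =>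
    (abs_add_le _ _).trans (add_le_add (hM r hr z hz) (hM' r hr z hz))⟩

theorem BddMeas.intervalIntegrable (hF : BddMeas L T F) {r : ℝ} (hr : r ∈ Set.Icc 0 T)
    (hz : z ∈ slabPhase L) : IntervalIntegrable (fun ρ => F r (collideAt ρ z)) volume (-1) 1 := by
  obtain ⟨hm, M, hM⟩ := hF
  exact intervalIntegrable_collideAt (h := F r) (hm.comp measurable_prodMk_left) fun ρ =>
    hM r hr _ (collideAt_mem_slabPhase.2 hz)

theorem gain_add (hF : BddMeas L T F) (hF' : BddMeas L T F') {r : ℝ} (hr : r ∈ Set.Icc 0 T) :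
    gain L κ (F + F') t z r = gain L κ F t z r + gain L κ F' t z r := by
  rw [gain, gain, gain, ← mul_add]
  congr 1
  by_cases hz : stream (t - r) z ∈ slabPhase L
  · simp only [Set.indicator_of_mem hz]
    exact intervalIntegral.integral_add (hF.intervalIntegrable hr hz)
      (hF'.intervalIntegrable hr hz)
  · simp only [Set.indicator_of_notMem hz, add_zero]

theorem transport_add (hκ : 0 ≤ κ) (hF : BddMeas L T F) (hF' : BddMeas L T F')
    (ht : t ∈ Set.Icc 0 T) :
    transport L κ (F + F') t z = transport L κ F t z + transport L κ F' t z := by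
  rw [transport, transport, transport, ← intervalIntegral.integral_add
    (hF.intervalIntegrable_gain hκ ht z) (hF'.intervalIntegrable_gain hκ ht z)]
  refine intervalIntegral.integral_congr fun r hr => ?_
  rw [Set.uIcc_of_le ht.1] at hr
  exact gain_add hF hF' ⟨hr.1, hr.2.trans ht.2⟩

theorem transport_congr (ht : t ∈ Set.Icc 0 T)
    (h : ∀ r ∈ Set.Icc 0 T, ∀ w ∈ slabPhase L, F r w = F' r w) :
    transport L κ F t z = transport L κ F' t z := by
  refine intervalIntegral.integral_congr fun r hr => ?_
  rw [Set.uIcc_of_le ht.1] at hr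
  simp only [gain]
  congr 1
  by_cases hz : stream (t - r) z ∈ slabPhase L
  · simp only [Set.indicator_of_mem hz]
    exact scatterIntegral_congr fun ρ =>
      h r ⟨hr.1, hr.2.trans ht.2⟩ _ (collideAt_mem_slabPhase.2 hz)
  · simp only [Set.indicator_of_notMem hz]

theorem iterate_transport_congr
    (h : ∀ r ∈ Set.Icc 0 T, ∀ w ∈ slabPhase L, F r w = F' r w) (n : ℕ) (ht : t ∈ Set.Icc 0 T)
    (hz : z ∈ slabPhase L) : (transport L κ)^[n] F t z = (transport L κ)^[n] F' t z := by
  induction n generalizing t z with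
  | zero => exact h t ht z hz
  | succ n ih =>
    rw [Function.iterate_succ_apply', Function.iterate_succ_apply']
    exact transport_congr ht fun r hr w hw => ih hr hw

theorem iterate_transport_add (hκ : 0 ≤ κ) (hF : BddMeas L T F) (hF' : BddMeas L T F') (n : ℕ)
    (ht : t ∈ Set.Icc 0 T) (hz : z ∈ slabPhase L) :
    (transport L κ)^[n] (F + F') t z =
      (transport L κ)^[n] F t z + (transport L κ)^[n] F' t z := by
  induction n generalizing t z with
  | zero => rfl
  | succ n ih =>
    simp only [Function.iterate_succ_apply']
    rw [← transport_add hκ (hF.iterate hκ n) (hF'.iterate hκ n) ht]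
    exact transport_congr ht fun r hr w hw => ih hr hw

theorem transport_mono (hκ : 0 ≤ κ) (hF : BddMeas L T F) (hF' : BddMeas L T F')
    (h : ∀ r ∈ Set.Icc 0 T, ∀ w ∈ slabPhase L, F r w ≤ F' r w) (ht : t ∈ Set.Icc 0 T) :
    transport L κ F t z ≤ transport L κ F' t z := by
  refine intervalIntegral.integral_mono_on ht.1 (hF.intervalIntegrable_gain hκ ht z)
    (hF'.intervalIntegrable_gain hκ ht z) fun r hr => ?_
  have hr' : r ∈ Set.Icc 0 T := ⟨hr.1, hr.2.trans ht.2⟩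
  rw [gain, gain]
  refine mul_le_mul_of_nonneg_left ?_ (by positivity)
  by_cases hz : stream (t - r) z ∈ slabPhase L
  · simp only [Set.indicator_of_mem hz]
    exact intervalIntegral.integral_mono (by norm_num) (hF.intervalIntegrable hr' hz)
      (hF'.intervalIntegrable hr' hz) fun ρ => h r hr' _ (collideAt_mem_slabPhase.2 hz)
  · simp only [Set.indicator_of_notMem hz, le_refl]

theorem iterate_transport_mono (hκ : 0 ≤ κ) (hF : BddMeas L T F) (hF' : BddMeas L T F')
    (h : ∀ r ∈ Set.Icc 0 T, ∀ w ∈ slabPhase L, F r w ≤ F' r w) (n : ℕ) (ht : t ∈ Set.Icc 0 T)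
    (hz : z ∈ slabPhase L) : (transport L κ)^[n] F t z ≤ (transport L κ)^[n] F' t z := by
  induction n generalizing t z with
  | zero => exact h t ht z hz
  | succ n ih =>
    simp only [Function.iterate_succ_apply']
    exact transport_mono hκ (hF.iterate hκ n) (hF'.iterate hκ n) (fun r hr w hw => ih hr hw) ht

/-! ### Transport and null sets -/

theorem scatterIntegral_congr_ae
    (hle : ∀ᵐ ρ ∂volume.restrict (Set.Ioc (-1 : ℝ) 1), h (collideAt ρ z) = h' (collideAt ρ z)) :
    scatterIntegral h z = scatterIntegral h' z := by
  simp only [scatterIntegral, intervalIntegral.integral_of_le (show (-1 : ℝ) ≤ 1 by norm_num)]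
  exact integral_congr_ae hle

/-- The new exceptional set consists of the `(t, z)` from which a positive measure of pairs
(collision time, impact parameter) leads into the old one. It is null at each time by
`ae_collide_notMem`, and off it the two integrands agree almost everywhere. -/
theorem AgreeAE.transport (h : AgreeAE F F') (L κ : ℝ) :
    AgreeAE (transport L κ F) (transport L κ F') := by
  obtain ⟨E, hE, hE0, hEF⟩ := h
  set ν : Measure (ℝ × ℝ) := (volume : Measure ℝ).prod (volume.restrict (Set.Ioc (-1 : ℝ) 1))
  have hm : Measurable fun q : (ℝ × Phase) × ℝ × ℝ =>
      (q.2.1, collideAt q.2.2 (stream (q.1.1 - q.2.1) q.1.2)) := by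
    refine (measurable_fst.comp measurable_snd).prodMk (measurable_collideAt.comp
      ((measurable_snd.comp measurable_snd).prodMk (measurable_stream.comp
        (((measurable_fst.comp measurable_fst).sub (measurable_fst.comp measurable_snd)).prodMk
          (measurable_snd.comp measurable_fst)))))
  refine ⟨{q | ν (Prod.mk q ⁻¹' ((fun q : (ℝ × Phase) × ℝ × ℝ =>
      (q.2.1, collideAt q.2.2 (stream (q.1.1 - q.2.1) q.1.2))) ⁻¹' E)) ≠ 0}, ?_, ?_, ?_⟩
  · exact (measurable_measure_prodMk_left (ν := ν) (hm hE))
      (measurableSet_singleton (0 : ℝ≥0∞)).compl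
  · intro t
    have := ae_collide_notMem hE hE0 (σ := fun r => t - r) (by fun_prop)
    rw [ae_iff] at this
    refine measure_mono_null (fun z hz => ?_) this
    simp only [Set.mem_ofPred_eq] at hz ⊢
    rw [ae_iff]
    simp only [not_not]
    exact hz
  · intro t z hz
    simp only [Set.mem_ofPred_eq, not_not] at hz
    have h1 : ∀ᵐ p ∂ν, (p.1, collideAt p.2 (stream (t - p.1) z)) ∉ E := by
      rw [ae_iff]
      simp only [not_not]
      exact hz
    have h2 := Measure.ae_ae_of_ae_prod h1
    refine intervalIntegral.integral_congr_ae ?_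
    filter_upwards [h2] with r hr _
    simp only [gain]
    congr 1
    by_cases hs : stream (t - r) z ∈ slabPhase L
    · simp only [Set.indicator_of_mem hs]
      exact scatterIntegral_congr_ae (hr.mono fun ρ hρ => hEF _ _ hρ)
    · simp only [Set.indicator_of_notMem hs]

theorem AgreeAE.iterate (h : AgreeAE F F') (L κ : ℝ) (n : ℕ) :
    AgreeAE ((SlabBoltzmann.transport L κ)^[n] F) ((SlabBoltzmann.transport L κ)^[n] F') := by
  induction n with
  | zero => exact h
  | succ n ih => simp only [Function.iterate_succ_apply']; exact ih.transport L κ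

theorem AgreeAE.ae_eq (h : AgreeAE F F') (t : ℝ) : ∀ᵐ z ∂phaseMeasure, F t z = F' t z := by
  obtain ⟨E, hE, hE0, hEF⟩ := h
  rw [ae_iff]
  refine measure_mono_null (fun z hz => ?_) (hE0 t)
  by_contra hc
  exact hz (hEF t z hc)

end

section

/-! ### Collision expansions as iterated transport -/

/-- The phase space over the closed strip. -/
def closedSlabPhase (L : ℝ) : Set Phase := {z | 0 ≤ z.1 0 ∧ z.1 0 ≤ L}

/-- The contribution of free flight during `[0, t]` inside of the strip. -/
def interiorSeed (L κ : ℝ) (ℓ : Phase → ℝ) (t : ℝ) (z : Phase) : ℝ :=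
  (closedSlabPhase L).indicator (fun w => Real.exp (-2 * κ * t) * ℓ w) (stream t z)

/-- The contribution of the free flight from the boundary. -/
def boundaryValue (L κ ρ₁ ρ₂ : ℝ) (z : Phase) : ℝ :=
  Real.exp (-2 * κ * entryTime L z) * reservoir L ρ₁ ρ₂ (stream (entryTime L z) z)

open Classical in
/-- The contribution of the free flight from the boundary during `[0, t]`. -/
def boundarySeed (L κ ρ₁ ρ₂ t : ℝ) (z : Phase) : ℝ :=
  if stream t z ∈ closedSlabPhase L then 0 else boundaryValue L κ ρ₁ ρ₂ z

/-- Decreasing positive collision times, all of them at most `t`. -/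
def IsCollisionList : ℝ → List (ℝ × ℝ) → Prop
  | _, [] => True
  | t, (t₁, _) :: c => t₁ ∈ Set.Ioc 0 t ∧ IsCollisionList t₁ c

variable {L κ t : ℝ} {z : Phase}

theorem mem_slabBoundary {x : Plane} : x ∈ slabBoundary L ↔ x 0 = 0 ∨ x 0 = L := Iff.rfl

theorem mem_closedSlabPhase : z ∈ closedSlabPhase L ↔ 0 ≤ z.1 0 ∧ z.1 0 ≤ L := Iff.rfl

/-- Convexity of the strip: on a segment from the interior to a point of the closure, only the far
end can touch the boundary. -/
theorem stream_mem_slabPhase {s : ℝ} (hz : z ∈ slabPhase L) (hs : 0 ≤ s) (hst : s < t)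
    (ht : stream t z ∈ closedSlabPhase L) : stream s z ∈ slabPhase L := by
  rw [mem_slabPhase] at hz ⊢
  rw [mem_closedSlabPhase] at ht
  rw [stream_fst_zero] at ht ⊢
  have h0 : 0 < t := hs.trans_lt hst
  constructor
  · by_contra hc
    nlinarith [mul_pos (sub_pos.2 hst) hz.1, mul_nonneg hs ht.1]
  · by_contra hc
    nlinarith [mul_pos (sub_pos.2 hst) (sub_pos.2 hz.2), mul_nonneg hs (sub_nonneg.2 ht.2)]

theorem slabPhase_subset_closed : slabPhase L ⊆ closedSlabPhase L := fun _ hz =>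
  ⟨hz.1.le, hz.2.le⟩

theorem notMem_slabBoundary (hz : z ∈ slabPhase L) : z.1 ∉ slabBoundary L := by
  rw [mem_slabPhase] at hz
  rw [mem_slabBoundary]
  rintro (h | h) <;> linarith [hz.1, hz.2]

/-- The exit from the strip, for a free path that leaves it before the time `t`. -/
theorem entryTime_spec (hz : z ∈ slabPhase L) (ht : 0 ≤ t) (hst : stream t z ∉ slabPhase L) :
    (z.2 : Plane) 0 ≠ 0 ∧ 0 < entryTime L z ∧ entryTime L z ≤ t ∧
      (stream (entryTime L z) z).1 ∈ slabBoundary L ∧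
      (stream t z ∉ closedSlabPhase L → entryTime L z < t) ∧
      ∀ s, 0 ≤ s → (stream s z).1 ∈ slabBoundary L → s = entryTime L z := by
  rw [mem_slabPhase] at hz hst
  simp only [mem_closedSlabPhase, mem_slabBoundary]
  simp only [stream_fst_zero] at hst ⊢
  rcases lt_trichotomy ((z.2 : Plane) 0) 0 with hv | hv | hv
  · have h1 : z.1 0 - t * (z.2 : Plane) 0 ≥ L := by
      by_contra hc
      exact hst ⟨by nlinarith [hz.1], not_le.1 hc⟩
    have hmul : entryTime L z * (z.2 : Plane) 0 = z.1 0 - L := by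
      rw [entryTime, if_neg hv.not_gt, div_mul_cancel₀ _ hv.ne]
    refine ⟨hv.ne, ?_, ?_, Or.inr (by linarith), fun h => ?_, fun s hs h => ?_⟩
    · by_contra hc; nlinarith [hz.2]
    · by_contra hc; nlinarith [hz.2]
    · by_contra hc
      exact h ⟨by nlinarith [hz.1], by nlinarith⟩
    · rcases h with h | h
      · nlinarith [hz.1]
      · exact mul_right_cancel₀ hv.ne (by linarith)
  · rw [hv] at hst
    exact absurd ⟨by linarith [hz.1], by linarith [hz.2]⟩ hst
  · have h1 : z.1 0 - t * (z.2 : Plane) 0 ≤ 0 := by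
      by_contra hc
      exact hst ⟨not_le.1 hc, by nlinarith [hz.2]⟩
    have hmul : entryTime L z * (z.2 : Plane) 0 = z.1 0 := by
      rw [entryTime, if_pos hv, div_mul_cancel₀ _ hv.ne']
    refine ⟨hv.ne', ?_, ?_, Or.inl (by linarith), fun h => ?_, fun s hs h => ?_⟩
    · by_contra hc; nlinarith [hz.1]
    · by_contra hc; nlinarith [hz.2]
    · by_contra hc
      exact h ⟨by nlinarith [hz.1], by nlinarith [hz.2]⟩
    · rcases h with h | h
      · exact mul_right_cancel₀ hv.ne' (by linarith)
      · nlinarith [hz.2]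

/-- A path that first meets the boundary exactly at backward time `t` has `τ = t - t = 0` and counts
as interior. This is why `interiorSeed` uses the closed strip. -/
theorem tau_nil_of_mem (hz : z ∈ slabPhase L)
    (hst : stream t z ∈ closedSlabPhase L) : tau L t z [] = 0 := by
  rw [tau]
  split_ifs with h
  · have : hittingTimes L t z [] = {t} := by
      refine Set.eq_singleton_iff_nonempty_unique_mem.2 ⟨h, fun s hs => ?_⟩
      by_contra hne
      exact notMem_slabBoundary (stream_mem_slabPhase hz hs.1.1
        (lt_of_le_of_ne hs.1.2 hne) hst) hs.2
    rw [this, csInf_singleton, sub_self]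
  · rfl

theorem tau_nil_of_notMem (hz : z ∈ slabPhase L) (ht : 0 ≤ t)
    (hst : stream t z ∉ closedSlabPhase L) : tau L t z [] = t - entryTime L z := by
  obtain ⟨-, h1, h2, h3, -, h5⟩ :=
    entryTime_spec hz ht fun h => hst (slabPhase_subset_closed h)
  have : hittingTimes L t z [] = {entryTime L z} := by
    refine Set.eq_singleton_iff_unique_mem.2 ⟨⟨⟨h1.le, h2⟩, h3⟩, fun s hs => ?_⟩
    exact h5 s hs.1.1 hs.2
  rw [tau, this, if_pos (Set.singleton_nonempty _), csInf_singleton]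

theorem lastTime_nil (t : ℝ) : lastTime t [] = t := rfl

theorem backward_nil (t : ℝ) (z : Phase) (s : ℝ) : backward t z [] s = stream s z := rfl

theorem backward_cons_of_lt {t₁ ρ s : ℝ} {c : List (ℝ × ℝ)} (h : s < t - t₁) :
    backward t z ((t₁, ρ) :: c) s = stream s z := by
  rw [backward, if_pos h]
  rfl

theorem backward_cons_of_le {t₁ ρ s : ℝ} {c : List (ℝ × ℝ)} (h : t - t₁ ≤ s) :
    backward t z ((t₁, ρ) :: c) s =
      backward t₁ (collideAt ρ (stream (t - t₁) z)) c (s - (t - t₁)) := by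
  rw [backward, if_neg h.not_gt]
  rfl

/-- A collision may occur at backward time `0` and change the velocity, so only the position is
preserved. -/
theorem backward_zero_fst {c : List (ℝ × ℝ)} (hc : IsCollisionList t c) :
    (backward t z c 0).1 = z.1 := by
  induction c generalizing t z with
  | nil => simp [backward_nil]
  | cons a c ih =>
    obtain ⟨t₁, ρ⟩ := a
    rcases hc.1.2.lt_or_eq with h | h
    · rw [backward_cons_of_lt (sub_pos.2 h), stream_zero]
    · rw [backward_cons_of_le (by linarith), h, sub_self, sub_zero, ← h, ih hc.2]
      simp [collideAt]

theorem lastTime_le {c : List (ℝ × ℝ)} (hc : IsCollisionList t c) : lastTime t c ≤ t := by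
  induction c generalizing t with
  | nil => exact le_rfl
  | cons a c ih => exact (ih hc.2).trans hc.1.2

theorem hittingTimes_bddBelow (L t : ℝ) (z : Phase) (c : List (ℝ × ℝ)) :
    BddBelow (hittingTimes L t z c) := ⟨0, fun _ hs => hs.1.1⟩

/-- No boundary point is met before the first collision, so the hitting times are those of the
restarted trajectory shifted by `t - t₁`. The shift cancels because `τ` is counted from the other
end of the time interval. -/
theorem tau_cons_of_mem {t₁ ρ : ℝ} {c : List (ℝ × ℝ)} (hz : z ∈ slabPhase L)
    (ht₁ : t₁ ∈ Set.Ioc 0 t) (hmem : stream (t - t₁) z ∈ slabPhase L) :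
    tau L t z ((t₁, ρ) :: c) = tau L t₁ (collideAt ρ (stream (t - t₁) z)) c := by
  have hH : hittingTimes L t z ((t₁, ρ) :: c) =
      OrderIso.addLeft (t - t₁) '' hittingTimes L t₁ (collideAt ρ (stream (t - t₁) z)) c := by
    ext s
    constructor
    · intro hs
      have hle : t - t₁ ≤ s := by
        by_contra hlt
        rw [not_le] at hlt
        have h2 := hs.2
        rw [backward_cons_of_lt hlt] at h2
        exact notMem_slabBoundary (stream_mem_slabPhase hz hs.1.1 hlt
          (slabPhase_subset_closed hmem)) h2
      refine ⟨s - (t - t₁), ⟨⟨by linarith, by linarith [hs.1.2]⟩, ?_⟩, ?_⟩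
      · rw [← backward_cons_of_le hle]
        exact hs.2
      · simp
    · rintro ⟨r, hr, rfl⟩
      have h0 := hr.1.1
      have h1 := hr.1.2
      refine ⟨⟨?_, ?_⟩, ?_⟩
      · rw [OrderIso.addLeft_apply]; linarith [ht₁.2]
      · rw [OrderIso.addLeft_apply]; linarith
      · rw [OrderIso.addLeft_apply, backward_cons_of_le (by linarith), add_sub_cancel_left]
        exact hr.2
  rw [tau, tau, hH]
  by_cases hne : (hittingTimes L t₁ (collideAt ρ (stream (t - t₁) z)) c).Nonempty
  · rw [if_pos (hne.image _), if_pos hne, ← OrderIso.map_csInf' _ hne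
      (hittingTimes_bddBelow _ _ _ _), OrderIso.addLeft_apply]
    ring
  · rw [if_neg (Set.image_nonempty.not.2 hne), if_neg hne]

/-- The exit comes no later than the first collision. Since `0 < t₁` and `t_N ≤ t₁`, such lists
violate both `τ = 0` and `τ < t_N`, so they drop out of both series. -/
theorem le_tau_cons_of_notMem {t₁ ρ : ℝ} {c : List (ℝ × ℝ)} (hz : z ∈ slabPhase L)
    (hc : IsCollisionList t ((t₁, ρ) :: c)) (hmem : stream (t - t₁) z ∉ slabPhase L) :
    t₁ ≤ tau L t z ((t₁, ρ) :: c) := by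
  have ht₁ := hc.1
  obtain ⟨-, h1, h2, h3, -, -⟩ := entryTime_spec hz (sub_nonneg.2 ht₁.2) hmem
  have hin : entryTime L z ∈ hittingTimes L t z ((t₁, ρ) :: c) := by
    refine ⟨⟨h1.le, by linarith [ht₁.1]⟩, ?_⟩
    rcases h2.lt_or_eq with h | h
    · rwa [backward_cons_of_lt h]
    · rw [backward_cons_of_le h.ge, h, sub_self, backward_zero_fst hc.2, ← h]
      exact h3
  rw [tau, if_pos ⟨_, hin⟩]
  linarith [csInf_le (hittingTimes_bddBelow L t z _) hin]

theorem collisionIntegral_congr (N : ℕ) (ht : 0 ≤ t) {F G : List (ℝ × ℝ) → ℝ}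
    (h : ∀ c, IsCollisionList t c → F c = G c) :
    collisionIntegral N t F = collisionIntegral N t G := by
  induction N generalizing t F G with
  | zero => exact h [] trivial
  | succ N ih =>
    rw [collisionIntegral, collisionIntegral]
    refine intervalIntegral.integral_congr_ae (ae_of_all _ fun t₁ ht₁ => ?_)
    rw [Set.uIoc_of_le ht] at ht₁
    refine intervalIntegral.integral_congr fun ρ _ => ?_
    exact ih ht₁.1.le fun c hc => h _ ⟨ht₁, hc⟩

theorem collisionIntegral_const_mul (N : ℕ) (t a : ℝ) (F : List (ℝ × ℝ) → ℝ) :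
    collisionIntegral N t (fun c => a * F c) = a * collisionIntegral N t F := by
  induction N generalizing t F with
  | zero => rfl
  | succ N ih =>
    simp only [collisionIntegral]
    simp_rw [ih, intervalIntegral.integral_const_mul]

theorem collisionIntegral_zero (N : ℕ) (t : ℝ) : collisionIntegral N t (fun _ => 0) = 0 := by
  simpa using collisionIntegral_const_mul N t 0 fun _ => 0

/-- A collision integral that can be computed recursively, one collision at a time, is an iterate
of the transport operator. -/
theorem collisionIntegral_eq_iterate_transport {Φ : ℝ → Phase → List (ℝ × ℝ) → ℝ}
    {F : ℝ → Phase → ℝ}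
    (h0 : ∀ t z, 0 ≤ t → z ∈ slabPhase L → Φ t z [] = F t z)
    (hmem : ∀ t z t₁ ρ c, z ∈ slabPhase L → IsCollisionList t ((t₁, ρ) :: c) →
      stream (t - t₁) z ∈ slabPhase L → Φ t z ((t₁, ρ) :: c) =
        Real.exp (-2 * κ * (t - t₁)) * Φ t₁ (collideAt ρ (stream (t - t₁) z)) c)
    (hnot : ∀ t z t₁ ρ c, z ∈ slabPhase L → IsCollisionList t ((t₁, ρ) :: c) →
      stream (t - t₁) z ∉ slabPhase L → Φ t z ((t₁, ρ) :: c) = 0)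
    (N : ℕ) (ht : 0 ≤ t) (hz : z ∈ slabPhase L) :
    κ ^ N * collisionIntegral N t (Φ t z) = (transport L κ)^[N] F t z := by
  induction N generalizing t z with
  | zero => simpa [collisionIntegral] using h0 t z ht hz
  | succ N ih =>
    rw [Function.iterate_succ_apply', transport, collisionIntegral,
      ← intervalIntegral.integral_const_mul]
    refine intervalIntegral.integral_congr_ae (ae_of_all _ fun t₁ ht₁ => ?_)
    rw [Set.uIoc_of_le ht] at ht₁
    simp only [gain]
    by_cases hs : stream (t - t₁) z ∈ slabPhase L
    · rw [Set.indicator_of_mem hs, scatterIntegral, ← intervalIntegral.integral_const_mul,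
        ← intervalIntegral.integral_const_mul]
      refine intervalIntegral.integral_congr fun ρ _ => ?_
      rw [← ih ht₁.1.le (collideAt_mem_slabPhase.2 hs), collisionIntegral_congr N ht₁.1.le
        fun c hc => hmem t z t₁ ρ c hz ⟨ht₁, hc⟩ hs, collisionIntegral_const_mul]
      ring
    · rw [Set.indicator_of_notMem hs, mul_zero]
      simp_rw [fun ρ => collisionIntegral_congr N ht₁.1.le
        fun c hc => hnot t z t₁ ρ c hz ⟨ht₁, hc⟩ hs, collisionIntegral_zero]
      simp

-- With the weight `e^{-2κt}` moved inside the integral, each free flight carries its own factor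
-- `e^{-2κ(t - t₁)}`, as the recursion requires.
open Classical in
theorem semigroup_term (ℓ : Phase → ℝ) (N : ℕ) (ht : 0 ≤ t) (hz : z ∈ slabPhase L) :
    Real.exp (-2 * κ * t) * κ ^ N *
      collisionIntegral N t (fun c => if tau L t z c = 0 then ℓ (backward t z c t) else 0) =
      (transport L κ)^[N] (interiorSeed L κ ℓ) t z := by
  rw [mul_comm (Real.exp _), mul_assoc, ← collisionIntegral_const_mul]
  refine collisionIntegral_eq_iterate_transport (Φ := fun t z c => Real.exp (-2 * κ * t) *
    if tau L t z c = 0 then ℓ (backward t z c t) else 0) ?_ ?_ ?_ N ht hz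
  · intro t z ht hz
    simp only [interiorSeed]
    by_cases hs : stream t z ∈ closedSlabPhase L
    · rw [tau_nil_of_mem hz hs, if_pos rfl, Set.indicator_of_mem hs, backward_nil]
    · have := (entryTime_spec hz ht fun h => hs (slabPhase_subset_closed h)).2.2.2.2.1 hs
      rw [tau_nil_of_notMem hz ht hs, if_neg (by linarith), Set.indicator_of_notMem hs, mul_zero]
  · intro t z t₁ ρ c hz hc hs
    rw [tau_cons_of_mem hz hc.1 hs, backward_cons_of_le (by linarith [hc.1.1]), ← mul_assoc,
      ← Real.exp_add]
    congr 2
    · ring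
    · ring_nf
  · intro t z t₁ ρ c hz hc hs
    have := le_tau_cons_of_notMem hz hc hs
    rw [if_neg (by linarith [hc.1.1]), mul_zero]

-- The condition `τ < t_N` is inherited by the tail of the list, and the flight time to the boundary
-- splits as `t - τ = (t - t₁) + (t₁ - τ)`, so the weight factors over the flights.
open Classical in
theorem outer_term (ρ₁ ρ₂ : ℝ) (N : ℕ) (ht : 0 ≤ t) (hz : z ∈ slabPhase L) :
    κ ^ N * collisionIntegral N t (fun c =>
        if tau L t z c < lastTime t c ∧ 0 < tau L t z c then
          Real.exp (-2 * κ * (t - tau L t z c)) *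
            reservoir L ρ₁ ρ₂ (backward t z c (t - tau L t z c))
        else 0) =
      (transport L κ)^[N] (boundarySeed L κ ρ₁ ρ₂) t z := by
  refine collisionIntegral_eq_iterate_transport (Φ := fun t z c =>
        if tau L t z c < lastTime t c ∧ 0 < tau L t z c then
          Real.exp (-2 * κ * (t - tau L t z c)) *
            reservoir L ρ₁ ρ₂ (backward t z c (t - tau L t z c))
        else 0) ?_ ?_ ?_ N ht hz
  · intro t z ht hz
    rw [boundarySeed]
    by_cases hs : stream t z ∈ closedSlabPhase L
    · rw [tau_nil_of_mem hz hs, if_pos hs, if_neg fun h => lt_irrefl _ h.2]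
    · obtain ⟨-, h1, -, -, h2, -⟩ :=
        entryTime_spec hz ht fun h => hs (slabPhase_subset_closed h)
      rw [tau_nil_of_notMem hz ht hs, if_neg hs, if_pos ⟨by rw [lastTime_nil]; linarith,
        by linarith [h2 hs]⟩, sub_sub_cancel, backward_nil, boundaryValue]
  · intro t z t₁ ρ c hz hc hs
    rw [tau_cons_of_mem hz hc.1 hs, lastTime]
    set τ := tau L t₁ (collideAt ρ (stream (t - t₁) z)) c
    by_cases hτ : τ < lastTime t₁ c ∧ 0 < τ
    · rw [if_pos hτ, if_pos hτ, backward_cons_of_le (by linarith [hτ.1, lastTime_le hc.2]),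
        ← mul_assoc, ← Real.exp_add]
      congr 2
      · ring
      · ring_nf
    · rw [if_neg hτ, if_neg hτ, mul_zero]
  · intro t z t₁ ρ c hz hc hs
    have h1 := le_tau_cons_of_notMem hz hc hs
    have h2 := lastTime_le hc.2
    rw [if_neg]
    rintro ⟨h, -⟩
    rw [lastTime] at h
    linarith

/-! ### The semigroup and the boundary contribution as series -/

theorem semigroup_apply (ℓ : Phase → ℝ) (ht : 0 ≤ t) (hz : z ∈ slabPhase L) :
    semigroup L κ t ℓ z = ∑' N : ℕ, (transport L κ)^[N] (interiorSeed L κ ℓ) t z := by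
  rw [semigroup, Set.indicator_of_mem hz]
  exact tsum_congr fun N => semigroup_term ℓ N ht hz

theorem outer_apply (ρ₁ ρ₂ : ℝ) (ht : 0 ≤ t) (hz : z ∈ slabPhase L) :
    outer L κ ρ₁ ρ₂ t z = ∑' N : ℕ, (transport L κ)^[N] (boundarySeed L κ ρ₁ ρ₂) t z := by
  rw [outer, Set.indicator_of_mem hz]
  exact tsum_congr fun N => outer_term ρ₁ ρ₂ N ht hz

end

section

/-! ### Seeds and free paths -/

variable {L κ T t M : ℝ} {z : Phase} {F : ℝ → Phase → ℝ} {ℓ : Phase → ℝ}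

theorem measurableSet_closedSlabPhase (L : ℝ) : MeasurableSet (closedSlabPhase L) := by
  have h : Measurable fun z : Phase => z.1 0 := by fun_prop
  exact (measurableSet_le measurable_const h).inter (measurableSet_le h measurable_const)

theorem measurable_interiorSeed (hℓ : Measurable ℓ) :
    Measurable (Function.uncurry (interiorSeed L κ ℓ)) := by
  have h1 : Measurable fun q : ℝ × Phase =>
      (closedSlabPhase L).indicator (fun w => Real.exp (-2 * κ * q.1) * ℓ w) q.2 := by
    have h2 : Measurable fun q : ℝ × Phase => Real.exp (-2 * κ * q.1) * ℓ q.2 := by fun_prop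
    have h3 := h2.indicator (measurable_snd (measurableSet_closedSlabPhase L) :
      MeasurableSet (Prod.snd ⁻¹' closedSlabPhase L : Set (ℝ × Phase)))
    exact h3
  have h4 : Measurable fun q : ℝ × Phase => (q.1, stream q.1 q.2) :=
    measurable_fst.prodMk measurable_stream
  exact h1.comp h4

theorem exp_neg_le_one (hκ : 0 ≤ κ) (ht : 0 ≤ t) : Real.exp (-2 * κ * t) ≤ 1 :=
  Real.exp_le_one_iff.2 (by nlinarith)

theorem abs_interiorSeed_le (hκ : 0 ≤ κ) (hℓ : ∀ w, |ℓ w| ≤ M) (ht : 0 ≤ t) :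
    |interiorSeed L κ ℓ t z| ≤ M := by
  have hM : 0 ≤ M := (abs_nonneg _).trans (hℓ z)
  rw [interiorSeed]
  by_cases hs : stream t z ∈ closedSlabPhase L
  · rw [Set.indicator_of_mem hs, abs_mul, abs_of_pos (Real.exp_pos _)]
    calc _ ≤ 1 * M := mul_le_mul (exp_neg_le_one hκ ht) (hℓ _) (abs_nonneg _) zero_le_one
      _ = M := one_mul M
  · rwa [Set.indicator_of_notMem hs, abs_zero]

theorem bddMeas_interiorSeed (hκ : 0 ≤ κ) (hm : Measurable ℓ) (hℓ : ∀ w, |ℓ w| ≤ M) :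
    BddMeas L T (interiorSeed L κ ℓ) :=
  ⟨measurable_interiorSeed hm, M, fun _ hr _ _ => abs_interiorSeed_le hκ hℓ hr.1⟩

theorem transport_eq_integral (L κ : ℝ) (F : ℝ → Phase → ℝ) (t : ℝ) (z : Phase) :
    transport L κ F t z = ∫ s in (0 : ℝ)..t, κ * Real.exp (-2 * κ * s) *
      (slabPhase L).indicator (scatterIntegral (F (t - s))) (stream s z) := by
  have := intervalIntegral.integral_comp_sub_left (a := 0) (b := t) (gain L κ F t z) t
  rw [sub_self, sub_zero] at this
  rw [transport, ← this]
  simp only [gain, sub_sub_cancel]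

/-- The part of the free path during `[0, t]` that lies in the strip. -/
theorem exists_exit (hz : z ∈ slabPhase L) (ht : 0 ≤ t) :
    ∃ τ, 0 ≤ τ ∧ τ ≤ t ∧ (∀ s, 0 ≤ s → s < τ → stream s z ∈ slabPhase L) ∧
      (∀ s, τ < s → s ≤ t → stream s z ∉ slabPhase L) ∧ stream τ z ∈ closedSlabPhase L ∧
      (stream t z ∈ closedSlabPhase L ∧ τ = t ∨
        stream t z ∉ closedSlabPhase L ∧ τ = entryTime L z) := by
  by_cases hs : stream t z ∈ closedSlabPhase L
  · exact ⟨t, ht, le_rfl, fun s h0 h1 => stream_mem_slabPhase hz h0 h1 hs,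
      fun s h0 h1 => absurd h0 h1.not_gt, hs, Or.inl ⟨hs, rfl⟩⟩
  · obtain ⟨-, h1, h2, h3, -, -⟩ :=
      entryTime_spec hz ht fun h => hs (slabPhase_subset_closed h)
    have hL : 0 < L := hz.1.trans hz.2
    have hcl : stream (entryTime L z) z ∈ closedSlabPhase L := by
      rw [mem_slabBoundary] at h3
      rw [mem_closedSlabPhase]
      rcases h3 with h | h <;> rw [h] <;> constructor <;> linarith
    refine ⟨entryTime L z, h1.le, h2, fun s h0 h => stream_mem_slabPhase hz h0 h hcl,
      fun s h h' hmem => ?_, hcl, Or.inr ⟨hs, rfl⟩⟩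
    exact notMem_slabBoundary (stream_mem_slabPhase hz h1.le h
      (slabPhase_subset_closed hmem)) h3

theorem transport_eq_integral_exit {τ : ℝ} (h0 : 0 ≤ τ) (hτ : τ ≤ t)
    (hin : ∀ s, 0 ≤ s → s < τ → stream s z ∈ slabPhase L)
    (hout : ∀ s, τ < s → s ≤ t → stream s z ∉ slabPhase L) :
    transport L κ F t z = ∫ s in (0 : ℝ)..τ, κ * Real.exp (-2 * κ * s) *
      scatterIntegral (F (t - s)) (stream s z) := by
  have hvanish : ∀ s ∈ Set.Ioc 0 t \ Set.Ioc 0 τ, κ * Real.exp (-2 * κ * s) *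
      (slabPhase L).indicator (scatterIntegral (F (t - s))) (stream s z) = 0 := fun s hs => by
    have h1 : τ < s := by
      by_contra hc
      exact hs.2 ⟨hs.1.1, not_lt.1 hc⟩
    rw [Set.indicator_of_notMem (hout s h1 hs.1.2), mul_zero]
  rw [transport_eq_integral, intervalIntegral.integral_of_le (h0.trans hτ),
    intervalIntegral.integral_of_le h0,
    setIntegral_eq_of_subset_of_forall_sdiff_eq_zero measurableSet_Ioc
      (Set.Ioc_subset_Ioc_right hτ) hvanish,
    integral_Ioc_eq_integral_Ioo, integral_Ioc_eq_integral_Ioo]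
  -- The end point `τ` may lie on the boundary, so the comparison is made on the open interval.
  refine setIntegral_congr_fun measurableSet_Ioo fun s hs => ?_
  simp only [Set.indicator_of_mem (hin s hs.1.le hs.2)]

/-! ### Moments of the scattered velocity -/

theorem abs_velocity_le_one (v : S1) : |(v : Plane) 0| ≤ 1 := by
  have := sq_add_sq_velocity v
  exact abs_le_one_iff_mul_self_le_one.2 (by nlinarith [sq_nonneg ((v : Plane) 1)])

theorem integral_odd_eq_zero {f : ℝ → ℝ} (hf : ∀ x, f (-x) = -f x) (a : ℝ) :
    ∫ x in (-a)..a, f x = 0 := by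
  have h := intervalIntegral.integral_comp_neg (a := -a) (b := a) f
  rw [neg_neg] at h
  simp_rw [hf] at h
  rw [intervalIntegral.integral_neg] at h
  linarith

/-- The term in `v₂` is odd in `ρ`, so `v₁` is an eigenfunction of the gain with eigenvalue `∫ (2ρ²
- 1) = -2/3`. With the loss `2` subtracted this gives `-8/3`. -/
theorem scatterIntegral_velocity (z : Phase) :
    scatterIntegral (fun w => (w.2 : Plane) 0) z = -(2 / 3) * (z.2 : Plane) 0 := by
  have h1 : scatterIntegral (fun w => (w.2 : Plane) 0) z = ∫ ρ in (-1 : ℝ)..1,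
      ((2 * ρ ^ 2 - 1) * (z.2 : Plane) 0 +
        2 * ρ * Real.sqrt (1 - ρ ^ 2) * (z.2 : Plane) 1) := by
    refine intervalIntegral.integral_congr fun ρ hρ => ?_
    rw [Set.uIcc_of_le (by norm_num)] at hρ
    exact scatter_zero hρ _
  rw [h1, intervalIntegral.integral_add
    ((by fun_prop : Continuous fun ρ : ℝ => (2 * ρ ^ 2 - 1) * (z.2 : Plane) 0).intervalIntegrable _ _)
    ((by fun_prop : Continuous fun ρ : ℝ =>
      2 * ρ * Real.sqrt (1 - ρ ^ 2) * (z.2 : Plane) 1).intervalIntegrable _ _),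
    integral_odd_eq_zero (f := fun ρ : ℝ => 2 * ρ * Real.sqrt (1 - ρ ^ 2) * (z.2 : Plane) 1)
      (fun x => by rw [neg_sq]; ring),
    intervalIntegral.integral_mul_const, intervalIntegral.integral_sub
      ((by fun_prop : Continuous fun ρ : ℝ => 2 * ρ ^ 2).intervalIntegrable _ _) (by simp),
    intervalIntegral.integral_const_mul, integral_pow]
  norm_num

/-- Equivalently, `2v₁² - 1` is an eigenfunction of the gain with eigenvalue `-2/15`, or `-32/15`
after subtracting the loss. -/
theorem scatterIntegral_sq_velocity (z : Phase) :
    scatterIntegral (fun w => (w.2 : Plane) 0 ^ 2) z =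
      16 / 15 - 2 / 15 * (z.2 : Plane) 0 ^ 2 := by
  have hv := sq_add_sq_velocity z.2
  set a := (z.2 : Plane) 0
  set b := (z.2 : Plane) 1
  have h1 : scatterIntegral (fun w => (w.2 : Plane) 0 ^ 2) z = ∫ ρ in (-1 : ℝ)..1,
      (((4 * a ^ 2 - 4 * b ^ 2) * ρ ^ 4 + (4 * b ^ 2 - 4 * a ^ 2) * ρ ^ 2 + a ^ 2) +
        ρ * (Real.sqrt (1 - ρ ^ 2) * (4 * (2 * ρ ^ 2 - 1) * a * b))) := by
    refine intervalIntegral.integral_congr fun ρ hρ => ?_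
    rw [Set.uIcc_of_le (by norm_num)] at hρ
    have hs : Real.sqrt (1 - ρ ^ 2) ^ 2 = 1 - ρ ^ 2 :=
      Real.sq_sqrt (by nlinarith [hρ.1, hρ.2])
    have := scatter_zero hρ z.2
    simp only [collideAt, this]
    linear_combination 4 * ρ ^ 2 * b ^ 2 * hs
  rw [h1, intervalIntegral.integral_add
    ((by fun_prop : Continuous fun ρ : ℝ =>
      (4 * a ^ 2 - 4 * b ^ 2) * ρ ^ 4 + (4 * b ^ 2 - 4 * a ^ 2) * ρ ^ 2 + a ^ 2).intervalIntegrable _ _)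
    ((by fun_prop : Continuous fun ρ : ℝ =>
      ρ * (Real.sqrt (1 - ρ ^ 2) * (4 * (2 * ρ ^ 2 - 1) * a * b))).intervalIntegrable _ _),
    integral_odd_eq_zero (f := fun ρ : ℝ =>
      ρ * (Real.sqrt (1 - ρ ^ 2) * (4 * (2 * ρ ^ 2 - 1) * a * b)))
      (fun x => by rw [neg_sq]; ring),
    intervalIntegral.integral_add
      ((by fun_prop : Continuous fun ρ : ℝ =>
        (4 * a ^ 2 - 4 * b ^ 2) * ρ ^ 4 + (4 * b ^ 2 - 4 * a ^ 2) * ρ ^ 2).intervalIntegrable _ _)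
      (by simp),
    intervalIntegral.integral_add
      ((by fun_prop : Continuous fun ρ : ℝ => (4 * a ^ 2 - 4 * b ^ 2) * ρ ^ 4).intervalIntegrable _ _)
      ((by fun_prop : Continuous fun ρ : ℝ => (4 * b ^ 2 - 4 * a ^ 2) * ρ ^ 2).intervalIntegrable _ _),
    intervalIntegral.integral_const_mul, intervalIntegral.integral_const_mul, integral_pow,
    integral_pow]
  norm_num
  linear_combination 16 / 15 * hv

/-! ### A supersolution for the survival probability -/

/-- The velocity profile of the supersolution. -/
def profile (κ k : ℝ) (z : Phase) : ℝ :=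
  1 - 3 * k / (8 * κ) * (z.2 : Plane) 0 +
    45 * k ^ 2 / (512 * κ ^ 2) * (2 * (z.2 : Plane) 0 ^ 2 - 1)

/-- A function `A - c e^{k x₁ + λ t} ψ(v)` with `λ = k² / (8 κ)`. -/
def barrier (κ k A c t : ℝ) (z : Phase) : ℝ :=
  A - c * (Real.exp (k * z.1 0 + k ^ 2 / (8 * κ) * t) * profile κ k z)

variable {k A c : ℝ}

theorem measurable_profile (κ k : ℝ) : Measurable (profile κ k) := by
  unfold profile
  fun_prop

theorem measurable_barrier (κ k A c : ℝ) : Measurable (Function.uncurry (barrier κ k A c)) := by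
  have := (measurable_profile κ k).comp (measurable_snd : Measurable (Prod.snd : ℝ × Phase → Phase))
  unfold barrier
  simp only [Function.uncurry_def]
  fun_prop

/-- For `k/κ ≤ 1/4` the two corrections are at most `3/32` and `45/8192`, together less than `1/10`.
-/
theorem profile_mem (hk : 0 < k) (hκ : 4 * k ≤ κ) (z : Phase) :
    profile κ k z ∈ Set.Icc (9 / 10 : ℝ) (11 / 10) := by
  have hκ0 : 0 < κ := by linarith
  have hv := abs_le.1 (abs_velocity_le_one z.2)
  set v := (z.2 : Plane) 0 with hvdef
  have hu : k / κ ≤ 1 / 4 := by rw [div_le_iff₀ hκ0]; linarith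
  have hu0 : 0 < k / κ := by positivity
  have h1 : profile κ k z = 1 - 3 / 8 * (k / κ) * v + 45 / 512 * (k / κ) ^ 2 * (2 * v ^ 2 - 1) := by
    rw [profile, ← hvdef]; field_simp
  rw [h1]
  set u := k / κ
  have h2 : |u * v| ≤ 1 / 4 := by
    rw [abs_mul, abs_of_pos hu0]
    calc u * |v| ≤ 1 / 4 * 1 := mul_le_mul hu (abs_le.2 hv) (abs_nonneg _) (by norm_num)
      _ = 1 / 4 := by norm_num
  have h3 : |u ^ 2 * (2 * v ^ 2 - 1)| ≤ 1 / 16 := by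
    rw [abs_mul, abs_of_pos (by positivity)]
    have h5 : v ^ 2 ≤ 1 := by nlinarith
    have h4 : |2 * v ^ 2 - 1| ≤ 1 := abs_le.2 ⟨by nlinarith [sq_nonneg v], by linarith⟩
    calc u ^ 2 * |2 * v ^ 2 - 1| ≤ (1 / 4) ^ 2 * 1 :=
          mul_le_mul (pow_le_pow_left₀ hu0.le hu 2) h4 (abs_nonneg _) (by norm_num)
      _ = 1 / 16 := by norm_num
  rw [abs_le] at h2 h3
  constructor <;> nlinarith [h2.1, h2.2, h3.1, h3.2]

theorem intervalIntegrable_profile_collideAt (hk : 0 < k) (hκ : 4 * k ≤ κ) (z : Phase) :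
    IntervalIntegrable (fun ρ => profile κ k (collideAt ρ z)) volume (-1) 1 :=
  intervalIntegrable_collideAt (measurable_profile κ k) (M := 11 / 10) fun ρ =>
    abs_le.2 ⟨by linarith [(profile_mem hk hκ (collideAt ρ z)).1],
      (profile_mem hk hκ (collideAt ρ z)).2⟩

theorem scatterIntegral_profile (z : Phase) :
    scatterIntegral (profile κ k) z = 2 + 2 / 3 * (3 * k / (8 * κ)) * (z.2 : Plane) 0 -
      2 / 15 * (45 * k ^ 2 / (512 * κ ^ 2)) * (2 * (z.2 : Plane) 0 ^ 2 - 1) := by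
  have h1 := scatterIntegral_velocity z
  have h2 := scatterIntegral_sq_velocity z
  rw [scatterIntegral] at h1 h2
  have hi1 : IntervalIntegrable (fun ρ => ((collideAt ρ z).2 : Plane) 0) volume (-1) 1 :=
    intervalIntegrable_collideAt (h := fun w => (w.2 : Plane) 0) (by fun_prop) (M := 1)
      fun ρ => abs_velocity_le_one _
  have hi2 : IntervalIntegrable (fun ρ => ((collideAt ρ z).2 : Plane) 0 ^ 2) volume (-1) 1 :=
    intervalIntegrable_collideAt (h := fun w => (w.2 : Plane) 0 ^ 2) (by fun_prop) (M := 1)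
      fun ρ => by
        rw [abs_of_nonneg (sq_nonneg _), sq_le_one_iff_abs_le_one]
        exact abs_velocity_le_one _
  have h3 : scatterIntegral (profile κ k) z = ∫ ρ in (-1 : ℝ)..1,
      ((1 - 45 * k ^ 2 / (512 * κ ^ 2)) - 3 * k / (8 * κ) * ((collideAt ρ z).2 : Plane) 0 +
        2 * (45 * k ^ 2 / (512 * κ ^ 2)) * ((collideAt ρ z).2 : Plane) 0 ^ 2) := by
    refine intervalIntegral.integral_congr fun ρ _ => ?_
    simp only [profile]
    ring
  rw [h3, intervalIntegral.integral_add
      ((intervalIntegrable_const).sub (hi1.const_mul _)) (hi2.const_mul _),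
    intervalIntegral.integral_sub intervalIntegrable_const (hi1.const_mul _),
    intervalIntegral.integral_const_mul, intervalIntegral.integral_const_mul, h1, h2]
  simp
  ring

theorem scatterIntegral_barrier (hk : 0 < k) (hκ : 4 * k ≤ κ) (t : ℝ) (z : Phase) :
    scatterIntegral (barrier κ k A c t) z =
      2 * A - c * (Real.exp (k * z.1 0 + k ^ 2 / (8 * κ) * t) *
        scatterIntegral (profile κ k) z) := by
  have hi := intervalIntegrable_profile_collideAt hk hκ z
  simp only [scatterIntegral, barrier]
  have h1 : ∀ ρ, (collideAt ρ z).1 = z.1 := fun _ => rfl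
  simp_rw [h1]
  rw [intervalIntegral.integral_sub intervalIntegrable_const ((hi.const_mul _).const_mul _),
    intervalIntegral.integral_const_mul, intervalIntegral.integral_const_mul]
  simp
  norm_num

/-- The subsolution property of `e^{k x₁ + λt} ψ(v)`. Against the eigenvalues `-8/3` and `-32/15`,
the coefficients of `profile` cancel the drift term `k v₁` and the part of order `k²/κ` proportional
to `2v₁² - 1`. The remaining constant is `3k²/(16κ)`. Taking `λ = k²/(8κ)` below this leaves room
for the cubic remainder and for `ψ ≤ 11/10`. -/
theorem profile_generator (hk : 0 < k) (hκ : 4 * k ≤ κ) (z : Phase) :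
    (2 * κ + k * (z.2 : Plane) 0 + k ^ 2 / (8 * κ)) * profile κ k z ≤
      κ * scatterIntegral (profile κ k) z := by
  have hκ0 : 0 < κ := by linarith
  have hψ := (profile_mem hk hκ z).2
  have hv := abs_le.1 (abs_velocity_le_one z.2)
  rw [scatterIntegral_profile]
  set v := (z.2 : Plane) 0 with hvdef
  have hu : k / κ ≤ 1 / 4 := by rw [div_le_iff₀ hκ0]; linarith
  have hu0 : 0 < k / κ := by positivity
  have h1 : κ * (2 + 2 / 3 * (3 * k / (8 * κ)) * v -
      2 / 15 * (45 * k ^ 2 / (512 * κ ^ 2)) * (2 * v ^ 2 - 1)) -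
      (2 * κ + k * v + k ^ 2 / (8 * κ)) * profile κ k z =
      k * (k / κ) * (3 / 16 - 45 / 512 * (k / κ) * (v * (2 * v ^ 2 - 1)) -
        1 / 8 * profile κ k z) := by
    rw [profile, ← hvdef]
    field_simp
    ring
  have h5 : v ^ 2 ≤ 1 := by nlinarith
  have h3 : |v * (2 * v ^ 2 - 1)| ≤ 1 := by
    rw [abs_mul]
    exact mul_le_one₀ (abs_le.2 hv) (abs_nonneg _)
      (abs_le.2 ⟨by nlinarith [sq_nonneg v], by linarith⟩)
  have h2 : k / κ * (v * (2 * v ^ 2 - 1)) ≤ 1 / 4 := by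
    calc k / κ * (v * (2 * v ^ 2 - 1)) ≤ 1 / 4 * 1 :=
          (mul_le_mul_of_nonneg_left ((le_abs_self _).trans h3) hu0.le).trans (by linarith)
      _ = 1 / 4 := by norm_num
  have h4 : 0 ≤ k * (k / κ) * (3 / 16 - 45 / 512 * (k / κ) * (v * (2 * v ^ 2 - 1)) -
        1 / 8 * profile κ k z) := by
    refine mul_nonneg (by positivity) ?_
    nlinarith
  linarith

/-- Along a free path, minus the derivative of `e^{-2κs}` times the barrier dominates the collision
integrand, by `profile_generator`. Integration up to the exit, or up to `t`, bounds the collision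
term by the difference of the end values. -/
theorem barrier_supersolution (hk : 0 < k) (hκ : 4 * k ≤ κ) (hc : 0 ≤ c)
    (h0 : ∀ w ∈ closedSlabPhase L, 1 ≤ barrier κ k A c 0 w)
    (hnn : ∀ r ∈ Set.Icc 0 T, ∀ w ∈ closedSlabPhase L, 0 ≤ barrier κ k A c r w)
    (ht : t ∈ Set.Icc 0 T) (hz : z ∈ slabPhase L) :
    interiorSeed L κ (fun _ => 1) t z + transport L κ (barrier κ k A c) t z ≤
      barrier κ k A c t z := by
  obtain ⟨τ, hτ0, hτt, hin, hout, hcl, hcase⟩ := exists_exit hz ht.1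
  rw [transport_eq_integral_exit hτ0 hτt hin hout]
  set v := (z.2 : Plane) 0 with hv
  set lam := k ^ 2 / (8 * κ) with hlam
  set ψ := profile κ k z with hψ
  set Q := scatterIntegral (profile κ k) z with hQ
  set e : ℝ → ℝ := fun s => Real.exp (-2 * κ * s + (k * (z.1 0 - s * v) + lam * (t - s))) with he
  have hprof : ∀ s, profile κ k (stream s z) = ψ := fun s => rfl
  have hQs : ∀ s, scatterIntegral (profile κ k) (stream s z) = Q := fun s => by
    rw [scatterIntegral_profile, hQ, scatterIntegral_profile]; rfl
  have hexp : ∀ s, Real.exp (-2 * κ * s) * Real.exp (k * (stream s z).1 0 + lam * (t - s)) =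
      e s := fun s => by
    rw [← Real.exp_add, stream_fst_zero]
  have hf : ∀ s, Real.exp (-2 * κ * s) * barrier κ k A c (t - s) (stream s z) =
      A * Real.exp (-2 * κ * s) - c * ψ * e s := fun s => by
    rw [barrier, hprof, ← hexp]; ring
  have hg : ∀ s, κ * Real.exp (-2 * κ * s) *
      scatterIntegral (barrier κ k A c (t - s)) (stream s z) =
      2 * κ * A * Real.exp (-2 * κ * s) - κ * c * Q * e s := fun s => by
    rw [scatterIntegral_barrier hk hκ, hQs, ← hexp]; ring
  have hder1 : ∀ s : ℝ, HasDerivAt (fun s => Real.exp (-2 * κ * s))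
      (-(2 * κ) * Real.exp (-2 * κ * s)) s := fun s => by
    have := ((hasDerivAt_id s).const_mul (-2 * κ)).exp
    refine this.congr_deriv ?_
    simp; ring
  have hder2 : ∀ s : ℝ, HasDerivAt e (-(2 * κ + k * v + lam) * e s) s := fun s => by
    have h1 := (hasDerivAt_id s).const_mul (-2 * κ)
    have h2 := ((((hasDerivAt_id s).mul_const v).const_sub (z.1 0)).const_mul k)
    have h3 := (((hasDerivAt_id s).const_sub t).const_mul lam)
    have := (h1.add (h2.add h3)).exp
    refine this.congr_deriv ?_
    simp [he]; ring
  have hder : ∀ s ∈ Set.uIcc 0 τ, HasDerivAt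
      (fun s => -(A * Real.exp (-2 * κ * s) - c * ψ * e s))
      (2 * κ * A * Real.exp (-2 * κ * s) - (2 * κ + k * v + lam) * ψ * c * e s) s :=
    fun s _ => by
      have := (((hder1 s).const_mul A).sub ((hder2 s).const_mul (c * ψ))).neg
      refine this.congr_deriv ?_
      ring
  have hce : Continuous e := by rw [he]; fun_prop
  have hint := intervalIntegral.integral_eq_sub_of_hasDerivAt hder
    ((by fun_prop : Continuous fun s =>
      2 * κ * A * Real.exp (-2 * κ * s) -
        (2 * κ + k * v + lam) * ψ * c * e s).intervalIntegrable _ _)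
  have hle : ∫ s in (0 : ℝ)..τ, κ * Real.exp (-2 * κ * s) *
      scatterIntegral (barrier κ k A c (t - s)) (stream s z) ≤
      ∫ s in (0 : ℝ)..τ, (2 * κ * A * Real.exp (-2 * κ * s) -
        (2 * κ + k * v + lam) * ψ * c * e s) := by
    simp_rw [hg]
    refine intervalIntegral.integral_mono_on hτ0
      ((by fun_prop : Continuous fun s =>
        2 * κ * A * Real.exp (-2 * κ * s) - κ * c * Q * e s).intervalIntegrable _ _)
      ((by fun_prop : Continuous fun s =>
      2 * κ * A * Real.exp (-2 * κ * s) -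
        (2 * κ + k * v + lam) * ψ * c * e s).intervalIntegrable _ _) fun s _ => ?_
    have hgen := profile_generator hk hκ z
    have hpos : 0 ≤ c * e s := mul_nonneg hc (Real.exp_pos _).le
    have := mul_le_mul_of_nonneg_right hgen hpos
    simp only [← hv, ← hlam, ← hψ, ← hQ] at this
    linarith
  -- Either the time runs out in the closed strip, where the initial barrier is at least `1`, or the
  -- path stops on the boundary, where the barrier is nonnegative and the seed vanishes.
  have hend : interiorSeed L κ (fun _ => 1) t z ≤
      Real.exp (-2 * κ * τ) * barrier κ k A c (t - τ) (stream τ z) := by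
    rcases hcase with ⟨hs, rfl⟩ | ⟨hs, -⟩
    · rw [interiorSeed, Set.indicator_of_mem hs, sub_self]
      exact mul_le_mul_of_nonneg_left (h0 _ hs) (Real.exp_pos _).le
    · rw [interiorSeed, Set.indicator_of_notMem hs]
      exact mul_nonneg (Real.exp_pos _).le
        (hnn _ ⟨by linarith, by linarith [ht.2]⟩ _ hcl)
  have hstart := hf 0
  have hfτ := hf τ
  rw [hint] at hle
  simp only [mul_zero, Real.exp_zero, one_mul, sub_zero, stream_zero] at hstart hle
  rw [hfτ] at hend
  linarith

/-! ### The bound for the sum over the number of collisions -/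

theorem BddMeas.sum {G : ℕ → ℝ → Phase → ℝ} (hG : ∀ n, BddMeas L T (G n)) (m : ℕ) :
    BddMeas L T (∑ n ∈ Finset.range m, G n) := by
  induction m with
  | zero => exact ⟨(measurable_zero : Measurable fun _ : ℝ × Phase => (0 : ℝ)), 0, fun _ _ _ _ => by simp⟩
  | succ m ih => rw [Finset.sum_range_succ]; exact ih.add (hG m)

theorem transport_sum {G : ℕ → ℝ → Phase → ℝ} (hκ : 0 ≤ κ) (hG : ∀ n, BddMeas L T (G n))
    (ht : t ∈ Set.Icc 0 T) (m : ℕ) :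
    transport L κ (∑ n ∈ Finset.range m, G n) t z =
      ∑ n ∈ Finset.range m, transport L κ (G n) t z := by
  induction m with
  | zero =>
    have : ∀ r, scatterIntegral ((0 : ℝ → Phase → ℝ) r) = 0 := fun r => by
      funext w
      simp [scatterIntegral]
    rw [Finset.sum_range_zero, Finset.sum_range_zero, transport]
    simp only [gain, this]
    simp
  | succ m ih =>
    rw [Finset.sum_range_succ, Finset.sum_range_succ,
      transport_add hκ (BddMeas.sum hG m) (hG m) ht, ih]

theorem sum_iterate_transport_succ (hκ : 0 ≤ κ) (hF : BddMeas L T F) (ht : t ∈ Set.Icc 0 T)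
    (m : ℕ) :
    ∑ n ∈ Finset.range (m + 1), (transport L κ)^[n] F t z =
      F t z + transport L κ (∑ n ∈ Finset.range m, (transport L κ)^[n] F) t z := by
  rw [Finset.sum_range_succ', transport_sum hκ (hF.iterate hκ) ht, add_comm]
  simp [Function.iterate_succ_apply']

/-- Comparison principle: the partial sums obey `u_{m+1} = F + transport u_m`, and `transport` is
monotone, so the bound by a supersolution passes from `u_m` to `u_{m+1}`. -/
theorem sum_iterate_transport_le {w : ℝ → Phase → ℝ} (hκ : 0 ≤ κ) (hF : BddMeas L T F)
    (hw : BddMeas L T w) (hw0 : ∀ r ∈ Set.Icc 0 T, ∀ y ∈ slabPhase L, 0 ≤ w r y)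
    (hsup : ∀ r ∈ Set.Icc 0 T, ∀ y ∈ slabPhase L, F r y + transport L κ w r y ≤ w r y)
    (ht : t ∈ Set.Icc 0 T) (hz : z ∈ slabPhase L) (m : ℕ) :
    ∑ n ∈ Finset.range m, (transport L κ)^[n] F t z ≤ w t z := by
  induction m generalizing t z with
  | zero => simpa using hw0 t ht z hz
  | succ m ih =>
    rw [sum_iterate_transport_succ hκ hF ht]
    have := transport_mono (z := z) hκ (BddMeas.sum (hF.iterate hκ) m) hw
      (fun r hr y hy => by simpa [Finset.sum_apply] using ih hr hy) ht
    linarith [hsup t ht z hz]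

theorem survival_sum_le (hk : 0 < k) (hκ : 4 * k ≤ κ)
    (hT : 0 ≤ T) (hkT : k * L + 1 ≤ k ^ 2 / (8 * κ) * T) (hz : z ∈ slabPhase L) (m : ℕ) :
    ∑ n ∈ Finset.range m, (transport L κ)^[n] (interiorSeed L κ fun _ => 1) T z ≤
      1 - 4 / 11 * Real.exp (-(k * L)) := by
  have hκ0 : 0 < κ := by linarith
  set lam := k ^ 2 / (8 * κ) with hlam
  have hlam0 : 0 < lam := by positivity
  -- As `profile ≤ 11/10`, this makes the subtracted term at most `1` up to time `T`, so the barrier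
  -- stays nonnegative.
  set c := 10 / 11 * Real.exp (-(k * L + lam * T)) with hc
  have hc0 : 0 < c := by positivity
  -- The excess over `1` compensates the largest possible subtracted term at time `0`.
  set A := 1 + c * (11 / 10 * Real.exp (k * L)) with hA
  have hexp : ∀ r ∈ Set.Icc 0 T, ∀ w ∈ closedSlabPhase L,
      Real.exp (k * w.1 0 + lam * r) * profile κ k w ≤
        11 / 10 * Real.exp (k * L + lam * r) := by
    intro r hr w hw
    have h1 : Real.exp (k * w.1 0 + lam * r) ≤ Real.exp (k * L + lam * r) := by
      gcongr
      exact hw.2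
    have h2 := profile_mem hk hκ w
    nlinarith [mul_le_mul h1 h2.2 (by linarith [h2.1]) (Real.exp_pos _).le]
  have hcT : c * (11 / 10 * Real.exp (k * L + lam * T)) = 1 := by
    have : Real.exp (-(k * L + lam * T)) * Real.exp (k * L + lam * T) = 1 := by
      rw [← Real.exp_add]; simp
    rw [hc]
    linear_combination this
  have h0 : ∀ w ∈ closedSlabPhase L, 1 ≤ barrier κ k A c 0 w := by
    intro w hw
    have h1 := hexp 0 ⟨le_rfl, hT⟩ w hw
    have h2 := mul_le_mul_of_nonneg_left h1 hc0.le
    rw [barrier, ← hlam, hA]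
    rw [mul_zero, add_zero] at h2 ⊢
    rw [add_zero] at h2
    linarith
  have hub : ∀ r ∈ Set.Icc 0 T, ∀ w ∈ closedSlabPhase L,
      c * (Real.exp (k * w.1 0 + lam * r) * profile κ k w) ≤ 1 := by
    intro r hr w hw
    rw [← hcT]
    refine mul_le_mul_of_nonneg_left ((hexp r hr w hw).trans ?_) hc0.le
    have := hr.2
    gcongr
  have hnn : ∀ r ∈ Set.Icc 0 T, ∀ w ∈ closedSlabPhase L, 0 ≤ barrier κ k A c r w := by
    intro r hr w hw
    have h1 := hub r hr w hw
    have h2 : 0 ≤ c * (11 / 10 * Real.exp (k * L)) := by positivity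
    rw [barrier, ← hlam, hA]
    linarith
  have hbdd : BddMeas L T (barrier κ k A c) := by
    refine ⟨measurable_barrier κ k A c, A, fun r hr w hw => ?_⟩
    have hw' := slabPhase_subset_closed hw
    rw [abs_of_nonneg (hnn r hr w hw'), barrier]
    have : 0 ≤ profile κ k w := by linarith [(profile_mem hk hκ w).1]
    have : 0 ≤ c * (Real.exp (k * w.1 0 + k ^ 2 / (8 * κ) * r) * profile κ k w) := by positivity
    linarith
  have hseed : BddMeas L T (interiorSeed L κ fun _ => 1) :=
    bddMeas_interiorSeed (M := 1) hκ0.le measurable_const fun _ => by simp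
  refine (sum_iterate_transport_le hκ0.le hseed hbdd
    (fun r hr y hy => hnn r hr y (slabPhase_subset_closed hy))
    (fun r hr y hy => barrier_supersolution hk hκ hc0.le h0 hnn hr hy)
    ⟨hT, le_rfl⟩ hz m).trans ?_
  have h1 : 9 / 10 * Real.exp (lam * T) ≤
      Real.exp (k * z.1 0 + lam * T) * profile κ k z := by
    have h2 := (profile_mem hk hκ z).1
    have h3 : Real.exp (lam * T) ≤ Real.exp (k * z.1 0 + lam * T) := by
      have : 0 ≤ k * z.1 0 := mul_nonneg hk.le hz.1.le
      gcongr
      linarith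
    nlinarith [mul_le_mul h3 h2 (by norm_num) (Real.exp_pos _).le]
  -- The extra `1` in `hkT` gives the factor `e > 27/10`. Then `9/10 - 11/27 ≥ 2/5` leaves a
  -- definite gap below `1` at time `T`.
  have h2 : 27 / 10 * Real.exp (k * L) ≤ Real.exp (lam * T) := by
    have h3 : Real.exp (k * L + 1) ≤ Real.exp (lam * T) := by gcongr
    rw [Real.exp_add] at h3
    nlinarith [Real.exp_one_gt_d9, Real.exp_pos (k * L)]
  have h3 : 2 / 5 * Real.exp (lam * T) ≤
      Real.exp (k * z.1 0 + lam * T) * profile κ k z - 11 / 10 * Real.exp (k * L) := by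
    linarith [Real.exp_pos (lam * T)]
  have h4 : c * (2 / 5 * Real.exp (lam * T)) = 4 / 11 * Real.exp (-(k * L)) := by
    have : Real.exp (-(k * L + lam * T)) * Real.exp (lam * T) = Real.exp (-(k * L)) := by
      rw [← Real.exp_add]; congr 1; ring
    rw [hc]
    linear_combination 4 / 11 * this
  have h5 := mul_le_mul_of_nonneg_left h3 hc0.le
  rw [barrier, ← hlam, hA]
  linarith

end

section

/-! ### The semigroup on bounded measurable functions -/

variable {L κ T t M : ℝ} {z : Phase} {F F' : ℝ → Phase → ℝ} {ℓ ℓ' h : Phase → ℝ}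

theorem summable_iterate_transport (hκ : 0 ≤ κ)
    (hF : ∀ r ∈ Set.Icc 0 t, ∀ w ∈ slabPhase L, |F r w| ≤ M) (ht : 0 ≤ t)
    (hz : z ∈ slabPhase L) : Summable fun n => (transport L κ)^[n] F t z := by
  have h1 : Summable fun n : ℕ => M * ((2 * κ * t) ^ n / n.factorial) :=
    (Real.summable_pow_div_factorial _).mul_left M
  refine Summable.of_norm_bounded h1 fun n => ?_
  rw [Real.norm_eq_abs, ← mul_div_assoc]
  exact abs_iterate_transport_le hκ hF n ⟨ht, le_rfl⟩ hz

theorem gain_const_mul (a : ℝ) (r : ℝ) :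
    gain L κ (fun s w => a * F s w) t z r = a * gain L κ F t z r := by
  have h1 : scatterIntegral (fun w => a * F r w) = fun w => a * scatterIntegral (F r) w := by
    funext w
    exact intervalIntegral.integral_const_mul _ _
  rw [gain, gain, h1]
  by_cases hz : stream (t - r) z ∈ slabPhase L
  · simp only [Set.indicator_of_mem hz]; ring
  · simp only [Set.indicator_of_notMem hz]; ring

theorem transport_const_mul (a : ℝ) (F : ℝ → Phase → ℝ) :
    transport L κ (fun s w => a * F s w) = fun s w => a * transport L κ F s w := by
  funext t z
  simp only [transport, gain_const_mul, intervalIntegral.integral_const_mul]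

theorem iterate_transport_const_mul (a : ℝ) (F : ℝ → Phase → ℝ) (n : ℕ) :
    (transport L κ)^[n] (fun s w => a * F s w) = fun s w => a * (transport L κ)^[n] F s w := by
  induction n with
  | zero => rfl
  | succ n ih => simp only [Function.iterate_succ_apply', ih, transport_const_mul]

theorem interiorSeed_mul (a : ℝ) :
    interiorSeed L κ (fun w => a * ℓ w) = fun t z => a * interiorSeed L κ ℓ t z := by
  funext t z
  simp only [interiorSeed]
  by_cases hz : stream t z ∈ closedSlabPhase L
  · simp only [Set.indicator_of_mem hz]; ring
  · simp only [Set.indicator_of_notMem hz]; ring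

theorem interiorSeed_add (ℓ ℓ' : Phase → ℝ) :
    interiorSeed L κ (ℓ + ℓ') = interiorSeed L κ ℓ + interiorSeed L κ ℓ' := by
  funext t z
  simp only [interiorSeed, Pi.add_apply]
  by_cases hz : stream t z ∈ closedSlabPhase L
  · simp only [Set.indicator_of_mem hz]; ring
  · simp only [Set.indicator_of_notMem hz]; ring

theorem interiorSeed_mono (hle : ∀ w, ℓ w ≤ ℓ' w) (t : ℝ) (z : Phase) :
    interiorSeed L κ ℓ t z ≤ interiorSeed L κ ℓ' t z :=
  Set.indicator_le_indicator (mul_le_mul_of_nonneg_left (hle _) (Real.exp_pos _).le)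

theorem hasSum_semigroup (hκ : 0 ≤ κ) (hℓ : ∀ w, |ℓ w| ≤ M) (ht : 0 ≤ t)
    (hz : z ∈ slabPhase L) :
    HasSum (fun n => (transport L κ)^[n] (interiorSeed L κ ℓ) t z) (semigroup L κ t ℓ z) := by
  rw [semigroup_apply ℓ ht hz]
  exact (summable_iterate_transport hκ
    (fun r hr w _ => abs_interiorSeed_le hκ hℓ hr.1) ht hz).hasSum

theorem semigroup_of_notMem (hz : z ∉ slabPhase L) : semigroup L κ t ℓ z = 0 := by
  rw [semigroup, Set.indicator_of_notMem hz]

theorem outer_of_notMem {ρ₁ ρ₂ : ℝ} (hz : z ∉ slabPhase L) : outer L κ ρ₁ ρ₂ t z = 0 := by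
  rw [outer, Set.indicator_of_notMem hz]

theorem semigroup_add {M' : ℝ} (hκ : 0 ≤ κ) (ht : 0 ≤ t) (hm : Measurable ℓ)
    (hm' : Measurable ℓ') (hℓ : ∀ w, |ℓ w| ≤ M) (hℓ' : ∀ w, |ℓ' w| ≤ M') (z : Phase) :
    semigroup L κ t (ℓ + ℓ') z = semigroup L κ t ℓ z + semigroup L κ t ℓ' z := by
  by_cases hz : z ∈ slabPhase L
  · have hsum : ∀ w, |(ℓ + ℓ') w| ≤ M + M' := fun w =>
      (abs_add_le _ _).trans (add_le_add (hℓ w) (hℓ' w))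
    refine (hasSum_semigroup hκ hsum ht hz).unique ?_
    refine ((hasSum_semigroup hκ hℓ ht hz).add (hasSum_semigroup hκ hℓ' ht hz)).congr_fun ?_
    intro n
    rw [interiorSeed_add, iterate_transport_add hκ (bddMeas_interiorSeed (T := t) hκ hm hℓ)
      (bddMeas_interiorSeed hκ hm' hℓ') n ⟨ht, le_rfl⟩ hz]
  · simp only [semigroup_of_notMem hz, add_zero]

theorem semigroup_sub {M' : ℝ} (hκ : 0 ≤ κ) (ht : 0 ≤ t) (hm : Measurable ℓ)
    (hm' : Measurable ℓ') (hℓ : ∀ w, |ℓ w| ≤ M) (hℓ' : ∀ w, |ℓ' w| ≤ M') (z : Phase) :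
    semigroup L κ t (ℓ - ℓ') z = semigroup L κ t ℓ z - semigroup L κ t ℓ' z := by
  have hsub : ∀ w, |(ℓ - ℓ') w| ≤ M + M' := fun w =>
    (abs_sub _ _).trans (add_le_add (hℓ w) (hℓ' w))
  have := semigroup_add (L := L) hκ ht (hm.sub hm') hm' hsub hℓ' z
  rw [sub_add_cancel] at this
  linarith

/-- A bound for the survival probability bounds the semigroup. -/
theorem abs_semigroup_le {α : ℝ} (hκ : 0 ≤ κ) (ht : 0 ≤ t) (hα : 0 ≤ α)
    (hsurv : ∀ z ∈ slabPhase L, ∀ m,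
      ∑ n ∈ Finset.range m, (transport L κ)^[n] (interiorSeed L κ fun _ => 1) t z ≤ α)
    (hm : Measurable ℓ) (hℓ : ∀ w, |ℓ w| ≤ M) (z : Phase) :
    |semigroup L κ t ℓ z| ≤ α * M := by
  have hM : 0 ≤ M := (abs_nonneg _).trans (hℓ z)
  by_cases hz : z ∈ slabPhase L
  · have hseed := bddMeas_interiorSeed (L := L) (T := t) hκ hm hℓ
    have hconst : ∀ a : ℝ, BddMeas L t (interiorSeed L κ fun _ => a * 1) := fun a =>
      bddMeas_interiorSeed (M := |a|) hκ measurable_const fun _ => by simp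
    -- From `-M ≤ ℓ ≤ M`, monotonicity traps each term between `±M` times the corresponding term for
    -- the constant `1`.
    have hn : ∀ n, |(transport L κ)^[n] (interiorSeed L κ ℓ) t z| ≤
        M * (transport L κ)^[n] (interiorSeed L κ fun _ => 1) t z := by
      intro n
      have hup := iterate_transport_mono hκ hseed (hconst M) (fun r _ w _ =>
        interiorSeed_mono (fun w => by linarith [(abs_le.1 (hℓ w)).2]) r w) n ⟨ht, le_rfl⟩ hz
      have hlow := iterate_transport_mono hκ (hconst (-M)) hseed (fun r _ w _ =>
        interiorSeed_mono (fun w => by linarith [(abs_le.1 (hℓ w)).1]) r w) n ⟨ht, le_rfl⟩ hz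
      rw [interiorSeed_mul, iterate_transport_const_mul] at hup hlow
      exact abs_le.2 ⟨by linarith, hup⟩
    have hlim := (hasSum_semigroup hκ hℓ ht hz).tendsto_sum_nat.abs
    refine le_of_tendsto hlim (Eventually.of_forall fun m => ?_)
    calc _ ≤ ∑ n ∈ Finset.range m, |(transport L κ)^[n] (interiorSeed L κ ℓ) t z| :=
          Finset.abs_sum_le_sum_abs _ _
      _ ≤ ∑ n ∈ Finset.range m,
          M * (transport L κ)^[n] (interiorSeed L κ fun _ => 1) t z :=
          Finset.sum_le_sum fun n _ => hn n
      _ = M * ∑ n ∈ Finset.range m,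
          (transport L κ)^[n] (interiorSeed L κ fun _ => 1) t z := by rw [Finset.mul_sum]
      _ ≤ M * α := mul_le_mul_of_nonneg_left (hsurv z hz m) hM
      _ = α * M := mul_comm _ _
  · rw [semigroup_of_notMem hz, abs_zero]
    positivity

theorem measurable_semigroup (hκ : 0 ≤ κ) (ht : 0 ≤ t) (hm : Measurable ℓ)
    (hℓ : ∀ w, |ℓ w| ≤ M) : Measurable (semigroup L κ t ℓ) := by
  refine measurable_of_tendsto_metrizable (f := fun m : ℕ => (slabPhase L).indicator fun z =>
    ∑ n ∈ Finset.range m, (transport L κ)^[n] (interiorSeed L κ ℓ) t z) (fun m => ?_) ?_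
  · refine Measurable.indicator ?_ (measurableSet_slabPhase L)
    refine Finset.measurable_sum _ fun n _ => ?_
    exact ((bddMeas_interiorSeed (L := L) (T := t) hκ hm hℓ).iterate hκ n).1.comp
      measurable_prodMk_left
  · rw [tendsto_pi_nhds]
    intro z
    by_cases hz : z ∈ slabPhase L
    · simp only [Set.indicator_of_mem hz]
      exact (hasSum_semigroup hκ hℓ ht hz).tendsto_sum_nat
    · simp only [Set.indicator_of_notMem hz, semigroup_of_notMem hz]
      exact tendsto_const_nhds

/-! ### Independence of the representative -/

theorem agreeAE_interiorSeed (hle : ℓ =ᵐ[phaseMeasure] ℓ') (L κ : ℝ) :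
    AgreeAE (interiorSeed L κ ℓ) (interiorSeed L κ ℓ') := by
  set N := toMeasurable phaseMeasure {z | ℓ z ≠ ℓ' z}
  have hN : MeasurableSet N := measurableSet_toMeasurable _ _
  have hN0 : phaseMeasure N = 0 := by
    rw [measure_toMeasurable]
    exact hle
  refine ⟨(fun q : ℝ × Phase => stream q.1 q.2) ⁻¹' N, measurable_stream hN, fun r => ?_,
    fun r z hz => ?_⟩
  · exact ((measurePreserving_stream r).measure_preimage hN.nullMeasurableSet).trans hN0
  · have : ℓ (stream r z) = ℓ' (stream r z) := by
      by_contra hne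
      exact hz (subset_toMeasurable _ _ hne)
    simp only [interiorSeed]
    by_cases hs : stream r z ∈ closedSlabPhase L
    · simp only [Set.indicator_of_mem hs, this]
    · simp only [Set.indicator_of_notMem hs]

theorem semigroup_congr_ae (hle : ℓ =ᵐ[phaseMeasure] ℓ') (ht : 0 ≤ t) :
    semigroup L κ t ℓ =ᵐ[phaseMeasure] semigroup L κ t ℓ' := by
  have h1 : ∀ᵐ z ∂phaseMeasure, ∀ n, (transport L κ)^[n] (interiorSeed L κ ℓ) t z =
      (transport L κ)^[n] (interiorSeed L κ ℓ') t z :=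
    ae_all_iff.2 fun n => ((agreeAE_interiorSeed hle L κ).iterate L κ n).ae_eq t
  filter_upwards [h1] with z hz
  by_cases hs : z ∈ slabPhase L
  · rw [semigroup_apply ℓ ht hs, semigroup_apply ℓ' ht hs]
    exact tsum_congr hz
  · rw [semigroup_of_notMem hs, semigroup_of_notMem hs]

/-! ### The mild form of the stationary equation -/

/-- The contribution of the first collision, at any time before the exit from the strip. -/
def freeReturn (L κ : ℝ) (h : Phase → ℝ) (z : Phase) : ℝ :=
  ∫ s in Set.Ioi (0 : ℝ), κ * Real.exp (-2 * κ * s) *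
    (slabPhase L).indicator (scatterIntegral h) (stream s z)

/-- The mild form of the stationary equation, for functions that are equal to the reservoir data
outside of the strip. -/
def IsMildSolution (L κ ρ₁ ρ₂ : ℝ) (h : Phase → ℝ) : Prop :=
  (∀ z ∈ slabPhase L, h z = boundaryValue L κ ρ₁ ρ₂ z + freeReturn L κ h z) ∧
    ∀ z ∉ slabPhase L, h z = reservoir L ρ₁ ρ₂ z

theorem abs_indicator_scatterIntegral_le (hM : ∀ w ∈ slabPhase L, |h w| ≤ M)
    (hM0 : 0 ≤ M) (z : Phase) :
    |(slabPhase L).indicator (scatterIntegral h) z| ≤ 2 * M := by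
  by_cases hz : z ∈ slabPhase L
  · rw [Set.indicator_of_mem hz]
    exact abs_scatterIntegral_le fun ρ => hM _ (collideAt_mem_slabPhase.2 hz)
  · rw [Set.indicator_of_notMem hz, abs_zero]
    positivity

theorem measurable_freeReturn_integrand (hm : Measurable h) :
    Measurable fun q : Phase × ℝ => κ * Real.exp (-2 * κ * q.2) *
      (slabPhase L).indicator (scatterIntegral h) (stream q.2 q.1) := by
  have h1 := ((measurable_scatterIntegral hm).indicator (measurableSet_slabPhase L)).comp
    (measurable_stream.comp measurable_swap)
  refine Measurable.mul (by fun_prop) h1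

theorem integrableOn_exp_neg_mul (hκ : 0 < κ) (a : ℝ) :
    IntegrableOn (fun s => a * Real.exp (-2 * κ * s)) (Set.Ioi 0) :=
  (integrableOn_exp_mul_Ioi (by linarith) 0).const_mul a

theorem abs_freeReturn_integrand_le (hκ : 0 < κ) (hM : ∀ w ∈ slabPhase L, |h w| ≤ M)
    (hM0 : 0 ≤ M) (s : ℝ) (z : Phase) :
    |κ * Real.exp (-2 * κ * s) * (slabPhase L).indicator (scatterIntegral h) (stream s z)| ≤
      2 * M * κ * Real.exp (-2 * κ * s) := by
  rw [abs_mul, abs_of_pos (by positivity)]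
  calc _ ≤ κ * Real.exp (-2 * κ * s) * (2 * M) :=
        mul_le_mul_of_nonneg_left (abs_indicator_scatterIntegral_le hM hM0 _) (by positivity)
    _ = _ := by ring

theorem integrableOn_freeReturn (hκ : 0 < κ) (hm : Measurable h)
    (hM : ∀ w ∈ slabPhase L, |h w| ≤ M) (hM0 : 0 ≤ M) (z : Phase) :
    IntegrableOn (fun s => κ * Real.exp (-2 * κ * s) *
      (slabPhase L).indicator (scatterIntegral h) (stream s z)) (Set.Ioi 0) := by
  refine Integrable.mono' (integrableOn_exp_neg_mul hκ (2 * M * κ))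
    ((measurable_freeReturn_integrand hm).comp measurable_prodMk_left).aestronglyMeasurable
    (ae_of_all _ fun s => abs_freeReturn_integrand_le hκ hM hM0 s z)

theorem measurable_freeReturn (hm : Measurable h) : Measurable (freeReturn L κ h) :=
  ((measurable_freeReturn_integrand hm).stronglyMeasurable.integral_prod_right'
    (ν := volume.restrict (Set.Ioi (0 : ℝ)))).measurable

theorem stream_notMem_of_le {s : ℝ} (hz : z ∈ slabPhase L) (ht : 0 ≤ t)
    (hs : stream t z ∉ slabPhase L) (hts : t ≤ s) : stream s z ∉ slabPhase L := by
  intro hmem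
  rcases hts.lt_or_eq with h | h
  · exact hs (stream_mem_slabPhase hz ht h (slabPhase_subset_closed hmem))
  · exact hs (h ▸ hmem)

theorem freeReturn_eq_transport (hz : z ∈ slabPhase L) (ht : 0 ≤ t)
    (hs : stream t z ∉ slabPhase L) (h : Phase → ℝ) :
    freeReturn L κ h z = transport L κ (fun _ => h) t z := by
  rw [transport_eq_integral, intervalIntegral.integral_of_le ht, freeReturn]
  refine setIntegral_eq_of_subset_of_forall_sdiff_eq_zero measurableSet_Ioi
    Set.Ioc_subset_Ioi_self fun s hs' => ?_
  have h1 : t ≤ s := by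
    by_contra hc
    exact hs'.2 ⟨hs'.1, (not_le.1 hc).le⟩
  rw [Set.indicator_of_notMem (stream_notMem_of_le hz ht hs h1), mul_zero]

/-- Splitting the flight at time `t` and shifting the tail by `t` restarts it at `stream t z`. -/
theorem freeReturn_eq_add (hκ : 0 < κ) (hm : Measurable h)
    (hM : ∀ w ∈ slabPhase L, |h w| ≤ M) (hM0 : 0 ≤ M) (ht : 0 ≤ t) (z : Phase) :
    freeReturn L κ h z = transport L κ (fun _ => h) t z +
      Real.exp (-2 * κ * t) * freeReturn L κ h (stream t z) := by
  set f : ℝ → ℝ := fun s => κ * Real.exp (-2 * κ * s) *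
      (slabPhase L).indicator (scatterIntegral h) (stream s z) with hf
  have hi : IntegrableOn f (Set.Ioi 0) := integrableOn_freeReturn hκ hm hM hM0 z
  have h1 : ∫ s in Set.Ioi 0, f s = (∫ s in Set.Ioc 0 t, f s) + ∫ s in Set.Ioi t, f s := by
    rw [← Set.Ioc_union_Ioi_eq_Ioi ht]
    exact setIntegral_union Set.Ioc_disjoint_Ioi_same measurableSet_Ioi
      (hi.mono_set Set.Ioc_subset_Ioi_self) (hi.mono_set (Set.Ioi_subset_Ioi ht))
  have h2 := (measurePreserving_add_right volume t).setIntegral_preimage_emb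
    (measurableEmbedding_addRight t) f (Set.Ioi t)
  rw [Set.preimage_add_const_Ioi, sub_self] at h2
  rw [transport_eq_integral, intervalIntegral.integral_of_le ht]
  refine h1.trans ?_
  rw [← h2, freeReturn, ← integral_const_mul]
  congr 1
  refine integral_congr_ae (ae_of_all _ fun s => ?_)
  simp only [hf]
  rw [stream_stream, add_comm t s, ← mul_assoc]
  congr 1
  have : Real.exp (-2 * κ * (s + t)) = Real.exp (-2 * κ * t) * Real.exp (-2 * κ * s) := by
    rw [← Real.exp_add]; congr 1; ring
  rw [this]
  ring

theorem entryTime_stream (hv : (z.2 : Plane) 0 ≠ 0) (s : ℝ) :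
    entryTime L (stream s z) = entryTime L z - s := by
  simp only [entryTime, stream_fst_zero, stream_snd]
  split_ifs
  · field_simp
  · field_simp
    ring

/-- Here `entryTime` is a division by zero, but this does no harm: the reservoir vanishes unless
`v₁` has a strict sign. -/
theorem boundaryValue_of_velocity_eq_zero {ρ₁ ρ₂ : ℝ} (hv : (z.2 : Plane) 0 = 0) :
    boundaryValue L κ ρ₁ ρ₂ z = 0 := by
  rw [boundaryValue, reservoir]
  simp [hv]

theorem boundaryValue_stream {ρ₁ ρ₂ : ℝ} (s : ℝ) (z : Phase) :
    boundaryValue L κ ρ₁ ρ₂ z =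
      Real.exp (-2 * κ * s) * boundaryValue L κ ρ₁ ρ₂ (stream s z) := by
  by_cases hv : (z.2 : Plane) 0 = 0
  · rw [boundaryValue_of_velocity_eq_zero hv,
      boundaryValue_of_velocity_eq_zero (z := stream s z) hv, mul_zero]
  · rw [boundaryValue, boundaryValue, entryTime_stream hv, stream_stream, add_sub_cancel,
      ← mul_assoc, ← Real.exp_add]
    congr 2
    ring

/-- The mild equation up to the time `t`. -/
theorem IsMildSolution.eq_add {ρ₁ ρ₂ : ℝ} (hh : IsMildSolution L κ ρ₁ ρ₂ h) (hκ : 0 < κ)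
    (hm : Measurable h) (hM : ∀ w, |h w| ≤ M) (ht : 0 ≤ t) (hz : z ∈ slabPhase L) :
    h z = interiorSeed L κ h t z + boundarySeed L κ ρ₁ ρ₂ t z +
      transport L κ (fun _ => h) t z := by
  have hM0 : 0 ≤ M := (abs_nonneg _).trans (hM z)
  rw [hh.1 z hz]
  by_cases hs : stream t z ∈ slabPhase L
  · rw [interiorSeed, boundarySeed, if_pos (slabPhase_subset_closed hs),
      Set.indicator_of_mem (slabPhase_subset_closed hs), hh.1 _ hs,
      freeReturn_eq_add hκ hm (fun w _ => hM w) hM0 ht, boundaryValue_stream t]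
    ring
  · obtain ⟨-, -, -, -, -, h6⟩ := entryTime_spec hz ht hs
    rw [freeReturn_eq_transport hz ht hs]
    congr 1
    -- If the path ends exactly on the boundary, `interiorSeed` evaluates `h` there, and the second
    -- clause of `IsMildSolution` supplies the reservoir value.
    by_cases hc : stream t z ∈ closedSlabPhase L
    · have hb : (stream t z).1 ∈ slabBoundary L := by
        rw [mem_slabBoundary]
        rw [mem_slabPhase] at hs
        rw [mem_closedSlabPhase] at hc
        by_contra hne
        rw [not_or] at hne
        exact hs ⟨lt_of_le_of_ne hc.1 (Ne.symm hne.1), lt_of_le_of_ne hc.2 hne.2⟩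
      rw [interiorSeed, boundarySeed, if_pos hc, Set.indicator_of_mem hc, add_zero, hh.2 _ hs,
        boundaryValue, ← h6 t ht hb]
    · rw [interiorSeed, boundarySeed, if_neg hc, Set.indicator_of_notMem hc, zero_add]

theorem abs_reservoir_le {ρ₁ ρ₂ : ℝ} (h1 : |ρ₁| ≤ M) (h2 : |ρ₂| ≤ M) (z : Phase) :
    |reservoir L ρ₁ ρ₂ z| ≤ M := by
  rw [reservoir]
  split_ifs
  · exact h1
  · exact h2
  · simpa using (abs_nonneg _).trans h1

theorem entryTime_nonneg (hz : z ∈ slabPhase L) : 0 ≤ entryTime L z := by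
  rw [mem_slabPhase] at hz
  rw [entryTime]
  split_ifs with hv
  · exact div_nonneg hz.1.le hv.le
  · exact div_nonneg_of_nonpos (by linarith) (not_lt.1 hv)

theorem abs_boundaryValue_le {ρ₁ ρ₂ : ℝ} (hκ : 0 ≤ κ) (h1 : |ρ₁| ≤ M) (h2 : |ρ₂| ≤ M)
    (hz : z ∈ slabPhase L) : |boundaryValue L κ ρ₁ ρ₂ z| ≤ M := by
  rw [boundaryValue, abs_mul, abs_of_pos (Real.exp_pos _)]
  calc _ ≤ 1 * M := mul_le_mul (exp_neg_le_one hκ (entryTime_nonneg hz))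
        (abs_reservoir_le h1 h2 _) (abs_nonneg _) zero_le_one
    _ = M := one_mul M

theorem measurable_reservoir (L ρ₁ ρ₂ : ℝ) : Measurable (reservoir L ρ₁ ρ₂) := by
  have hx : Measurable fun z : Phase => z.1 0 := by fun_prop
  have hv : Measurable fun z : Phase => (z.2 : Plane) 0 := by fun_prop
  unfold reservoir
  refine Measurable.ite ?_ measurable_const (Measurable.ite ?_ measurable_const measurable_const)
  · exact (measurableSet_eq_fun hx measurable_const).inter (measurableSet_lt measurable_const hv)
  · exact (measurableSet_eq_fun hx measurable_const).inter (measurableSet_lt hv measurable_const)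

theorem measurable_entryTime (L : ℝ) : Measurable (entryTime L) := by
  have hx : Measurable fun z : Phase => z.1 0 := by fun_prop
  have hv : Measurable fun z : Phase => (z.2 : Plane) 0 := by fun_prop
  unfold entryTime
  exact Measurable.ite (measurableSet_lt measurable_const hv) (hx.div hv)
    ((hx.sub measurable_const).div hv)

theorem measurable_boundaryValue (L κ ρ₁ ρ₂ : ℝ) : Measurable (boundaryValue L κ ρ₁ ρ₂) := by
  have h1 := measurable_entryTime L
  have h2 : Measurable fun z => reservoir L ρ₁ ρ₂ (stream (entryTime L z) z) :=
    (measurable_reservoir L ρ₁ ρ₂).comp (measurable_stream.comp (h1.prodMk measurable_id))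
  unfold boundaryValue
  exact ((h1.const_mul _).exp).mul h2

theorem abs_boundarySeed_le {ρ₁ ρ₂ : ℝ} (hκ : 0 ≤ κ) (h1 : |ρ₁| ≤ M) (h2 : |ρ₂| ≤ M)
    (hz : z ∈ slabPhase L) (t : ℝ) : |boundarySeed L κ ρ₁ ρ₂ t z| ≤ M := by
  rw [boundarySeed]
  split_ifs
  · simpa using (abs_nonneg _).trans h1
  · exact abs_boundaryValue_le hκ h1 h2 hz

theorem bddMeas_boundarySeed {ρ₁ ρ₂ : ℝ} (hκ : 0 ≤ κ) :
    BddMeas L T (boundarySeed L κ ρ₁ ρ₂) := by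
  refine ⟨?_, max |ρ₁| |ρ₂|, fun r _ w hw =>
    abs_boundarySeed_le hκ (le_max_left _ _) (le_max_right _ _) hw r⟩
  unfold boundarySeed
  refine Measurable.ite (measurable_stream (measurableSet_closedSlabPhase L)) measurable_const ?_
  exact (measurable_boundaryValue L κ ρ₁ ρ₂).comp measurable_snd

/-- A mild solution is invariant under the evolution with reservoirs. -/
theorem IsMildSolution.eq_semigroup_add_outer {ρ₁ ρ₂ : ℝ} (hh : IsMildSolution L κ ρ₁ ρ₂ h)
    (hκ : 0 < κ) (hm : Measurable h) (hM : ∀ w, |h w| ≤ M) (ht : 0 ≤ t)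
    (hz : z ∈ slabPhase L) :
    h z = semigroup L κ t h z + outer L κ ρ₁ ρ₂ t z := by
  set S := interiorSeed L κ h with hS
  set B := boundarySeed L κ ρ₁ ρ₂ with hB
  have hSb : BddMeas L t S := bddMeas_interiorSeed hκ.le hm hM
  have hBb : BddMeas L t B := bddMeas_boundarySeed hκ.le
  have hH : BddMeas L t (fun _ => h) := ⟨hm.comp measurable_snd, M, fun _ _ w _ => hM w⟩
  -- `IsMildSolution.eq_add` iterated `m` times. The remainder is the general term of a convergent
  -- series, so it tends to zero.
  have hexp : ∀ m, h z = (∑ n ∈ Finset.range m, (transport L κ)^[n] S t z) +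
      (∑ n ∈ Finset.range m, (transport L κ)^[n] B t z) +
      (transport L κ)^[m] (fun _ => h) t z := by
    intro m
    induction m with
    | zero => simp
    | succ m ih =>
      have h1 : (transport L κ)^[m] (fun _ => h) t z =
          (transport L κ)^[m] (S + B + transport L κ fun _ => h) t z :=
        iterate_transport_congr (T := t) (fun r hr w hw =>
          hh.eq_add hκ hm hM hr.1 hw) m ⟨ht, le_rfl⟩ hz
      rw [iterate_transport_add hκ.le (hSb.add hBb) (hH.transport hκ.le) m ⟨ht, le_rfl⟩ hz,
        iterate_transport_add hκ.le hSb hBb m ⟨ht, le_rfl⟩ hz,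
        ← Function.iterate_succ_apply] at h1
      rw [Finset.sum_range_succ, Finset.sum_range_succ]
      linarith
  have l1 := (hasSum_semigroup (L := L) hκ.le hM ht hz).tendsto_sum_nat
  have l2 := (summable_iterate_transport (F := B) hκ.le (fun r _ w hw =>
    abs_boundarySeed_le (ρ₁ := ρ₁) (ρ₂ := ρ₂) hκ.le (le_max_left |ρ₁| |ρ₂|)
      (le_max_right |ρ₁| |ρ₂|) hw r) ht hz).hasSum.tendsto_sum_nat
  have l3 := (summable_iterate_transport (F := fun _ => h) (L := L) hκ.le
    (fun r _ w _ => hM w) ht hz).tendsto_atTop_zero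
  rw [outer_apply ρ₁ ρ₂ ht hz]
  have l4 := (l1.add l2).add l3
  rw [add_zero] at l4
  exact tendsto_nhds_unique (tendsto_const_nhds.congr hexp) l4

end

section

variable {L κ T t M : ℝ} {z : Phase} {ℓ ℓ' h h' : Phase → ℝ}

/-! ### Construction of mild solutions by monotone iteration -/

theorem scatterIntegral_mono_of_mem (hm : Measurable h) (hm' : Measurable h')
    (hM : ∀ w ∈ slabPhase L, |h w| ≤ M) (hM' : ∀ w ∈ slabPhase L, |h' w| ≤ M)
    (hle : ∀ w ∈ slabPhase L, h w ≤ h' w) (z : Phase) :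
    (slabPhase L).indicator (scatterIntegral h) z ≤
      (slabPhase L).indicator (scatterIntegral h') z := by
  by_cases hz : z ∈ slabPhase L
  · simp only [Set.indicator_of_mem hz]
    exact scatterIntegral_mono hm hm' (fun ρ => hM _ (collideAt_mem_slabPhase.2 hz))
      (fun ρ => hM' _ (collideAt_mem_slabPhase.2 hz))
      (fun ρ => hle _ (collideAt_mem_slabPhase.2 hz))
  · simp only [Set.indicator_of_notMem hz, le_refl]

theorem freeReturn_mono (hκ : 0 < κ) (hm : Measurable h) (hm' : Measurable h')
    (hM : ∀ w ∈ slabPhase L, |h w| ≤ M) (hM' : ∀ w ∈ slabPhase L, |h' w| ≤ M) (hM0 : 0 ≤ M)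
    (hle : ∀ w ∈ slabPhase L, h w ≤ h' w) (z : Phase) :
    freeReturn L κ h z ≤ freeReturn L κ h' z :=
  integral_mono (integrableOn_freeReturn hκ hm hM hM0 z)
    (integrableOn_freeReturn hκ hm' hM' hM0 z) fun _ =>
    mul_le_mul_of_nonneg_left (scatterIntegral_mono_of_mem hm hm' hM hM' hle _) (by positivity)

theorem freeReturn_const_mul (a : ℝ) (h : Phase → ℝ) (z : Phase) :
    freeReturn L κ (fun w => a * h w) z = a * freeReturn L κ h z := by
  have h1 : scatterIntegral (fun w => a * h w) = fun w => a * scatterIntegral h w := by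
    funext w
    exact intervalIntegral.integral_const_mul _ _
  rw [freeReturn, freeReturn, ← integral_const_mul]
  congr 1
  funext s
  rw [h1]
  by_cases hz : stream s z ∈ slabPhase L
  · simp only [Set.indicator_of_mem hz]; ring
  · simp only [Set.indicator_of_notMem hz]; ring

theorem tendsto_freeReturn {u : ℕ → Phase → ℝ} (hκ : 0 < κ) (hm : ∀ n, Measurable (u n))
    (hM : ∀ n, ∀ w ∈ slabPhase L, |u n w| ≤ M) (hM0 : 0 ≤ M)
    (hlim : ∀ w ∈ slabPhase L, Tendsto (fun n => u n w) atTop (𝓝 (h w))) (z : Phase) :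
    Tendsto (fun n => freeReturn L κ (u n) z) atTop (𝓝 (freeReturn L κ h z)) := by
  refine tendsto_integral_of_dominated_convergence
    (fun s => 2 * M * κ * Real.exp (-2 * κ * s)) (fun n =>
      (integrableOn_freeReturn hκ (hm n) (hM n) hM0 z).1)
    (integrableOn_exp_neg_mul hκ (2 * M * κ))
    (fun n => ae_of_all _ fun s => abs_freeReturn_integrand_le hκ (hM n) hM0 s z)
    (ae_of_all _ fun s => ?_)
  refine Tendsto.const_mul _ ?_
  by_cases hz : stream s z ∈ slabPhase L
  · simp only [Set.indicator_of_mem hz]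
    refine intervalIntegral.tendsto_integral_filter_of_dominated_convergence (fun _ => M)
      (Eventually.of_forall fun n =>
        ((hm n).comp (measurable_collideAt_left _)).aestronglyMeasurable)
      (Eventually.of_forall fun n => ae_of_all _ fun ρ _ =>
        hM n _ (collideAt_mem_slabPhase.2 hz)) (by simp)
      (ae_of_all _ fun ρ _ => hlim _ (collideAt_mem_slabPhase.2 hz))
  · simp only [Set.indicator_of_notMem hz]
    exact tendsto_const_nhds

theorem freeReturn_eq_integral_entryTime (hz : z ∈ slabPhase L) (hv : (z.2 : Plane) 0 ≠ 0)
    (h : Phase → ℝ) :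
    freeReturn L κ h z = ∫ s in (0 : ℝ)..entryTime L z,
      κ * Real.exp (-2 * κ * s) * scatterIntegral h (stream s z) := by
  have hb : (stream (entryTime L z) z).1 ∈ slabBoundary L := by
    rw [mem_slabBoundary, stream_fst_zero, entryTime]
    split_ifs with h0
    · left; field_simp; ring
    · right; field_simp; ring
  have hns : stream (entryTime L z) z ∉ slabPhase L := fun hmem => notMem_slabBoundary hmem hb
  have h0 := entryTime_nonneg hz
  rw [freeReturn_eq_transport hz h0 hns]
  have hcl : stream (entryTime L z) z ∈ closedSlabPhase L := by
    have hL : 0 < L := hz.1.trans hz.2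
    rw [mem_slabBoundary] at hb
    rw [mem_closedSlabPhase]
    rcases hb with h | h <;> rw [h] <;> constructor <;> linarith
  exact transport_eq_integral_exit h0 le_rfl
    (fun s h0 h1 => stream_mem_slabPhase hz h0 h1 hcl)
    (fun s h1 h2 => absurd h1 h2.not_gt)

theorem integral_exp_neg_mul (κ a : ℝ) :
    ∫ s in (0 : ℝ)..a, 2 * κ * Real.exp (-2 * κ * s) = 1 - Real.exp (-2 * κ * a) := by
  have hder : ∀ s ∈ Set.uIcc 0 a, HasDerivAt (fun s => -Real.exp (-2 * κ * s))
      (2 * κ * Real.exp (-2 * κ * s)) s := fun s _ => by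
    have := ((hasDerivAt_id s).const_mul (-2 * κ)).exp.neg
    refine this.congr_deriv ?_
    simp; ring
  rw [intervalIntegral.integral_eq_sub_of_hasDerivAt hder
    ((by fun_prop : Continuous fun s => 2 * κ * Real.exp (-2 * κ * s)).intervalIntegrable _ _)]
  simp
  ring

/-- Constants are supersolutions of the mild equation with smaller reservoir data. -/
theorem boundaryValue_add_freeReturn_le {ρ₁ ρ₂ : ℝ} (hκ : 0 < κ) (h1 : |ρ₁| ≤ M)
    (h2 : |ρ₂| ≤ M) (hz : z ∈ slabPhase L) :
    boundaryValue L κ ρ₁ ρ₂ z + freeReturn L κ (fun _ => M) z ≤ M := by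
  have hM0 : 0 ≤ M := (abs_nonneg _).trans h1
  by_cases hv : (z.2 : Plane) 0 = 0
  -- Parallel to the boundary the flight never leaves the strip, and the density `2κ e^{-2κs}` has
  -- total mass one.
  · rw [boundaryValue_of_velocity_eq_zero hv, zero_add]
    have hle : freeReturn L κ (fun _ => M) z ≤
        ∫ s in Set.Ioi (0 : ℝ), 2 * M * κ * Real.exp (-2 * κ * s) := by
      refine integral_mono (integrableOn_freeReturn hκ measurable_const
        (fun w _ => (abs_of_nonneg hM0).le) hM0 z) (integrableOn_exp_neg_mul hκ _) fun s => ?_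
      exact (le_abs_self _).trans (abs_freeReturn_integrand_le hκ
        (fun w _ => (abs_of_nonneg hM0).le) hM0 s z)
    refine hle.trans (le_of_eq ?_)
    rw [integral_const_mul, integral_exp_mul_Ioi (by linarith)]
    field_simp
    simp
  · rw [freeReturn_eq_integral_entryTime hz hv]
    have h3 : ∀ s, κ * Real.exp (-2 * κ * s) * scatterIntegral (fun _ => M) (stream s z) =
        M * (2 * κ * Real.exp (-2 * κ * s)) := fun s => by
      rw [scatterIntegral_const]; ring
    simp_rw [h3]
    rw [intervalIntegral.integral_const_mul, integral_exp_neg_mul, boundaryValue]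
    have := (le_abs_self _).trans (abs_reservoir_le (L := L) h1 h2 (stream (entryTime L z) z))
    nlinarith [Real.exp_pos (-2 * κ * entryTime L z)]

open Classical in
/-- The right side of the mild equation. -/
def mildStep (L κ ρ₁ ρ₂ : ℝ) (h : Phase → ℝ) (z : Phase) : ℝ :=
  if z ∈ slabPhase L then boundaryValue L κ ρ₁ ρ₂ z + freeReturn L κ h z
  else reservoir L ρ₁ ρ₂ z

theorem isMildSolution_iff {ρ₁ ρ₂ : ℝ} :
    IsMildSolution L κ ρ₁ ρ₂ h ↔ mildStep L κ ρ₁ ρ₂ h = h := by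
  constructor
  · intro hh
    funext z
    rw [mildStep]
    split_ifs with hz
    · exact (hh.1 z hz).symm
    · exact (hh.2 z hz).symm
  · intro hh
    refine ⟨fun z hz => ?_, fun z hz => ?_⟩
    · rw [← congrFun hh z, mildStep, if_pos hz]
    · rw [← congrFun hh z, mildStep, if_neg hz]

theorem measurable_mildStep {ρ₁ ρ₂ : ℝ} (hm : Measurable h) :
    Measurable (mildStep L κ ρ₁ ρ₂ h) :=
  Measurable.ite (measurableSet_slabPhase L)
    ((measurable_boundaryValue L κ ρ₁ ρ₂).add (measurable_freeReturn hm))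
    (measurable_reservoir L ρ₁ ρ₂)

theorem reservoir_nonneg {ρ₁ ρ₂ : ℝ} (h1 : 0 ≤ ρ₁) (h2 : 0 ≤ ρ₂) (z : Phase) :
    0 ≤ reservoir L ρ₁ ρ₂ z := by
  rw [reservoir]
  split_ifs
  · exact h1
  · exact h2
  · exact le_rfl

theorem mildStep_mono {ρ₁ ρ₂ : ℝ} (hκ : 0 < κ) (hm : Measurable h) (hm' : Measurable h')
    (hM : ∀ w ∈ slabPhase L, |h w| ≤ M) (hM' : ∀ w ∈ slabPhase L, |h' w| ≤ M) (hM0 : 0 ≤ M)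
    (hle : ∀ w, h w ≤ h' w) (z : Phase) :
    mildStep L κ ρ₁ ρ₂ h z ≤ mildStep L κ ρ₁ ρ₂ h' z := by
  rw [mildStep, mildStep]
  split_ifs with hz
  · linarith [freeReturn_mono hκ hm hm' hM hM' hM0 (fun w _ => hle w) z]
  · exact le_rfl

theorem freeReturn_zero (z : Phase) : freeReturn L κ (fun _ => 0) z = 0 := by
  simpa using freeReturn_const_mul (L := L) (κ := κ) 0 (fun _ => 0) z

theorem mildStep_mem_Icc {ρ₁ ρ₂ : ℝ} (hκ : 0 < κ) (h1 : ρ₁ ∈ Set.Icc 0 M)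
    (h2 : ρ₂ ∈ Set.Icc 0 M) (hm : Measurable h) (hh : ∀ w, h w ∈ Set.Icc 0 M) (z : Phase) :
    mildStep L κ ρ₁ ρ₂ h z ∈ Set.Icc 0 M := by
  have h1' : |ρ₁| ≤ M := by rw [abs_of_nonneg h1.1]; exact h1.2
  have h2' : |ρ₂| ≤ M := by rw [abs_of_nonneg h2.1]; exact h2.2
  have hM0 : 0 ≤ M := h1.1.trans h1.2
  have hh' : ∀ w ∈ slabPhase L, |h w| ≤ M := fun w _ => by
    rw [abs_of_nonneg (hh w).1]; exact (hh w).2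
  have hc : ∀ w ∈ slabPhase L, |(fun _ => M : Phase → ℝ) w| ≤ M := fun w _ =>
    (abs_of_nonneg hM0).le
  have h0 : ∀ w ∈ slabPhase L, |(fun _ => 0 : Phase → ℝ) w| ≤ M := fun w _ => by simpa
  rw [mildStep]
  split_ifs with hz
  · have hb : 0 ≤ boundaryValue L κ ρ₁ ρ₂ z :=
      mul_nonneg (Real.exp_pos _).le (reservoir_nonneg h1.1 h2.1 _)
    have hlow := freeReturn_mono (κ := κ) hκ measurable_const hm h0 hh' hM0
      (fun w _ => (hh w).1) z
    have hup := freeReturn_mono (κ := κ) hκ hm measurable_const hh' hc hM0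
      (fun w _ => (hh w).2) z
    rw [freeReturn_zero] at hlow
    exact ⟨by linarith, by linarith [boundaryValue_add_freeReturn_le hκ h1' h2' hz]⟩
  · exact ⟨reservoir_nonneg h1.1 h2.1 z, (le_abs_self _).trans (abs_reservoir_le h1' h2' z)⟩

theorem measurable_iterate_mildStep {ρ₁ ρ₂ : ℝ} (hm : Measurable h) (n : ℕ) :
    Measurable ((mildStep L κ ρ₁ ρ₂)^[n] h) := by
  induction n with
  | zero => exact hm
  | succ n ih => rw [Function.iterate_succ_apply']; exact measurable_mildStep ih

theorem iterate_mildStep_mem_Icc {ρ₁ ρ₂ : ℝ} (hκ : 0 < κ) (h1 : ρ₁ ∈ Set.Icc 0 M)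
    (h2 : ρ₂ ∈ Set.Icc 0 M) (hm : Measurable h) (hh : ∀ w, h w ∈ Set.Icc 0 M) (n : ℕ)
    (z : Phase) : (mildStep L κ ρ₁ ρ₂)^[n] h z ∈ Set.Icc 0 M := by
  induction n generalizing z with
  | zero => exact hh z
  | succ n ih =>
    rw [Function.iterate_succ_apply']
    exact mildStep_mem_Icc hκ h1 h2 (measurable_iterate_mildStep hm n) ih z

theorem abs_le_of_mem_Icc_zero {x : ℝ} (hx : x ∈ Set.Icc 0 M) : |x| ≤ M := by
  rw [abs_of_nonneg hx.1]; exact hx.2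

/-- A pointwise limit of the iteration of the mild equation is a mild solution. -/
theorem isMildSolution_of_tendsto {ρ₁ ρ₂ : ℝ} (hκ : 0 < κ) (h1 : ρ₁ ∈ Set.Icc 0 M)
    (h2 : ρ₂ ∈ Set.Icc 0 M) (hm : Measurable ℓ) (hℓ : ∀ w, ℓ w ∈ Set.Icc 0 M)
    (hlim : ∀ w, Tendsto (fun n => (mildStep L κ ρ₁ ρ₂)^[n] ℓ w) atTop (𝓝 (h w))) :
    Measurable h ∧ (∀ w, h w ∈ Set.Icc 0 M) ∧ IsMildSolution L κ ρ₁ ρ₂ h := by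
  have hmeas := fun n => measurable_iterate_mildStep (L := L) (κ := κ) (ρ₁ := ρ₁) (ρ₂ := ρ₂) hm n
  have hmem := fun n w => iterate_mildStep_mem_Icc (L := L) hκ h1 h2 hm hℓ n w
  refine ⟨measurable_of_tendsto_metrizable hmeas (tendsto_pi_nhds.2 hlim),
    fun w => isClosed_Icc.mem_of_tendsto (hlim w) (Eventually.of_forall fun n => hmem n w), ?_⟩
  rw [isMildSolution_iff]
  funext z
  have h3 := (tendsto_add_atTop_iff_nat 1).2 (hlim z)
  refine tendsto_nhds_unique ?_ h3
  simp only [Function.iterate_succ_apply', mildStep]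
  split_ifs with hz
  · exact (tendsto_freeReturn hκ hmeas (fun n w _ => abs_le_of_mem_Icc_zero (hmem n w))
      (h1.1.trans h1.2) (fun w _ => hlim w) z).const_add _
  · exact tendsto_const_nhds

/-- The iteration from zero increases and stays below the constant supersolution `M`. Its pointwise
limit solves the equation at every point, not only almost everywhere. -/
theorem exists_isMildSolution {ρ₁ ρ₂ : ℝ} (hκ : 0 < κ) (h1 : ρ₁ ∈ Set.Icc 0 M)
    (h2 : ρ₂ ∈ Set.Icc 0 M) :
    ∃ h : Phase → ℝ, Measurable h ∧ (∀ w, h w ∈ Set.Icc 0 M) ∧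
      IsMildSolution L κ ρ₁ ρ₂ h := by
  have hM0 : 0 ≤ M := h1.1.trans h1.2
  set u : ℕ → Phase → ℝ := fun n => (mildStep L κ ρ₁ ρ₂)^[n] fun _ => 0 with hu
  have h0 : ∀ w : Phase, (fun _ => 0 : Phase → ℝ) w ∈ Set.Icc 0 M := fun w => ⟨le_rfl, hM0⟩
  have hmem : ∀ n w, u n w ∈ Set.Icc 0 M := fun n w =>
    iterate_mildStep_mem_Icc hκ h1 h2 measurable_const h0 n w
  have hmono : ∀ n w, u n w ≤ u (n + 1) w := by
    intro n
    induction n with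
    | zero => exact fun w => (hmem 1 w).1
    | succ n ih =>
      intro w
      simp only [hu, Function.iterate_succ_apply'] at ih ⊢
      have hmn := measurable_iterate_mildStep (L := L) (κ := κ) (ρ₁ := ρ₁) (ρ₂ := ρ₂)
        (h := fun _ => 0) measurable_const
      exact mildStep_mono hκ (hmn n) (measurable_mildStep (hmn n))
        (fun w _ => abs_le_of_mem_Icc_zero (hmem n w))
        (fun w _ => by
          have := abs_le_of_mem_Icc_zero (hmem (n + 1) w)
          simpa only [hu, Function.iterate_succ_apply'] using this) hM0 ih w
  refine ⟨fun w => ⨆ n, u n w, isMildSolution_of_tendsto hκ h1 h2 measurable_const h0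
    fun w => ?_⟩
  exact tendsto_atTop_ciSup (monotone_nat_of_le_succ fun n => hmono n w)
    ⟨M, by rintro _ ⟨n, rfl⟩; exact (hmem n w).2⟩

/-! ### Decay without reservoirs -/

/-- The iteration that starts from one and has no reservoirs. -/
def decay (L κ : ℝ) (n : ℕ) : Phase → ℝ := (mildStep L κ 0 0)^[n] fun _ => 1

theorem decay_mem_Icc (hκ : 0 < κ) (n : ℕ) (z : Phase) : decay L κ n z ∈ Set.Icc 0 1 :=
  iterate_mildStep_mem_Icc (M := 1) hκ ⟨le_rfl, zero_le_one⟩ ⟨le_rfl, zero_le_one⟩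
    measurable_const (fun _ => ⟨zero_le_one, le_rfl⟩) n z

theorem measurable_decay (n : ℕ) : Measurable (decay L κ n) :=
  measurable_iterate_mildStep measurable_const n

theorem decay_succ_of_mem (hz : z ∈ slabPhase L) (n : ℕ) :
    decay L κ (n + 1) z = freeReturn L κ (decay L κ n) z := by
  rw [decay, Function.iterate_succ_apply', mildStep, if_pos hz, boundaryValue]
  simp [reservoir, decay]

theorem reservoir_zero (z : Phase) : reservoir L 0 0 z = 0 := by
  simp [reservoir]

theorem outer_zero (t : ℝ) (z : Phase) : outer L κ 0 0 t z = 0 := by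
  by_cases hz : z ∈ slabPhase L
  · rw [outer, Set.indicator_of_mem hz]
    simp only [reservoir_zero, mul_zero, ite_self, collisionIntegral_zero, tsum_zero]
  · exact outer_of_notMem hz

/-- Without reservoirs the iteration converges to zero if the survival probability is less than
one. -/
theorem tendsto_decay {α : ℝ} (hκ : 0 < κ) (ht : 0 ≤ t) (hα : 0 ≤ α) (hα1 : α < 1)
    (hsurv : ∀ z ∈ slabPhase L, ∀ m,
      ∑ n ∈ Finset.range m, (transport L κ)^[n] (interiorSeed L κ fun _ => 1) t z ≤ α)
    (z : Phase) : Tendsto (fun n => decay L κ n z) atTop (𝓝 0) := by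
  have hanti : ∀ n w, decay L κ (n + 1) w ≤ decay L κ n w := by
    intro n
    induction n with
    | zero => exact fun w => (decay_mem_Icc hκ 1 w).2
    | succ n ih =>
      intro w
      have h1 : ∀ k, decay L κ (k + 1) = mildStep L κ 0 0 (decay L κ k) := fun k =>
        Function.iterate_succ_apply' _ _ _
      have h2 := mildStep_mono (L := L) (κ := κ) (ρ₁ := 0) (ρ₂ := 0) (M := 1) hκ (measurable_decay _) (measurable_decay _)
        (fun w _ => abs_le_of_mem_Icc_zero (decay_mem_Icc hκ _ w))
        (fun w _ => abs_le_of_mem_Icc_zero (decay_mem_Icc hκ _ w)) zero_le_one ih w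
      rwa [← h1, ← h1] at h2
  have hlim : ∀ w, Tendsto (fun n => decay L κ n w) atTop (𝓝 (⨅ n, decay L κ n w)) :=
    fun w => tendsto_atTop_ciInf (antitone_nat_of_succ_le fun n => hanti n w)
      ⟨0, by rintro _ ⟨n, rfl⟩; exact (decay_mem_Icc hκ n w).1⟩
  set q : Phase → ℝ := fun w => ⨅ n, decay L κ n w with hq
  obtain ⟨hqm, hqI, hqs⟩ := isMildSolution_of_tendsto (M := 1) (h := q) hκ
    ⟨le_rfl, zero_le_one⟩ ⟨le_rfl, zero_le_one⟩ measurable_const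
    (fun _ => ⟨zero_le_one, le_rfl⟩) hlim
  -- The limit `q` is a mild solution with zero data, hence `q = S⁰(t) q` in the strip, and each use
  -- of this identity improves the bound by a factor `α`.
  have hpow : ∀ n : ℕ, ∀ w, |q w| ≤ α ^ n := by
    intro n
    induction n with
    | zero => exact fun w => by simpa using abs_le_of_mem_Icc_zero (hqI w)
    | succ n ih =>
      intro w
      by_cases hw : w ∈ slabPhase L
      · rw [hqs.eq_semigroup_add_outer hκ hqm ih ht hw, outer_zero, add_zero, pow_succ']
        exact abs_semigroup_le hκ.le ht hα hsurv hqm ih w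
      · rw [hqs.2 w hw, reservoir_zero, abs_zero]
        positivity
  have hq0 : q z = 0 := by
    have h1 := ge_of_tendsto' (tendsto_pow_atTop_nhds_zero_of_lt_one hα hα1) fun n => hpow n z
    exact abs_nonpos_iff.1 h1
  have := hlim z
  rwa [← hq0]

end

section

variable {L κ T t M : ℝ} {z : Phase} {ℓ ℓ' h h' : Phase → ℝ}

/-! ### Integration along characteristics -/

/-- Fubini on the triangle `s < r`. It serves as integration by parts for functions that are only
integrable. -/
theorem integral_mul_integral_tail {g p : ℝ → ℝ} {θ : ℝ} (hθ : 0 ≤ θ)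
    (hg : IntervalIntegrable g volume 0 θ) (hp : IntervalIntegrable p volume 0 θ) :
    ∫ s in (0 : ℝ)..θ, g s * ∫ r in s..θ, p r =
      ∫ r in (0 : ℝ)..θ, p r * ∫ s in (0 : ℝ)..r, g s := by
  rw [intervalIntegrable_iff_integrableOn_Ioc_of_le hθ] at hg hp
  set ν : Measure ℝ := volume.restrict (Set.Ioc 0 θ) with hν
  have hK : Integrable (fun x : ℝ × ℝ => {x : ℝ × ℝ | x.1 < x.2}.indicator
      (fun x => g x.1 * p x.2) x) (ν.prod ν) :=
    (Integrable.mul_prod hg hp).indicator (measurableSet_lt measurable_fst measurable_snd)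
  have hswap := integral_integral_swap
    (f := fun s r => {x : ℝ × ℝ | x.1 < x.2}.indicator (fun x => g x.1 * p x.2) (s, r)) hK
  rw [intervalIntegral.integral_of_le hθ, intervalIntegral.integral_of_le hθ]
  calc ∫ s in Set.Ioc 0 θ, g s * ∫ r in s..θ, p r
      = ∫ s, ∫ r, {x : ℝ × ℝ | x.1 < x.2}.indicator (fun x => g x.1 * p x.2) (s, r) ∂ν ∂ν := by
        refine setIntegral_congr_fun measurableSet_Ioc fun s hs => ?_
        rw [intervalIntegral.integral_of_le hs.2, ← integral_const_mul, hν]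
        have hsub : Set.Ioc s θ = Set.Ioc 0 θ ∩ Set.Ioi s := by
          ext r
          simp only [Set.mem_inter_iff, Set.mem_Ioc, Set.mem_Ioi]
          exact ⟨fun h => ⟨⟨hs.1.trans h.1, h.2⟩, h.1⟩, fun h => ⟨h.2, h.1.2⟩⟩
        rw [hsub, ← setIntegral_indicator measurableSet_Ioi]
        rfl
    _ = ∫ r, ∫ s, {x : ℝ × ℝ | x.1 < x.2}.indicator (fun x => g x.1 * p x.2) (s, r) ∂ν ∂ν :=
        hswap
    _ = ∫ r in Set.Ioc 0 θ, p r * ∫ s in (0 : ℝ)..r, g s := by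
        refine setIntegral_congr_fun measurableSet_Ioc fun r hr => ?_
        have hIoo : ∫ s in Set.Ioc 0 r, p r * g s = ∫ s in Set.Ioo 0 r, p r * g s :=
          integral_Ioc_eq_integral_Ioo
        rw [intervalIntegral.integral_of_le hr.1.le, ← integral_const_mul, hIoo, hν]
        have hsub : Set.Ioo 0 r = Set.Ioc 0 θ ∩ Set.Iio r := by
          ext s
          simp only [Set.mem_inter_iff, Set.mem_Ioc, Set.mem_Ioo, Set.mem_Iio]
          exact ⟨fun h => ⟨⟨h.1, h.2.le.trans hr.2⟩, h.2⟩, fun h => ⟨h.1.1, h.2⟩⟩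
        rw [hsub, ← setIntegral_indicator measurableSet_Iio]
        refine integral_congr_ae (ae_of_all _ fun s => ?_)
        simp only [Set.indicator, Set.mem_ofPred_eq, Set.mem_Iio, mul_comm]

theorem integral_mul_exp (c r : ℝ) :
    ∫ s in (0 : ℝ)..r, c * Real.exp (c * s) = Real.exp (c * r) - 1 := by
  have hder : ∀ s ∈ Set.uIcc 0 r, HasDerivAt (fun s => Real.exp (c * s))
      (c * Real.exp (c * s)) s := fun s _ => by
    have := ((hasDerivAt_id s).const_mul c).exp
    refine this.congr_deriv ?_
    simp; ring
  rw [intervalIntegral.integral_eq_sub_of_hasDerivAt hder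
    ((by fun_prop : Continuous fun s => c * Real.exp (c * s)).intervalIntegrable _ _)]
  simp

/-- From the mild to the integrated form of the equation `y' = c y - q` on `[0, θ]`. -/
theorem integrated_of_mild {c R θ y₀ : ℝ} {q y : ℝ → ℝ} (hθ : 0 ≤ θ)
    (hq : IntervalIntegrable q volume 0 θ) (hy : IntervalIntegrable y volume 0 θ)
    (heq : ∀ᵐ s, s ∈ Set.Ioc 0 θ → y s = Real.exp (-c * (θ - s)) * R +
      ∫ r in s..θ, Real.exp (-c * (r - s)) * q r)
    (h0 : y₀ = Real.exp (-c * θ) * R + ∫ r in (0 : ℝ)..θ, Real.exp (-c * r) * q r) :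
    y₀ = R + ∫ s in (0 : ℝ)..θ, (q s - c * y s) := by
  have hp : IntervalIntegrable (fun r => Real.exp (-c * r) * q r) volume 0 θ :=
    hq.continuousOn_mul (by fun_prop)
  have hg : IntervalIntegrable (fun s => c * Real.exp (c * s)) volume 0 θ :=
    (by fun_prop : Continuous fun s => c * Real.exp (c * s)).intervalIntegrable _ _
  have htail : IntervalIntegrable (fun s => c * Real.exp (c * s) *
      ∫ r in s..θ, Real.exp (-c * r) * q r) volume 0 θ := by
    refine hg.mul_continuousOn ?_
    exact intervalIntegral.continuousOn_primitive_interval_left 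
      ((intervalIntegrable_iff' enorm_ne_top).1 hp)
  -- The factor `c e^{cs}` has an explicit primitive, so exchanging the integrals yields the claim
  -- without differentiating `y`.
  have h1 : ∫ s in (0 : ℝ)..θ, c * y s = ∫ s in (0 : ℝ)..θ,
      (Real.exp (-c * θ) * R * (c * Real.exp (c * s)) +
        c * Real.exp (c * s) * ∫ r in s..θ, Real.exp (-c * r) * q r) := by
    refine intervalIntegral.integral_congr_ae (heq.mono fun s hs hmem => ?_)
    rw [Set.uIoc_of_le hθ] at hmem
    have h2 : ∀ r, Real.exp (-c * (r - s)) * q r =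
        Real.exp (c * s) * (Real.exp (-c * r) * q r) := fun r => by
      rw [← mul_assoc, ← Real.exp_add]; ring_nf
    have h3 : Real.exp (-c * (θ - s)) = Real.exp (-c * θ) * Real.exp (c * s) := by
      rw [← Real.exp_add]; ring_nf
    rw [hs hmem]
    simp_rw [h2]
    rw [intervalIntegral.integral_const_mul, h3]
    ring
  have h2 : ∫ r in (0 : ℝ)..θ, Real.exp (-c * r) * q r * ∫ s in (0 : ℝ)..r, c * Real.exp (c * s) =
      (∫ r in (0 : ℝ)..θ, q r) - ∫ r in (0 : ℝ)..θ, Real.exp (-c * r) * q r := by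
    rw [← intervalIntegral.integral_sub hq hp]
    refine intervalIntegral.integral_congr fun r _ => ?_
    have : Real.exp (-c * r) * Real.exp (c * r) = 1 := by rw [← Real.exp_add]; simp
    simp only [integral_mul_exp]
    linear_combination q r * this
  have h3 : Real.exp (-c * θ) * Real.exp (c * θ) = 1 := by rw [← Real.exp_add]; simp
  rw [intervalIntegral.integral_sub hq (hy.const_mul c), h1,
    intervalIntegral.integral_add (hg.const_mul _) htail, intervalIntegral.integral_const_mul,
    integral_mul_exp, integral_mul_integral_tail hθ hg hp, h2, h0]
  linear_combination R * h3

/-- From the integrated to the mild form of the equation `y' = c y - q` on `[0, θ]`. -/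
theorem mild_of_integrated {c R θ : ℝ} {q y : ℝ → ℝ} (hθ : 0 ≤ θ)
    (hq : IntervalIntegrable q volume 0 θ) (hy : IntervalIntegrable y volume 0 θ)
    (heq : ∀ᵐ s, s ∈ Set.Ioc 0 θ → y s = R + ∫ r in s..θ, (q r - c * y r)) :
    R + ∫ s in (0 : ℝ)..θ, (q s - c * y s) =
      Real.exp (-c * θ) * R + ∫ r in (0 : ℝ)..θ, Real.exp (-c * r) * q r := by
  have hp : IntervalIntegrable (fun r => q r - c * y r) volume 0 θ := hq.sub (hy.const_mul c)
  have hg : IntervalIntegrable (fun s => -c * Real.exp (-c * s)) volume 0 θ :=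
    (by fun_prop : Continuous fun s => -c * Real.exp (-c * s)).intervalIntegrable _ _
  have hqe : IntervalIntegrable (fun r => Real.exp (-c * r) * q r) volume 0 θ :=
    hq.continuousOn_mul (by fun_prop)
  have hye : IntervalIntegrable (fun r => -c * Real.exp (-c * r) * y r) volume 0 θ :=
    hy.continuousOn_mul (by fun_prop)
  have htail : IntervalIntegrable (fun s => -c * Real.exp (-c * s) *
      ∫ r in s..θ, (q r - c * y r)) volume 0 θ := by
    refine hg.mul_continuousOn ?_
    exact intervalIntegral.continuousOn_primitive_interval_left 
      ((intervalIntegrable_iff' enorm_ne_top).1 hp)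
  -- Testing against the derivative of the integrating factor `e^{-cs}` makes the terms containing
  -- `y` cancel after the exchange of integrals.
  have h1 : ∫ s in (0 : ℝ)..θ, -c * Real.exp (-c * s) * y s = ∫ s in (0 : ℝ)..θ,
      (R * (-c * Real.exp (-c * s)) +
        -c * Real.exp (-c * s) * ∫ r in s..θ, (q r - c * y r)) := by
    refine intervalIntegral.integral_congr_ae (heq.mono fun s hs hmem => ?_)
    rw [Set.uIoc_of_le hθ] at hmem
    conv_lhs => rw [hs hmem]
    ring
  have h2 : ∫ r in (0 : ℝ)..θ, (q r - c * y r) * ∫ s in (0 : ℝ)..r, -c * Real.exp (-c * s) =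
      (∫ r in (0 : ℝ)..θ, Real.exp (-c * r) * q r) +
        (∫ r in (0 : ℝ)..θ, -c * Real.exp (-c * r) * y r) -
        ∫ r in (0 : ℝ)..θ, (q r - c * y r) := by
    rw [← intervalIntegral.integral_add hqe hye, ← intervalIntegral.integral_sub (hqe.add hye) hp]
    refine intervalIntegral.integral_congr fun r _ => ?_
    simp only [integral_mul_exp]
    ring
  rw [intervalIntegral.integral_add (hg.const_mul _) htail, intervalIntegral.integral_const_mul,
    integral_mul_exp, integral_mul_integral_tail hθ hg hp, h2] at h1
  linarith

/-! ### Null sets -/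

theorem volume_hyperplane (c : ℝ) : volume {x : Plane | x 0 = c} = 0 := by
  have h1 : MeasurableSet {f : Fin 2 → ℝ | f 0 = c} :=
    measurableSet_eq_fun (measurable_pi_apply 0) measurable_const
  have h2 := (PiLp.volume_preserving_ofLp (Fin 2)).measure_preimage h1.nullMeasurableSet
  have h3 : volume {f : Fin 2 → ℝ | f 0 = c} = 0 :=
    Measure.pi_hyperplane (fun _ : Fin 2 => (volume : Measure ℝ)) 0 c
  exact h2.trans h3

theorem toSphere_eq_zero_of_cone {E : Type*} [NormedAddCommGroup E] [NormedSpace ℝ E]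
    [MeasurableSpace E] [BorelSpace E] {μ : Measure E} {s : Set (Metric.sphere (0 : E) 1)}
    (hs : MeasurableSet s) (h0 : μ (Set.Ioo (0 : ℝ) 1 • ((↑) '' s : Set E)) = 0) :
    μ.toSphere s = 0 := by
  rw [Measure.toSphere_apply' _ hs, h0, mul_zero]

theorem ae_velocity_ne_zero : ∀ᵐ z ∂phaseMeasure, (z.2 : Plane) 0 ≠ 0 := by
  have h1 : circleMeasure {v : S1 | (v : Plane) 0 = 0} = 0 := by
    have hm : MeasurableSet {v : S1 | (v : Plane) 0 = 0} :=
      (by fun_prop : Measurable fun v : S1 => (v : Plane) 0) (measurableSet_singleton 0)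
    refine toSphere_eq_zero_of_cone hm (measure_mono_null ?_ (volume_hyperplane 0))
    rintro _ ⟨c, -, _, ⟨v, hv, rfl⟩, rfl⟩
    have hv' : (v : Plane) 0 = 0 := hv
    simp [hv']
  have h2 : ∀ᵐ v : S1 ∂circleMeasure, (v : Plane) 0 ≠ 0 := by
    rw [ae_iff]
    simpa only [not_not] using h1
  rw [phaseMeasure_eq]
  exact Measure.quasiMeasurePreserving_snd.ae h2

theorem ae_notMem_slabBoundary (L : ℝ) : ∀ᵐ z ∂phaseMeasure, z.1 ∉ slabBoundary L := by
  have h1 : ∀ᵐ x : Plane, x ∉ slabBoundary L := by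
    rw [ae_iff]
    simp only [not_not]
    exact measure_union_null (volume_hyperplane 0) (volume_hyperplane L)
  rw [phaseMeasure_eq]
  exact Measure.quasiMeasurePreserving_fst.ae h1

/-- By Fubini and invariance, almost every ray meets a given null set only for a null set of times.
This lets an equation known almost everywhere be used along characteristics. -/
theorem ae_stream {P : Phase → Prop} (hP : ∀ᵐ z ∂phaseMeasure, P z) :
    ∀ᵐ z ∂phaseMeasure, ∀ᵐ s : ℝ, P (stream s z) := by
  set N := toMeasurable phaseMeasure {z | ¬ P z}
  have hN : MeasurableSet N := measurableSet_toMeasurable _ _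
  have hN0 : phaseMeasure N = 0 := by
    rw [measure_toMeasurable]
    exact hP
  have hm : MeasurableSet {q : Phase × ℝ | stream q.2 q.1 ∉ N} :=
    (measurable_stream.comp measurable_swap) hN.compl
  have h1 : ∀ᵐ z ∂phaseMeasure, ∀ᵐ s : ℝ, stream s z ∉ N := by
    refine (Measure.ae_ae_comm hm).2 (ae_of_all _ fun s => ?_)
    rw [ae_iff]
    simp only [not_not]
    exact ((measurePreserving_stream s).measure_preimage hN.nullMeasurableSet).trans hN0
  filter_upwards [h1] with z hz
  filter_upwards [hz] with s hs
  by_contra hc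
  exact hs (subset_toMeasurable _ _ hc)

theorem ae_collide {P : Phase → Prop} (hP : ∀ᵐ z ∂phaseMeasure, P z) :
    ∀ᵐ z ∂phaseMeasure, ∀ᵐ s : ℝ, ∀ᵐ ρ ∂volume.restrict (Set.Ioc (-1 : ℝ) 1),
      P (collideAt ρ (stream s z)) := by
  set N := toMeasurable phaseMeasure {z | ¬ P z}
  have hN : MeasurableSet N := measurableSet_toMeasurable _ _
  have hN0 : phaseMeasure N = 0 := by
    rw [measure_toMeasurable]
    exact hP
  have h1 := ae_collide_notMem (E := Prod.snd ⁻¹' N) (measurable_snd hN) (fun _ => hN0)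
    (σ := id) measurable_id
  filter_upwards [h1] with z hz
  filter_upwards [Measure.ae_ae_of_ae_prod hz] with s hs
  filter_upwards [hs] with ρ hρ
  by_contra hc
  exact hρ (subset_toMeasurable _ _ hc)

theorem ae_slabMeasure_iff {P : Phase → Prop} :
    (∀ᵐ z ∂slabMeasure L, P z) ↔ ∀ᵐ z ∂phaseMeasure, z ∈ slabPhase L → P z :=
  ae_restrict_iff' (measurableSet_slabPhase L)

/-- A bounded measurable representative. -/
theorem exists_measurable_bounded {ν : Measure Phase} {f : Phase → ℝ}
    (hf : AEStronglyMeasurable f ν) (hM : ∀ᵐ z ∂ν, |f z| ≤ M) (hM0 : 0 ≤ M) :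
    ∃ f' : Phase → ℝ, Measurable f' ∧ (∀ z, |f' z| ≤ M) ∧ f =ᵐ[ν] f' := by
  refine ⟨fun z => max (-M) (min M (hf.mk f z)), ?_, fun z => ?_, ?_⟩
  · exact measurable_const.max (measurable_const.min hf.stronglyMeasurable_mk.measurable)
  · exact abs_le.2 ⟨le_max_left _ _, max_le (by linarith) (min_le_left _ _)⟩
  · filter_upwards [hf.ae_eq_mk, hM] with z hz hb
    rw [← hz, min_eq_right (abs_le.1 hb).2, max_eq_right (abs_le.1 hb).1]

theorem ae_abs_le_toReal_eLpNorm {ν : Measure Phase} {f : Phase → ℝ} (hf : MemLp f ⊤ ν) :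
    ∀ᵐ z ∂ν, |f z| ≤ (eLpNorm f ⊤ ν).toReal := by
  have h1 := ae_le_eLpNormEssSup (f := f) (μ := ν)
  have h2 := hf.2
  rw [eLpNorm_exponent_top] at h2 ⊢
  filter_upwards [h1] with z hz
  have := ENNReal.toReal_mono h2.ne hz
  simpa using this

/-! ### Mild and stationary solutions -/

theorem mul_boltzmannOp {μ η : ℝ} (hm : Measurable h) (hM : ∀ w, |h w| ≤ M) (z : Phase) :
    η * boltzmannOp μ h z = μ * η * scatterIntegral h z - 2 * (μ * η) * h z := by
  have h1 : ∫ ρ in (-1 : ℝ)..1, (h (z.1, scatter ρ z.2) - h z) =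
      scatterIntegral h z - ∫ _ in (-1 : ℝ)..1, h z :=
    intervalIntegral.integral_sub (intervalIntegrable_collideAt hm fun ρ => hM _)
      intervalIntegrable_const
  rw [boltzmannOp, h1]
  simp
  ring

theorem stream_mem_slabPhase_of_lt_entryTime {s : ℝ} (hz : z ∈ slabPhase L)
    (hv : (z.2 : Plane) 0 ≠ 0) (hs : 0 ≤ s) (hst : s < entryTime L z) :
    stream s z ∈ slabPhase L := by
  refine stream_mem_slabPhase hz hs hst ?_
  have hL : 0 < L := hz.1.trans hz.2
  rw [mem_closedSlabPhase, stream_fst_zero, entryTime]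
  split_ifs
  · rw [div_mul_cancel₀ _ hv]
    constructor <;> linarith
  · rw [div_mul_cancel₀ _ hv]
    constructor <;> linarith

theorem intervalIntegrable_stream (hm : Measurable h) (hM : ∀ w, |h w| ≤ M) (z : Phase)
    (a b : ℝ) : IntervalIntegrable (fun s => h (stream s z)) volume a b :=
  intervalIntegrable_of_abs_le (hm.comp (measurable_stream_left z)) fun _ _ => hM _

theorem abs_scatterIntegral_le_of_forall (hM : ∀ w, |h w| ≤ M) (z : Phase) :
    |scatterIntegral h z| ≤ 2 * M := abs_scatterIntegral_le fun _ => hM _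

theorem integral_stream_shift (f : ℝ → ℝ) (s θ : ℝ) :
    ∫ r in (0 : ℝ)..(θ - s), f (r + s) = ∫ r in s..θ, f r := by
  rw [intervalIntegral.integral_comp_add_right (fun r => f r)]
  simp

/-- Along a characteristic the mild form is the variation of constants formula for `y' = 2κy - q`,
with `y` the streamed solution and `q` the gain. `integrated_of_mild` removes the exponentials. -/
theorem IsMildSolution.isStationarySolution {μ η ρ₁ ρ₂ : ℝ}
    (hh : IsMildSolution L (μ * η) ρ₁ ρ₂ h) (hm : Measurable h) (hM : ∀ w, |h w| ≤ M) :
    IsStationarySolution L μ η ρ₁ ρ₂ h := by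
  refine ae_slabMeasure_iff.2 (ae_velocity_ne_zero.mono fun z hv hz => ?_)
  set κ := μ * η with hκ
  set θ := entryTime L z with hθ
  have hθ0 : 0 ≤ θ := entryTime_nonneg hz
  set R := reservoir L ρ₁ ρ₂ (stream θ z) with hR
  have hqm := measurable_scatterIntegral hm
  have hq : IntervalIntegrable (fun s => κ * scatterIntegral h (stream s z)) volume 0 θ :=
    (intervalIntegrable_stream hqm (abs_scatterIntegral_le_of_forall hM) z 0 θ).const_mul κ
  have hmild : ∀ s, 0 ≤ s → stream s z ∈ slabPhase L → h (stream s z) =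
      Real.exp (-(2 * κ) * (θ - s)) * R + ∫ r in s..θ, Real.exp (-(2 * κ) * (r - s)) *
        (κ * scatterIntegral h (stream r z)) := by
    intro s _ hs
    rw [hh.1 _ hs, freeReturn_eq_integral_entryTime hs hv, boundaryValue, entryTime_stream hv,
      stream_stream, add_sub_cancel, ← hθ, ← hR, ← integral_stream_shift _ s θ]
    congr 1
    · ring_nf
    · refine intervalIntegral.integral_congr fun r _ => ?_
      simp only [stream_stream, add_sub_cancel_right]
      rw [add_comm s r]
      ring_nf
  have h0 := hmild 0 le_rfl (by simpa using hz)
  have key := integrated_of_mild (c := 2 * κ) (R := R) (y₀ := h z)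
    (q := fun s => κ * scatterIntegral h (stream s z)) (y := fun s => h (stream s z)) hθ0 hq
    (intervalIntegrable_stream hm hM z 0 θ) ?_ (by simpa using h0)
  · rw [key]
    congr 1
    refine intervalIntegral.integral_congr fun s _ => ?_
    exact (mul_boltzmannOp hm hM (stream s z)).symm
  · have hne : ∀ᵐ s : ℝ, s ≠ θ := by simp [ae_iff]
    filter_upwards [hne] with s hs hmem
    exact hmild s hmem.1.le (stream_mem_slabPhase_of_lt_entryTime hz hv hmem.1.le
      (lt_of_le_of_ne hmem.2 hs))

/-- The collision operator evaluates both the streamed and the scattered point. By `ae_stream` and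
`ae_collide` the two functions agree at both along almost every characteristic. -/
theorem IsStationarySolution.congr_ae {μ η ρ₁ ρ₂ : ℝ} {g g' : Phase → ℝ}
    (hg : IsStationarySolution L μ η ρ₁ ρ₂ g) (hgg : g =ᵐ[slabMeasure L] g') :
    IsStationarySolution L μ η ρ₁ ρ₂ g' := by
  have h1 := ae_slabMeasure_iff.1 hgg
  refine ae_slabMeasure_iff.2 ?_
  filter_upwards [ae_slabMeasure_iff.1 hg, h1, ae_stream h1, ae_collide h1, ae_velocity_ne_zero]
    with z hz hzz hs hc hv hmem
  rw [← hzz hmem, hz hmem]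
  congr 1
  have hne : ∀ᵐ s : ℝ, s ≠ entryTime L z := by simp [ae_iff]
  refine intervalIntegral.integral_congr_ae ?_
  filter_upwards [hs, hc, hne] with s hs hc hne hsmem
  rw [Set.uIoc_of_le (entryTime_nonneg hmem)] at hsmem
  have hin : stream s z ∈ slabPhase L := stream_mem_slabPhase_of_lt_entryTime hmem hv
    hsmem.1.le (lt_of_le_of_ne hsmem.2 hne)
  have hint : ∫ ρ in (-1 : ℝ)..1, (g (collideAt ρ (stream s z)) - g (stream s z)) =
      ∫ ρ in (-1 : ℝ)..1, (g' (collideAt ρ (stream s z)) - g' (stream s z)) := by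
    rw [intervalIntegral.integral_of_le (by norm_num), intervalIntegral.integral_of_le (by norm_num)]
    refine integral_congr_ae ?_
    filter_upwards [hc] with ρ hρ
    rw [hρ (collideAt_mem_slabPhase.2 hin), hs hin]
  exact congrArg (fun x => η * (μ * x)) hint

/-- Almost every characteristic satisfies the equation at its starting point and at almost all of
its further points, which is all that `mild_of_integrated` needs. -/
theorem IsStationarySolution.ae_mild {μ η ρ₁ ρ₂ : ℝ}
    (hh : IsStationarySolution L μ η ρ₁ ρ₂ h) (hm : Measurable h) (hM : ∀ w, |h w| ≤ M) :
    ∀ᵐ z ∂phaseMeasure, z ∈ slabPhase L →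
      h z = boundaryValue L (μ * η) ρ₁ ρ₂ z + freeReturn L (μ * η) h z := by
  set κ := μ * η with hκ
  have h1 := ae_slabMeasure_iff.1 hh
  filter_upwards [h1, ae_stream h1, ae_velocity_ne_zero] with z hz hs hv hmem
  set θ := entryTime L z with hθ
  have hθ0 : 0 ≤ θ := entryTime_nonneg hmem
  set R := reservoir L ρ₁ ρ₂ (stream θ z) with hR
  have hqm := measurable_scatterIntegral hm
  have hq : IntervalIntegrable (fun s => κ * scatterIntegral h (stream s z)) volume 0 θ :=
    (intervalIntegrable_stream hqm (abs_scatterIntegral_le_of_forall hM) z 0 θ).const_mul κ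
  have key := mild_of_integrated (c := 2 * κ) (R := R)
    (q := fun s => κ * scatterIntegral h (stream s z)) (y := fun s => h (stream s z)) hθ0 hq
    (intervalIntegrable_stream hm hM z 0 θ) ?_
  · have h2 : h z = R + ∫ s in (0 : ℝ)..θ,
        (κ * scatterIntegral h (stream s z) - 2 * κ * h (stream s z)) := by
      rw [hz hmem]
      congr 1
      refine intervalIntegral.integral_congr fun s _ => ?_
      exact mul_boltzmannOp hm hM (stream s z)
    rw [h2, key, freeReturn_eq_integral_entryTime hmem hv, boundaryValue, ← hθ, ← hR]
    congr 1
    · ring_nf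
    · refine intervalIntegral.integral_congr fun r _ => ?_
      ring_nf
  · have hne : ∀ᵐ s : ℝ, s ≠ θ := by simp [ae_iff]
    filter_upwards [hs, hne] with s hs hne hsmem
    have hin : stream s z ∈ slabPhase L := stream_mem_slabPhase_of_lt_entryTime hmem hv
      hsmem.1.le (lt_of_le_of_ne hsmem.2 hne)
    have h3 := hs hin
    rw [h3, entryTime_stream hv, ← hθ, ← integral_stream_shift _ s θ]
    congr 1
    · rw [hR]
      have := stream_stream (θ - s) s z
      rw [add_sub_cancel] at this
      rw [← this]
      rfl
    · refine intervalIntegral.integral_congr fun r _ => ?_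
      have h4 := mul_boltzmannOp (μ := μ) (η := η) hm hM (stream r (stream s z))
      rw [stream_stream, add_comm s r] at h4
      refine Eq.trans ?_ h4
      rw [← stream_stream s r, stream_stream, add_comm r s, ← stream_stream r s]
      rfl

end

section

variable {L κ T t M α : ℝ} {z : Phase} {ℓ ℓ' h h' : Phase → ℝ}

/-! ### Uniqueness -/

theorem abs_freeReturn_sub_le {g : Phase → ℝ} {w : Phase → ℝ} {M' : ℝ} (hκ : 0 < κ)
    (hh : Measurable h) (hg : Measurable g) (hw : Measurable w) (hhM : ∀ y, |h y| ≤ M)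
    (hgM : ∀ y, |g y| ≤ M) (hwM : ∀ y, |w y| ≤ M')
    (hae : ∀ᵐ s : ℝ, ∀ᵐ ρ ∂volume.restrict (Set.Ioc (-1 : ℝ) 1),
      collideAt ρ (stream s z) ∈ slabPhase L →
        |g (collideAt ρ (stream s z)) - h (collideAt ρ (stream s z))| ≤
          w (collideAt ρ (stream s z))) :
    |freeReturn L κ g z - freeReturn L κ h z| ≤ freeReturn L κ w z := by
  have hM0 : 0 ≤ M := (abs_nonneg _).trans (hhM z)
  have hM0' : 0 ≤ M' := (abs_nonneg _).trans (hwM z)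
  have h1 : freeReturn L κ g z - freeReturn L κ h z = ∫ s in Set.Ioi (0 : ℝ),
      (κ * Real.exp (-2 * κ * s) * (slabPhase L).indicator (scatterIntegral g) (stream s z) -
        κ * Real.exp (-2 * κ * s) * (slabPhase L).indicator (scatterIntegral h) (stream s z)) :=
    (integral_sub (integrableOn_freeReturn hκ hg (fun y _ => hgM y) hM0 z)
      (integrableOn_freeReturn hκ hh (fun y _ => hhM y) hM0 z)).symm
  rw [h1, ← Real.norm_eq_abs]
  refine norm_integral_le_of_norm_le
    (integrableOn_freeReturn hκ hw (fun y _ => hwM y) hM0' z) (ae_restrict_of_ae ?_)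
  filter_upwards [hae] with s hs
  rw [← mul_sub, norm_mul, Real.norm_of_nonneg (by positivity : 0 ≤ κ * Real.exp (-2 * κ * s))]
  refine mul_le_mul_of_nonneg_left ?_ (by positivity)
  by_cases hz : stream s z ∈ slabPhase L
  · simp only [Set.indicator_of_mem hz]
    rw [scatterIntegral, scatterIntegral, ← intervalIntegral.integral_sub
      (intervalIntegrable_collideAt hg fun ρ => hgM _)
      (intervalIntegrable_collideAt hh fun ρ => hhM _)]
    refine intervalIntegral.norm_integral_le_of_norm_le (by norm_num) ?_
      (intervalIntegrable_collideAt hw fun ρ => hwM _)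
    rw [ae_restrict_iff' measurableSet_Ioc] at hs
    filter_upwards [hs] with ρ hρ hmem
    exact hρ hmem (collideAt_mem_slabPhase.2 hz)
  · simp only [Set.indicator_of_notMem hz, sub_zero, norm_zero, le_refl]

/-- The bounds for the survival probability that are needed below. -/
def SurvivalBound (L κ t α : ℝ) : Prop :=
  ∀ z ∈ slabPhase L, ∀ m,
    ∑ n ∈ Finset.range m, (transport L κ)^[n] (interiorSeed L κ fun _ => 1) t z ≤ α

/-- In the difference of two mild equations the boundary terms cancel, so each application turns a
bound by a multiple of `decay n` into one by the same multiple of `decay (n + 1)`, and `decay` tends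
to zero. -/
theorem IsMildSolution.ae_eq_of_isStationarySolution {μ η ρ₁ ρ₂ : ℝ} {g : Phase → ℝ}
    (hκ : 0 < μ * η) (ht : 0 ≤ t) (hα : 0 ≤ α) (hα1 : α < 1)
    (hsurv : SurvivalBound L (μ * η) t α)
    (hh : IsMildSolution L (μ * η) ρ₁ ρ₂ h) (hm : Measurable h) (hM : ∀ w, |h w| ≤ M)
    (hM0 : 0 ≤ M) (hg : MemLp g ⊤ (slabMeasure L)) (hgs : IsStationarySolution L μ η ρ₁ ρ₂ g) :
    g =ᵐ[slabMeasure L] h := by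
  set κ := μ * η with hκdef
  obtain ⟨g', hgm, hgM, hgg⟩ := exists_measurable_bounded hg.1 (ae_abs_le_toReal_eLpNorm hg)
    ENNReal.toReal_nonneg
  set K := (eLpNorm g ⊤ (slabMeasure L)).toReal with hK
  have hK0 : 0 ≤ K := ENNReal.toReal_nonneg
  have hmild := (hgs.congr_ae hgg).ae_mild hgm hgM
  have hdec : ∀ n, ∀ᵐ z ∂phaseMeasure, z ∈ slabPhase L →
      |g' z - h z| ≤ (K + M) * decay L κ n z := by
    intro n
    induction n with
    | zero =>
      refine ae_of_all _ fun z _ => ?_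
      have : decay L κ 0 z = 1 := rfl
      rw [this, mul_one]
      exact (abs_sub _ _).trans (add_le_add (hgM z) (hM z))
    | succ n ih =>
      filter_upwards [hmild, ae_collide ih] with z hz hc hmem
      rw [hz hmem, hh.1 z hmem, add_sub_add_left_eq_sub, decay_succ_of_mem hmem,
        ← freeReturn_const_mul]
      refine abs_freeReturn_sub_le (M := K + M) (M' := (K + M) * 1) hκ hm hgm
        ((measurable_decay n).const_mul _) (fun y => (hM y).trans (by linarith))
        (fun y => (hgM y).trans (by linarith)) (fun y => ?_) hc
      have h1 := decay_mem_Icc (L := L) hκ n y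
      rw [abs_of_nonneg (mul_nonneg (by linarith) h1.1)]
      exact mul_le_mul_of_nonneg_left h1.2 (by linarith)
  have h2 : ∀ᵐ z ∂slabMeasure L, g' z = h z := by
    refine ae_slabMeasure_iff.2 ?_
    filter_upwards [ae_all_iff.2 hdec] with z hz hmem
    have h3 := (tendsto_decay hκ ht hα hα1 hsurv z).const_mul (K + M)
    rw [mul_zero] at h3
    have h4 := ge_of_tendsto' h3 fun n => hz n hmem
    exact sub_eq_zero.1 (abs_nonpos_iff.1 h4)
  filter_upwards [hgg, h2] with z h3 h4
  rw [h3, h4]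

/-! ### The contraction and the Neumann series -/

theorem ae_abs_semigroup_le (hκ : 0 ≤ κ) (ht : 0 ≤ t) (hα : 0 ≤ α)
    (hsurv : SurvivalBound L κ t α) (hℓ : AEStronglyMeasurable ℓ phaseMeasure)
    (hM : ∀ᵐ z ∂phaseMeasure, |ℓ z| ≤ M) (hM0 : 0 ≤ M) :
    AEStronglyMeasurable (semigroup L κ t ℓ) phaseMeasure ∧
      ∀ᵐ z ∂phaseMeasure, |semigroup L κ t ℓ z| ≤ α * M := by
  obtain ⟨ℓ', hm', hM', heq⟩ := exists_measurable_bounded hℓ hM hM0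
  have h1 := semigroup_congr_ae (L := L) (κ := κ) heq ht
  refine ⟨(measurable_semigroup hκ ht hm' hM').aestronglyMeasurable.congr h1.symm, ?_⟩
  filter_upwards [h1] with z hz
  rw [hz]
  exact abs_semigroup_le hκ ht hα hsurv hm' hM' z

theorem memLp_top_semigroup (hκ : 0 ≤ κ) (ht : 0 ≤ t) (hα : 0 ≤ α)
    (hsurv : SurvivalBound L κ t α) (hℓ : MemLp ℓ ⊤ phaseMeasure) :
    MemLp (semigroup L κ t ℓ) ⊤ phaseMeasure ∧
      eLpNorm (semigroup L κ t ℓ) ⊤ phaseMeasure ≤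
        ENNReal.ofReal α * eLpNorm ℓ ⊤ phaseMeasure := by
  obtain ⟨h1, h2⟩ := ae_abs_semigroup_le hκ ht hα hsurv hℓ.1 (ae_abs_le_toReal_eLpNorm hℓ)
    ENNReal.toReal_nonneg
  refine ⟨memLp_top_of_bound h1 _ h2, ?_⟩
  rw [eLpNorm_exponent_top]
  refine (eLpNormEssSup_le_of_ae_bound h2).trans (le_of_eq ?_)
  rw [ENNReal.ofReal_mul hα, ENNReal.ofReal_toReal hℓ.2.ne]

theorem IsMildSolution.outer_eq {ρ₁ ρ₂ : ℝ} (hh : IsMildSolution L κ ρ₁ ρ₂ h)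
    (hκ : 0 < κ) (hm : Measurable h) (hM : ∀ w, |h w| ≤ M) (ht : 0 ≤ t) :
    outer L κ ρ₁ ρ₂ t = (slabPhase L).indicator fun z => h z - semigroup L κ t h z := by
  funext z
  by_cases hz : z ∈ slabPhase L
  · rw [Set.indicator_of_mem hz]
    linarith [hh.eq_semigroup_add_outer hκ hm hM ht hz]
  · rw [Set.indicator_of_notMem hz, outer_of_notMem hz]

theorem measurable_iterate_semigroup (hκ : 0 ≤ κ) (ht : 0 ≤ t) (hα : 0 ≤ α) (hα1 : α ≤ 1)
    (hsurv : SurvivalBound L κ t α) (hm : Measurable ℓ) (hM : ∀ w, |ℓ w| ≤ M) (n : ℕ) :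
    Measurable ((semigroup L κ t)^[n] ℓ) ∧ ∀ w, |(semigroup L κ t)^[n] ℓ w| ≤ M := by
  induction n with
  | zero => exact ⟨hm, hM⟩
  | succ n ih =>
    simp only [Function.iterate_succ_apply']
    refine ⟨measurable_semigroup hκ ht ih.1 ih.2, fun w => ?_⟩
    have hM0 : 0 ≤ M := (abs_nonneg _).trans (hM w)
    exact (abs_semigroup_le hκ ht hα hsurv ih.1 ih.2 w).trans
      (mul_le_of_le_one_left hM0 hα1)

/-- Partial sums of the Neumann series. -/
def neumannSum (L κ t : ℝ) (f : Phase → ℝ) (m : ℕ) (z : Phase) : ℝ :=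
  ∑ n ∈ Finset.range m, (semigroup L κ t)^[n] f z

theorem measurable_neumannSum (hκ : 0 ≤ κ) (ht : 0 ≤ t) (hα : 0 ≤ α) (hα1 : α ≤ 1)
    (hsurv : SurvivalBound L κ t α) (hm : Measurable ℓ) (hM : ∀ w, |ℓ w| ≤ M) (m : ℕ) :
    Measurable (neumannSum L κ t ℓ m) ∧ ∀ w, |neumannSum L κ t ℓ m w| ≤ m * M := by
  have h1 := measurable_iterate_semigroup hκ ht hα hα1 hsurv hm hM
  refine ⟨Finset.measurable_sum _ fun n _ => (h1 n).1, fun w => ?_⟩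
  refine (Finset.abs_sum_le_sum_abs _ _).trans ?_
  refine (Finset.sum_le_sum fun n _ => (h1 n).2 w).trans (le_of_eq ?_)
  simp

/-- Additivity of the semigroup is available for bounded measurable functions, so the induction
carries these properties of the partial sums along. -/
theorem neumannSum_succ (hκ : 0 ≤ κ) (ht : 0 ≤ t) (hα : 0 ≤ α) (hα1 : α ≤ 1)
    (hsurv : SurvivalBound L κ t α) (hm : Measurable ℓ) (hM : ∀ w, |ℓ w| ≤ M) (m : ℕ)
    (z : Phase) :
    neumannSum L κ t ℓ (m + 1) z = ℓ z + semigroup L κ t (neumannSum L κ t ℓ m) z := by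
  induction m with
  | zero =>
    have h1 : neumannSum L κ t ℓ 0 = fun _ => 0 := by funext w; simp [neumannSum]
    have h2 := abs_semigroup_le (L := L) (ℓ := fun _ => 0) (M := 0) hκ ht hα hsurv
      measurable_const (fun _ => by simp) z
    rw [mul_zero, abs_nonpos_iff] at h2
    rw [h1, h2]
    simp [neumannSum]
  | succ m ih =>
    have h1 : neumannSum L κ t ℓ (m + 1) =
        neumannSum L κ t ℓ m + (semigroup L κ t)^[m] ℓ := by
      funext w
      simp [neumannSum, Finset.sum_range_succ]
    have h2 : neumannSum L κ t ℓ (m + 1 + 1) z =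
        neumannSum L κ t ℓ (m + 1) z + (semigroup L κ t)^[m + 1] ℓ z := by
      simp [neumannSum, Finset.sum_range_succ]
    have h3 := measurable_neumannSum hκ ht hα hα1 hsurv hm hM m
    have h4 := measurable_iterate_semigroup hκ ht hα hα1 hsurv hm hM m
    rw [h2, ih, Function.iterate_succ_apply']
    conv_rhs => rw [h1]
    rw [semigroup_add hκ ht h3.1 h4.1 h3.2 h4.2]
    ring

/-- In the strip `h = S⁰(t)h + h^out`, so the error after `m + 1` terms is the image under `S⁰(t)`
of the error after `m` terms. -/
theorem IsMildSolution.tendsto_neumannSum {ρ₁ ρ₂ : ℝ} (hκ : 0 < κ) (ht : 0 ≤ t) (hα : 0 ≤ α)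
    (hα1 : α < 1) (hsurv : SurvivalBound L κ t α) (hh : IsMildSolution L κ ρ₁ ρ₂ h)
    (hm : Measurable h) (hM : ∀ w, |h w| ≤ M) (hM0 : 0 ≤ M) :
    Tendsto (fun m => eLpNorm (fun z => neumannSum L κ t (outer L κ ρ₁ ρ₂ t) m z - h z) ⊤
      (slabMeasure L)) atTop (𝓝 0) := by
  set f := outer L κ ρ₁ ρ₂ t with hf
  have hfeq := hh.outer_eq hκ hm hM ht
  have hfm : Measurable f := by
    rw [hf, hfeq]
    exact (hm.sub (measurable_semigroup hκ.le ht hm hM)).indicator (measurableSet_slabPhase L)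
  have hfM : ∀ w, |f w| ≤ M + α * M := fun w => by
    rw [hf, hfeq]
    by_cases hw : w ∈ slabPhase L
    · rw [Set.indicator_of_mem hw]
      exact (abs_sub _ _).trans
        (add_le_add (hM w) (abs_semigroup_le hκ.le ht hα hsurv hm hM w))
    · rw [Set.indicator_of_notMem hw, abs_zero]
      positivity
  have hP := measurable_neumannSum hκ.le ht hα hα1.le hsurv hfm hfM
  have hbound : ∀ m, ∀ᵐ z ∂phaseMeasure, |h z - neumannSum L κ t f m z| ≤ α ^ m * M := by
    intro m
    induction m with
    | zero => exact ae_of_all _ fun z => by simpa [neumannSum] using hM z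
    | succ m ih =>
      have h1 := (ae_abs_semigroup_le hκ.le ht hα hsurv
        (hm.sub (hP m).1).aestronglyMeasurable ih (by positivity)).2
      filter_upwards [h1, ae_notMem_slabBoundary L] with z hz hb
      by_cases hmem : z ∈ slabPhase L
      · have h2 := hh.eq_semigroup_add_outer hκ hm hM ht hmem
        have h3 := neumannSum_succ hκ.le ht hα hα1.le hsurv hfm hfM m z
        have h4 := semigroup_sub (L := L) hκ.le ht hm (hP m).1 hM (hP m).2 z
        have h5 : h z - neumannSum L κ t f (m + 1) z =
            semigroup L κ t (h - neumannSum L κ t f m) z := by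
          rw [h3, h4, hf]
          linarith
        rw [h5, pow_succ', mul_assoc]
        exact hz
      -- Outside the strip `h` is the reservoir function, which lives on the two boundary lines, a
      -- null set.
      · have h2 : h z = 0 := by
          rw [mem_slabBoundary, not_or] at hb
          rw [hh.2 z hmem, reservoir, if_neg fun h => hb.1 h.1, if_neg fun h => hb.2 h.1]
        have h3 : ∀ n, (semigroup L κ t)^[n] f z = 0 := fun n => by
          cases n with
          | zero => exact outer_of_notMem hmem
          | succ n =>
            rw [Function.iterate_succ_apply']
            exact semigroup_of_notMem hmem
        rw [h2, neumannSum, Finset.sum_eq_zero fun n _ => h3 n, sub_zero, abs_zero]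
        positivity
  have hle : ∀ m, eLpNorm (fun z => neumannSum L κ t f m z - h z) ⊤ (slabMeasure L) ≤
      ENNReal.ofReal (α ^ m * M) := by
    intro m
    rw [eLpNorm_exponent_top]
    refine eLpNormEssSup_le_of_ae_bound (ae_restrict_of_ae ?_)
    filter_upwards [hbound m] with z hz
    rwa [Real.norm_eq_abs, abs_sub_comm]
  have hlim : Tendsto (fun m : ℕ => ENNReal.ofReal (α ^ m * M)) atTop (𝓝 0) := by
    have := (tendsto_pow_atTop_nhds_zero_of_lt_one hα hα1).mul_const M
    rw [zero_mul] at this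
    simpa using ENNReal.tendsto_ofReal this
  exact tendsto_of_tendsto_of_tendsto_of_le_of_le tendsto_const_nhds hlim
    (fun _ => zero_le) hle

/-- For large `η` the survival probability at time `η` is at most a constant that does not depend
on `η`. -/
theorem exists_survivalBound {μ : ℝ} (hL : 0 < L) (hμ : 0 < μ) :
    ∃ α : ℝ, 0 ≤ α ∧ α < 1 ∧ ∃ η₀ : ℝ, 0 < η₀ ∧
      ∀ η, η₀ ≤ η → SurvivalBound L (μ * η) η α := by
  -- This gives `k ≥ 1` and `k ≥ 8μ(L + 1)`, hence `kL + 1 ≤ k(L + 1) ≤ k²/(8μ)`, and the last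
  -- quantity is `λη` for every `η`.
  set k := 8 * μ * (L + 1) + 1 with hk
  have hk1 : 1 ≤ k := by
    have : 0 ≤ 8 * μ * (L + 1) := by positivity
    linarith
  have hk0 : 0 < k := by linarith
  have hexp : Real.exp (-(k * L)) ≤ 1 := Real.exp_le_one_iff.2 (by nlinarith)
  refine ⟨1 - 4 / 11 * Real.exp (-(k * L)), by linarith,
    by linarith [Real.exp_pos (-(k * L))], 4 * k / μ, by positivity, fun η hη z hz m => ?_⟩
  have hη0 : 0 < η := lt_of_lt_of_le (by positivity) hη
  have h1 : 4 * k ≤ μ * η := by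
    rw [div_le_iff₀ hμ] at hη
    linarith
  refine survival_sum_le hk0 h1 hη0.le ?_ hz m
  have h2 : k ^ 2 / (8 * (μ * η)) * η = k ^ 2 / (8 * μ) := by
    field_simp
  rw [h2, le_div_iff₀ (by positivity)]
  nlinarith [mul_pos hμ hk0, mul_nonneg hμ.le (sub_nonneg.2 hk1)]

end

end SlabBoltzmann

end

/-! ### Contraction, stationary solution and Neumann series for small `ε` -/

theorem mainTheorem7 (L μ ρ₁ ρ₂ : ℝ) (hL : 0 < L) (hμ : 0 < μ) (hρ₁ : 0 < ρ₁) (hρ₂ : 0 < ρ₂)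
    (η : ℝ → ℝ) (hη : SlabBoltzmann.SlowlyDiverging η) :
    ∃ α : ℝ, 0 ≤ α ∧ α < 1 ∧ ∃ ε₀ : ℝ, 0 < ε₀ ∧ ∀ ε : ℝ, 0 < ε → ε < ε₀ →
      (∀ ℓ₀ : SlabBoltzmann.Phase → ℝ, MemLp ℓ₀ ⊤ SlabBoltzmann.phaseMeasure →
        MemLp (SlabBoltzmann.semigroup L (μ * η ε) (η ε) ℓ₀) ⊤ SlabBoltzmann.phaseMeasure ∧
        eLpNorm (SlabBoltzmann.semigroup L (μ * η ε) (η ε) ℓ₀) ⊤ SlabBoltzmann.phaseMeasure ≤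
          ENNReal.ofReal α * eLpNorm ℓ₀ ⊤ SlabBoltzmann.phaseMeasure) ∧
      ∃ h : SlabBoltzmann.Phase → ℝ,
        MemLp h ⊤ (SlabBoltzmann.slabMeasure L) ∧
        SlabBoltzmann.IsStationarySolution L μ (η ε) ρ₁ ρ₂ h ∧
        (∀ g : SlabBoltzmann.Phase → ℝ, MemLp g ⊤ (SlabBoltzmann.slabMeasure L) →
          SlabBoltzmann.IsStationarySolution L μ (η ε) ρ₁ ρ₂ g →
          g =ᵐ[SlabBoltzmann.slabMeasure L] h) ∧
        Tendsto (fun m : ℕ => eLpNorm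
            (fun z => (∑ n ∈ Finset.range m,
              (SlabBoltzmann.semigroup L (μ * η ε) (η ε))^[n]
                (SlabBoltzmann.outer L (μ * η ε) ρ₁ ρ₂ (η ε)) z) - h z)
            ⊤ (SlabBoltzmann.slabMeasure L)) atTop (𝓝 0) := by
  obtain ⟨α, hα0, hα1, η₀, hη₀, hsurv⟩ := SlabBoltzmann.exists_survivalBound hL hμ
  have hev : ∀ᶠ ε in 𝓝[>] (0 : ℝ), η₀ ≤ η ε := hη.1.eventually_ge_atTop η₀
  obtain ⟨ε₀, hε₀, hsub⟩ := mem_nhdsGT_iff_exists_Ioo_subset.1 hev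
  refine ⟨α, hα0, hα1, ε₀, hε₀, fun ε hε hεε₀ => ?_⟩
  have hge : η₀ ≤ η ε := hsub ⟨hε, hεε₀⟩
  have hηpos : 0 < η ε := hη₀.trans_le hge
  have hκ : 0 < μ * η ε := mul_pos hμ hηpos
  have hbound := hsurv _ hge
  refine ⟨fun ℓ₀ hℓ₀ =>
    SlabBoltzmann.memLp_top_semigroup hκ.le hηpos.le hα0 hbound hℓ₀, ?_⟩
  obtain ⟨h, hm, hI, hmild⟩ := SlabBoltzmann.exists_isMildSolution (L := L)
    (M := max ρ₁ ρ₂) hκ ⟨hρ₁.le, le_max_left ρ₁ ρ₂⟩ ⟨hρ₂.le, le_max_right ρ₁ ρ₂⟩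
  have hM : ∀ w, |h w| ≤ max ρ₁ ρ₂ := fun w => SlabBoltzmann.abs_le_of_mem_Icc_zero (hI w)
  have hM0 : 0 ≤ max ρ₁ ρ₂ := hρ₁.le.trans (le_max_left ρ₁ ρ₂)
  exact ⟨h, memLp_top_of_bound hm.aestronglyMeasurable _ (ae_of_all _ hM),
    hmild.isStationarySolution hm hM,
    fun g hg hgs => hmild.ae_eq_of_isStationarySolution hκ hηpos.le hα0 hα1 hbound hm hM hM0
      hg hgs,
    hmild.tendsto_neumannSum hκ hηpos.le hα0 hα1 hbound hm hM hM0⟩
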